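/- **Notation.** For $z>1$ and complex $\mu,\kappa$ let $$P^\mu_\kappa(z)=\frac{1}{\Gamma(1-\mu)}\Big(\frac{z+1}{z-1}\Big)^{\mu/2}{}_2F_1\Big(-\kappa,\kappa+1;1-\mu;\frac{1-z}{2}\Big),$$ $$Q^\mu_\kappa(z)=\frac{e^{i\mu\pi}\sqrt\pi\,\Gamma(\kappa+\mu+1)}{2^{\kappa+1}\Gamma(\kappa+3/2)}\,(z^2-1)^{\mu/2}z^{-\kappa-\mu-1}{}_2F_1\Big(\frac{\kappa+\mu}{2}+1,\frac{\kappa+\mu+1}{2};\kappa+\frac32;\frac1{z^2}\Big)$$ be the associated Legendre functions of the first and second kind (${}_2F_1$ being continued analytically along the negative real axis). For $\Omega\subseteq(0,\infty)$ let $L_{\sigma,p}(\Omega)$ be the space of measurable $g:\Omega\to\mathbb C$ with $\int_\Omega |g(x)|^p x^{\sigma p-1}\,dx<\infty$, and let $f^*(s)=\int_0^\infty f(x)x^{s-1}dx$ denote the Mellin transform. For $\tau\in\mathbb R$ put $$(F_\mu f)(\tau)=\sqrt\pi\,\Gamma\big(\tfrac12+i\tau-\mu\big)\Gamma\big(\tfrac12-i\tau-\mu\big)\int_0^\infty\Big[P^\mu_{-1/2+i\tau}\Big(\sqrt{\tfrac{1+y}{y}}\Big)\Big]^2f(y)\,dy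 .$$ **Theorem 2.** Let $\mu\in\mathbb C$ with $\operatorname{Re}\mu<1/2$, $1<p\le2$, $q=p/(p-1)$, $-\frac1{2q}<\nu<\min(0,-\operatorname{Re}\mu)$, and let $f\in L_{1-\nu,1}(\mathbb R_+)\cap L_{1-\nu,p}(\mathbb R_+)$. Let $$\varphi(x)=\frac1{2\pi i}\int_{\nu+1/2-i\infty}^{\nu+1/2+i\infty}\frac{\Gamma(1/2-\mu-s)\Gamma(s)\Gamma(1-s)}{\Gamma(s+1/2)\Gamma(1/2-s)\Gamma(1/2+s-\mu)}\,f^*(3/2-s)\,x^{-s}\,ds ,\quad x>0,$$ and suppose that $\varphi\in L_{-1/4,1}(0,1)\cap L_{1/4,1}(1,\infty)$ and $\int_{\mathbb R}|(F_\mu f)(\tau)|\,|\tau|e^{2\pi|\tau|}d\tau<\infty$. Suppose moreover that for some $\gamma<0$: $f\in L_{3/2-\gamma,1}(\mathbb R_+)$; the function $f^*(3/2-s)/s$ is analytic in the open strip $\gamma<\operatorname{Re}s<\nu+1/2$ (that is, its singularity at $s=0$ is removable); and $$\int_{\operatorname{Re}s=\sigma}(1+|s|)^{1-2\sigma}\,\Big|\frac{f^*(3/2-s)}{s}\Big|\,|ds|<\infty\qquad\text{for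 every }\sigma\in[\gamma,\nu+1/2].$$ Then for every $x>0$ $$\int_x^\infty y^{1/2}f(y)\,dy=-\frac{2e^{i\mu\pi}}{\pi\sqrt x}\int_0^\infty\tau\sinh(\pi\tau)\,\Gamma\big(\tfrac12+i\tau-\mu\big)\Gamma\big(\tfrac12-i\tau-\mu\big)P^\mu_{-1/2+i\tau}\Big(\sqrt{\tfrac{1+x}{x}}\Big)$$ $$\times\Big[Q^{-\mu}_{-1/2+i\tau}\Big(\sqrt{\tfrac{1+x}{x}}\Big)+Q^{-\mu}_{-1/2-i\tau}\Big(\sqrt{\tfrac{1+x}{x}}\Big)\Big]\int_0^\infty\Big[P^\mu_{-1/2+i\tau}\Big(\sqrt{\tfrac{1+y}{y}}\Big)\Big]^2f(y)\,dy\,d\tau ,$$ where the integral on the left, the inner integral (for every $\tau$) and the outer integral converge absolutely. Moreover the transform $F_\mu$ is inverted by $$f(x)=\frac{x^{-1/2}}{\pi^2}\frac{d}{dx}\Big[x^{3/2}\int_0^\infty\tau\sinh(2\pi\tau)\,S_\mu(x,\tau)\,(F_\mu f)(\tau)\,d\tau\Big]\qquad\text{for almost all }x>0,$$ with an absolutely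 convergent integral for every $x>0$, where, for any $\gamma_0$ with $\frac32<\gamma_0<\min(2,2-\operatorname{Re}\mu)$, $$S_\mu(x,\tau)=\frac1{2\pi i}\int_{\gamma_0-i\infty}^{\gamma_0+i\infty}\frac{\Gamma(2-s)\Gamma(2-s-\mu)}{\Gamma(s-1-\mu)\Gamma(5/2-s)}\,\Gamma\big(s-\tfrac32+i\tau\big)\Gamma\big(s-\tfrac32-i\tau\big)\,x^{-s}\,ds .$$ -/

import Mathlib

open MeasureTheory Set Complex

noncomputable section

namespace LegendreIndex

/-- Membership of `f` in the weighted Lebesgue space `L_{σ,p}(Ω)`, `Ω ⊆ (0,∞)`, whose norm is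
`(∫_Ω |f(x)|^p x^{σp-1} dx)^{1/p}`. -/
def MemWeightedLp (σ p : ℝ) (Ω : Set ℝ) (f : ℝ → ℂ) : Prop :=
  AEStronglyMeasurable f (volume.restrict Ω) ∧
    IntegrableOn (fun x : ℝ => ‖f x‖ ^ p * x ^ (σ * p - 1)) Ω

/-- The Gauss function `₂F₁(a,b;c;w)`, continued analytically from the unit disc to the half-plane
`Re w < 1/2` by Pfaff's formula
`₂F₁(a,b;c;w) = (1-w)^{-a} ₂F₁(a,c-b;c;w/(w-1))`
(the series on the right converges there, since `|w/(w-1)| < 1` exactly when `Re w < 1/2`). -/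
def gaussF (a b c w : ℂ) : ℂ :=
  (1 - w) ^ (-a) * ordinaryHypergeometric a (c - b) c (w / (w - 1))

/-- The associated Legendre function of the first kind `P^μ_κ(z)` for `z > 1`,
`P^μ_κ(z) = (1/Γ(1-μ)) ((z+1)/(z-1))^{μ/2} ₂F₁(-κ, κ+1; 1-μ; (1-z)/2)`. -/
def legendreP (μ κ : ℂ) (z : ℝ) : ℂ :=
  1 / Gamma (1 - μ) * (((z + 1) / (z - 1) : ℝ) : ℂ) ^ (μ / 2) *
    gaussF (-κ) (κ + 1) (1 - μ) ((1 - z) / 2)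

/-- The associated Legendre function of the second kind `Q^μ_κ(z)` for `z > 1`,
`Q^μ_κ(z) = e^{iμπ} √π Γ(κ+μ+1) / (2^{κ+1} Γ(κ+3/2)) (z²-1)^{μ/2} z^{-κ-μ-1}
  ₂F₁((κ+μ)/2+1, (κ+μ+1)/2; κ+3/2; z^{-2})`. -/
def legendreQ (μ κ : ℂ) (z : ℝ) : ℂ :=
  cexp (I * μ * Real.pi) * (Real.sqrt Real.pi : ℂ) * Gamma (κ + μ + 1) /
      ((2 : ℂ) ^ (κ + 1) * Gamma (κ + 3 / 2)) *
    ((z ^ 2 - 1 : ℝ) : ℂ) ^ (μ / 2) * (z : ℂ) ^ (-κ - μ - 1) *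
    ordinaryHypergeometric ((κ + μ) / 2 + 1) ((κ + μ + 1) / 2) (κ + 3 / 2) (1 / (z : ℂ) ^ 2)

/-- The argument `√((1+y)/y)` of the Legendre functions. -/
def arg (y : ℝ) : ℝ := Real.sqrt ((1 + y) / y)

/-- The product `Γ(1/2 + iτ - μ) Γ(1/2 - iτ - μ)`. -/
def gammaProd (μ : ℂ) (τ : ℝ) : ℂ :=
  Gamma (1 / 2 + I * τ - μ) * Gamma (1 / 2 - I * τ - μ)

/-- `[P^μ_{-1/2+iτ}(√((1+y)/y))]²`. -/
def kernelPP (μ : ℂ) (τ y : ℝ) : ℂ :=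
  legendreP μ (-1 / 2 + I * τ) (arg y) ^ 2

/-- `P^μ_{-1/2+iτ} [Q^{-μ}_{-1/2+iτ} + Q^{-μ}_{-1/2-iτ}]`, all at `√((1+x)/x)`. -/
def kernelPQ (μ : ℂ) (τ x : ℝ) : ℂ :=
  legendreP μ (-1 / 2 + I * τ) (arg x) *
    (legendreQ (-μ) (-1 / 2 + I * τ) (arg x) + legendreQ (-μ) (-1 / 2 - I * τ) (arg x))

/-- The index transform
`(F_μ f)(τ) = √π Γ(1/2+iτ-μ) Γ(1/2-iτ-μ) ∫_0^∞ [P^μ_{-1/2+iτ}(√((1+y)/y))]² f(y) dy`. -/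
def indexTransform (μ : ℂ) (f : ℝ → ℂ) (τ : ℝ) : ℂ :=
  (Real.sqrt Real.pi : ℂ) * gammaProd μ τ * ∫ y in Ioi (0 : ℝ), kernelPP μ τ y * f y

/-- The function `φ`, the inverse Mellin integral over `Re s = ν + 1/2` of
`Γ(1/2-μ-s) Γ(s) Γ(1-s) / (Γ(s+1/2) Γ(1/2-s) Γ(1/2+s-μ)) f*(3/2-s)`. -/
def phi (μ : ℂ) (ν : ℝ) (f : ℝ → ℂ) : ℝ → ℂ :=
  mellinInv (ν + 1 / 2) fun s =>
    Gamma (1 / 2 - μ - s) * Gamma s * Gamma (1 - s) /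
      (Gamma (s + 1 / 2) * Gamma (1 / 2 - s) * Gamma (1 / 2 + s - μ)) * mellin f (3 / 2 - s)

/-- The kernel `S_μ(x,τ)`, the inverse Mellin integral over `Re s = c` of
`Γ(2-s) Γ(2-s-μ) / (Γ(s-1-μ) Γ(5/2-s)) Γ(s-3/2+iτ) Γ(s-3/2-iτ)`. -/
def kernelS (μ : ℂ) (c x τ : ℝ) : ℂ :=
  mellinInv c (fun s =>
    Gamma (2 - s) * Gamma (2 - s - μ) / (Gamma (s - 1 - μ) * Gamma (5 / 2 - s)) *
      Gamma (s - 3 / 2 + I * τ) * Gamma (s - 3 / 2 - I * τ)) x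

/-- The function `x^{3/2} ∫_0^∞ τ sinh(2πτ) S_μ(x,τ) g(τ) dτ`. -/
def inverseIntegral (μ : ℂ) (c : ℝ) (g : ℝ → ℂ) (x : ℝ) : ℂ :=
  ((x ^ (3 / 2 : ℝ) : ℝ) : ℂ) *
    ∫ τ in Ioi (0 : ℝ), ((τ * Real.sinh (2 * Real.pi * τ) : ℝ) : ℂ) * kernelS μ c x τ * g τ

end LegendreIndex

end

noncomputable section

namespace LegendreIndex

open Filter Topology Asymptotics
open scoped FourierTransform

/-! Put b = 1/2 - μ and x = exp ξ. On the Mellin side both kernels split into Γ(s+iτ)Γ(s-iτ) times a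
factor free of τ. With G(s) = f*(3/2-s)/s and h = `symbolPP b G`, Parseval's equality turns the
index transform into F(τ) = (2π)⁻¹ ∫ Γ(s+iτ)Γ(s-iτ) h(s) |ds| over a line in the right half-plane.
The kernel contributes a factor Γ(s) with a pole at 0. Since Γ(s) f*(3/2-s) = Γ(s+1) G(s) and G is
holomorphic at 0, h is holomorphic across Re s = 0.

The heart is the inversion of this transform, `gammaTransform_eq`: ∫_0^∞ τ sinh(2πτ) Γ(s+iτ)Γ(s-iτ)
F(τ) dτ = π² h(-s) for small Re s > 0. By the beta integral, Γ(s+iτ)Γ(s-iτ) = 2Γ(2s) ∫ e^{2iτv} (2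
cosh v)^{-2s} dv, so F is the Fourier transform of an explicit function of v. Fourier inversion,
differentiated in v, expresses the sine transform of τF(τ) as tanh v times the Mellin–Barnes
integral of Γ(2s+1) h(s) at (2 cosh v)². The closed form `tanh_mul_barnesJ` gives the same
expression with h(s) replaced by π⁻² times the left side of the inversion formula at -s. A Fourier
uniqueness theorem then identifies the two symbols.

Next, `symbolPQ b s` times `symbolPP b G (-s)` equals G(-s), which is minus the Mellin transform at
s of x ↦ ∫_x^∞ √y f(y) dy. Integrating the inversion formula against `symbolPQ b s` x^{-s} therefore
produces the kernel P(Q+Q) on one side and, by Mellin inversion, the antiderivative on the other.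
The kernel S_μ is the same Mellin–Barnes integral shifted by 3/2, so the second formula follows by
Lebesgue differentiation.

The Mellin–Barnes representations of the kernels come from differential equations. In the variable
ξ, Legendre functions (divided by x^{1/4}) solve a second order equation, and their products solve
its symmetric square. The functional equation of Γ makes the Mellin–Barnes integrals solve the same
equations. Moving the contour to the left past the poles on Re s = 0 gives the behaviour at ξ = -∞,
which determines a solution when τ ≠ 0. The connection formula `solP_eq_solQ` ties the function of
the first kind to the two exponents ±iτ/2 there. -/

/-- `f` grows at most like a polynomial times `exp (r |Im s|)` in the strip `a ≤ Re s ≤ b`. -/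
def StripGrowth (r : ℝ) (f : ℂ → ℂ) (a b : ℝ) : Prop :=
  ∃ C : ℝ, ∃ K : ℕ, 0 ≤ C ∧ ∀ s : ℂ, a ≤ s.re → s.re ≤ b →
    ‖f s‖ ≤ C * (1 + |s.im|) ^ K * Real.exp (r * |s.im|)

/-! ### Growth of functions on vertical strips -/

namespace StripGrowth

variable {r r₁ r₂ a b : ℝ} {f g : ℂ → ℂ}

lemma mul (hf : StripGrowth r₁ f a b) (hg : StripGrowth r₂ g a b) :
    StripGrowth (r₁ + r₂) (fun s => f s * g s) a b := by
  obtain ⟨C, K, hC, h⟩ := hf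
  obtain ⟨D, L, hD, h'⟩ := hg
  refine ⟨C * D, K + L, by positivity, fun s h1 h2 => ?_⟩
  rw [norm_mul]
  calc ‖f s‖ * ‖g s‖ ≤ (C * (1 + |s.im|) ^ K * Real.exp (r₁ * |s.im|)) *
        (D * (1 + |s.im|) ^ L * Real.exp (r₂ * |s.im|)) := by
          gcongr
          · exact h s h1 h2
          · exact h' s h1 h2
    _ = _ := by rw [add_mul, Real.exp_add, pow_add]; ring

lemma mul_zero_left (hf : StripGrowth 0 f a b) (hg : StripGrowth r g a b) :
    StripGrowth r (fun s => f s * g s) a b := by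
  simpa using hf.mul hg

lemma mul_zero_right (hf : StripGrowth r f a b) (hg : StripGrowth 0 g a b) :
    StripGrowth r (fun s => f s * g s) a b := by
  simpa using hf.mul hg

lemma const (c : ℂ) : StripGrowth 0 (fun _ => c) a b :=
  ⟨‖c‖, 0, norm_nonneg _, fun s _ _ => by simp⟩

lemma of_bounded (C : ℝ) (h : ∀ s : ℂ, a ≤ s.re → s.re ≤ b → ‖f s‖ ≤ C) :
    StripGrowth 0 f a b :=
  ⟨|C|, 0, abs_nonneg _, fun s h1 h2 => by simpa using (h s h1 h2).trans (le_abs_self C)⟩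

lemma id : StripGrowth 0 (fun s => s) a b := by
  refine ⟨1 + |a| + |b|, 1, by positivity, fun s h1 h2 => ?_⟩
  have h3 : |s.re| ≤ |a| + |b| := by
    rw [abs_le]
    constructor
    · linarith [neg_abs_le a, abs_nonneg b]
    · linarith [le_abs_self b, abs_nonneg a]
  have := Complex.norm_le_abs_re_add_abs_im s
  have h4 : 0 ≤ |s.im| := abs_nonneg _
  simp only [pow_one, zero_mul, Real.exp_zero, mul_one]
  nlinarith [abs_nonneg a, abs_nonneg b]

lemma neg (hf : StripGrowth r f a b) : StripGrowth r (fun s => -f s) a b := by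
  simpa [StripGrowth] using hf

lemma mono {a' b' : ℝ} (hf : StripGrowth r f a b) (h1 : a ≤ a') (h2 : b' ≤ b) :
    StripGrowth r f a' b' := by
  obtain ⟨C, K, hC, h⟩ := hf
  exact ⟨C, K, hC, fun s h3 h4 => h s (h1.trans h3) (h4.trans h2)⟩

lemma congr (hf : StripGrowth r f a b) (h : ∀ s : ℂ, a ≤ s.re → s.re ≤ b → f s = g s) :
    StripGrowth r g a b := by
  obtain ⟨C, K, hC, h'⟩ := hf
  exact ⟨C, K, hC, fun s h3 h4 => h s h3 h4 ▸ h' s h3 h4⟩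

lemma comp_add_const (c : ℂ) (hf : StripGrowth r f (a + c.re) (b + c.re)) :
    StripGrowth r (fun s => f (s + c)) a b := by
  obtain ⟨C, K, hC, h⟩ := hf
  refine ⟨C * (1 + |c.im|) ^ K * Real.exp (|r| * |c.im|), K, by positivity, fun s h1 h2 => ?_⟩
  refine (h (s + c) (by simpa using h1) (by simpa using h2)).trans ?_
  have h3 : 1 + |(s + c).im| ≤ (1 + |c.im|) * (1 + |s.im|) := by
    rw [add_im]
    nlinarith [abs_add_le s.im c.im, abs_nonneg s.im, abs_nonneg c.im]
  have h4 : r * |(s + c).im| ≤ |r| * |c.im| + r * |s.im| := by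
    have h5 : |(s + c).im| - |s.im| ≤ |c.im| := by
      rw [add_im]; linarith [abs_add_le s.im c.im]
    have h6 : -|c.im| ≤ |(s + c).im| - |s.im| := by
      rw [add_im]
      have := abs_sub_abs_le_abs_sub s.im (s.im + c.im)
      have h7 : |s.im - (s.im + c.im)| = |c.im| := by rw [← abs_neg]; ring_nf
      linarith
    have h8 : r * (|(s + c).im| - |s.im|) ≤ |r| * |c.im| := by
      refine (le_abs_self _).trans ?_
      rw [abs_mul]
      exact mul_le_mul_of_nonneg_left (abs_le.2 ⟨h6, h5⟩) (abs_nonneg r)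
    linarith
  calc C * (1 + |(s + c).im|) ^ K * Real.exp (r * |(s + c).im|)
      ≤ C * ((1 + |c.im|) * (1 + |s.im|)) ^ K * Real.exp (|r| * |c.im| + r * |s.im|) := by
        gcongr
    _ = _ := by rw [mul_pow, Real.exp_add]; ring

lemma comp_neg (hf : StripGrowth r f (-b) (-a)) : StripGrowth r (fun s => f (-s)) a b := by
  obtain ⟨C, K, hC, h⟩ := hf
  refine ⟨C, K, hC, fun s h1 h2 => ?_⟩
  simpa using h (-s) (by simpa using h2) (by simpa using h1)

/-- A real dilation of the variable. -/
lemma comp_mul (c : ℝ) (hc : 0 < c) (hf : StripGrowth r f (c * a) (c * b)) :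
    StripGrowth (c * r) (fun s => f (c * s)) a b := by
  obtain ⟨C, K, hC, h⟩ := hf
  refine ⟨C * (1 + c) ^ K, K, by positivity, fun s h1 h2 => ?_⟩
  have h3 := h (c * s) (by simpa using mul_le_mul_of_nonneg_left h1 hc.le)
    (by simpa using mul_le_mul_of_nonneg_left h2 hc.le)
  have h5 : |((c : ℂ) * s).im| = c * |s.im| := by simp [abs_mul, abs_of_pos hc]
  rw [h5] at h3
  refine h3.trans ?_
  have h4 : 1 + c * |s.im| ≤ (1 + c) * (1 + |s.im|) := by
    nlinarith [abs_nonneg s.im]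
  calc C * (1 + c * |s.im|) ^ K * Real.exp (r * (c * |s.im|))
      ≤ C * ((1 + c) * (1 + |s.im|)) ^ K * Real.exp (r * (c * |s.im|)) := by gcongr
    _ = _ := by rw [mul_pow]; ring_nf

lemma cexp_mul (ξ : ℝ) : StripGrowth 0 (fun s => cexp (-s * ξ)) a b := by
  refine of_bounded (Real.exp (|a * ξ| + |b * ξ|)) fun s h1 h2 => ?_
  rw [Complex.norm_exp]
  have h3 : (-s * (ξ : ℂ)).re = -(s.re * ξ) := by simp
  rw [h3]
  refine Real.exp_le_exp.2 ?_
  rcases le_total 0 ξ with h | h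
  · have := mul_le_mul_of_nonneg_right h1 h
    linarith [neg_abs_le (a * ξ), abs_nonneg (b * ξ)]
  · have := mul_le_mul_of_nonpos_right h2 h
    linarith [neg_abs_le (b * ξ), abs_nonneg (a * ξ)]

end StripGrowth

lemma pow_mul_exp_neg_bounded (K : ℕ) {r : ℝ} (hr : r < 0) :
    ∃ C : ℝ, 0 ≤ C ∧ ∀ t : ℝ, 0 ≤ t → (1 + t) ^ K * Real.exp (r * t) ≤ C := by
  -- The constant comes from y ^ K / K! ≤ exp y at y = -r(1+t); the shift by 1 costs exp(-r).
  refine ⟨K.factorial * (1 / (-r)) ^ K * Real.exp (-r), ?_, fun t ht => ?_⟩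
  · have : 0 < -r := by linarith
    positivity
  have h0 : 0 < -r := by linarith
  have h1 := Real.pow_div_factorial_le_exp (-r * (1 + t)) (by positivity) K
  rw [div_le_iff₀ (by positivity)] at h1
  calc (1 + t) ^ K * Real.exp (r * t) = (1 / (-r)) ^ K * (-r * (1 + t)) ^ K * Real.exp (r * t) := by
        rw [← mul_pow, ← mul_assoc, one_div_mul_cancel h0.ne', one_mul]
    _ ≤ (1 / (-r)) ^ K * (Real.exp (-r * (1 + t)) * K.factorial) * Real.exp (r * t) := by gcongr
    _ = K.factorial * (1 / (-r)) ^ K * (Real.exp (-r * (1 + t)) * Real.exp (r * t)) := by ring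
    _ = _ := by rw [← Real.exp_add]; ring_nf

lemma StripGrowth.exp_decay {r a b : ℝ} {f : ℂ → ℂ} (hf : StripGrowth r f a b) {δ : ℝ}
    (hr : r < -δ) : ∃ C : ℝ, 0 ≤ C ∧ ∀ s : ℂ, a ≤ s.re → s.re ≤ b →
      ‖f s‖ ≤ C * Real.exp (-δ * |s.im|) := by
  obtain ⟨C, K, hC, h⟩ := hf
  obtain ⟨D, hD, h'⟩ := pow_mul_exp_neg_bounded K (r := r + δ) (by linarith)
  refine ⟨C * D, by positivity, fun s h1 h2 => (h s h1 h2).trans ?_⟩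
  have h3 := h' |s.im| (abs_nonneg _)
  calc C * (1 + |s.im|) ^ K * Real.exp (r * |s.im|)
      = C * ((1 + |s.im|) ^ K * Real.exp ((r + δ) * |s.im|)) * Real.exp (-δ * |s.im|) := by
        rw [show r * |s.im| = (r + δ) * |s.im| + -δ * |s.im| by ring, Real.exp_add]; ring
    _ ≤ _ := by gcongr

lemma StripGrowth.quad_decay {r a b : ℝ} {f : ℂ → ℂ} (hf : StripGrowth r f a b)
    (hr : r < 0) : ∃ C : ℝ, 0 ≤ C ∧ ∀ s : ℂ, a ≤ s.re → s.re ≤ b →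
      ‖f s‖ ≤ C / (1 + s.im ^ 2) := by
  obtain ⟨C, K, hC, h⟩ := hf
  obtain ⟨D, hD, h'⟩ := pow_mul_exp_neg_bounded (K + 2) hr
  refine ⟨C * D, by positivity, fun s h1 h2 => (h s h1 h2).trans ?_⟩
  have h3 := h' |s.im| (abs_nonneg _)
  rw [le_div_iff₀ (by positivity)]
  have h4 : 1 + s.im ^ 2 ≤ (1 + |s.im|) ^ 2 := by
    rw [← sq_abs]; nlinarith [abs_nonneg s.im]
  calc C * (1 + |s.im|) ^ K * Real.exp (r * |s.im|) * (1 + s.im ^ 2)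
      ≤ C * (1 + |s.im|) ^ K * Real.exp (r * |s.im|) * (1 + |s.im|) ^ 2 := by gcongr
    _ = C * ((1 + |s.im|) ^ (K + 2) * Real.exp (r * |s.im|)) := by ring
    _ ≤ _ := by gcongr

/-! ### Bounds for the Gamma function on vertical strips -/

/-- By Euler's beta integral, Γ(s)/Γ(s+d) = B(s,d)/Γ(d), and |B(s,d)| ≤ B(Re s, d) for real d > 0.
Hence |Γ(σ+it)|/Γ(σ) increases with σ, and bounds on a few special lines control whole strips. -/
lemma norm_Gamma_le_of_re_lt {σ σ' t : ℝ} (hσ : 0 < σ) (h : σ < σ') :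
    ‖Gamma (σ + t * I)‖ ≤ Real.Gamma σ / Real.Gamma σ' * ‖Gamma (σ' + t * I)‖ := by
  have hd : 0 < σ' - σ := by linarith
  have h1 := Complex.betaIntegral_eq_Gamma_mul_div (σ + t * I) ((σ' - σ : ℝ) : ℂ) (by simpa)
    (by rw [ofReal_re]; exact hd)
  have h2 := Complex.betaIntegral_eq_Gamma_mul_div (σ : ℂ) ((σ' - σ : ℝ) : ℂ) (by simpa)
    (by rw [ofReal_re]; exact hd)
  rw [show (σ + t * I : ℂ) + ((σ' - σ : ℝ) : ℂ) = σ' + t * I by push_cast; ring] at h1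
  rw [show (σ : ℂ) + ((σ' - σ : ℝ) : ℂ) = σ' by push_cast; ring] at h2
  have h3 : ‖Complex.betaIntegral (σ + t * I) ((σ' - σ : ℝ) : ℂ)‖ ≤
      ‖Complex.betaIntegral σ ((σ' - σ : ℝ) : ℂ)‖ := by
    have hc := Complex.betaIntegral_convergent (u := (σ : ℂ)) (v := ((σ' - σ : ℝ) : ℂ)) (by simpa)
      (by rw [ofReal_re]; exact hd)
    have h4 : Complex.betaIntegral σ ((σ' - σ : ℝ) : ℂ) =
        ((∫ x in (0:ℝ)..1, x ^ (σ - 1) * (1 - x) ^ (σ' - σ - 1) : ℝ) : ℂ) := by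
      rw [Complex.betaIntegral, ← intervalIntegral.integral_ofReal]
      refine intervalIntegral.integral_congr fun x hx => ?_
      rw [uIcc_of_le zero_le_one] at hx
      rw [ofReal_mul, ofReal_cpow hx.1, ofReal_cpow (by linarith [hx.2])]
      push_cast; ring
    rw [h4, Complex.betaIntegral, Complex.norm_real, Real.norm_eq_abs]
    refine le_trans ?_ (le_abs_self _)
    refine intervalIntegral.norm_integral_le_of_norm_le zero_le_one ?_ ?_
    · refine Eventually.of_forall fun x hx => ?_
      rw [norm_mul, norm_cpow_eq_rpow_re_of_pos hx.1]
      rcases hx.2.lt_or_eq with h5 | h5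
      · rw [show (1 - (x : ℂ)) = ((1 - x : ℝ) : ℂ) by push_cast; ring,
          norm_cpow_eq_rpow_re_of_pos (by linarith)]
        simp
      -- At the endpoint x = 1 the base 1 - x vanishes, and the convention for 0 ^ w depends on
      -- whether w = 0.
      · subst h5
        rw [show ((σ' - σ : ℝ) : ℂ) - 1 = ((σ' - σ - 1 : ℝ) : ℂ) by push_cast; ring]
        rcases eq_or_ne (σ' - σ - 1) 0 with h6 | h6
        · simp [h6]
        · rw [ofReal_one, sub_self, sub_self, Real.zero_rpow h6,
            Complex.zero_cpow (ofReal_ne_zero.2 h6)]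
          simp
    · have := hc.norm
      refine this.congr_ae ?_ 
      rw [EventuallyEq, ae_restrict_iff' measurableSet_uIoc]
      have h1ne : ∀ᵐ x : ℝ, x ≠ 1 := by simp [ae_iff, measure_singleton]
      filter_upwards [h1ne] with x hx1 hx
      rw [uIoc_of_le zero_le_one] at hx
      have h7 : x < 1 := lt_of_le_of_ne hx.2 hx1
      rw [norm_mul, norm_cpow_eq_rpow_re_of_pos hx.1,
        show (1 - (x : ℂ)) = ((1 - x : ℝ) : ℂ) by push_cast; ring,
          norm_cpow_eq_rpow_re_of_pos (by linarith)]
      simp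
  rw [h1, h2, norm_div, norm_mul, norm_div, norm_mul, Complex.Gamma_ofReal, Complex.Gamma_ofReal,
    Complex.Gamma_ofReal, norm_real, norm_real, norm_real, Real.norm_of_nonneg (Real.Gamma_pos_of_pos hσ).le,
    Real.norm_of_nonneg (Real.Gamma_pos_of_pos hd).le,
    Real.norm_of_nonneg (Real.Gamma_pos_of_pos (hσ.trans h)).le] at h3
  have g1 := Real.Gamma_pos_of_pos hσ
  have g2 := Real.Gamma_pos_of_pos hd
  have g3 := Real.Gamma_pos_of_pos (hσ.trans h)
  have g4 : 0 < ‖Gamma (σ' + t * I)‖ :=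
    norm_pos_iff.2 (Complex.Gamma_ne_zero_of_re_pos (by simpa using hσ.trans h))
  rw [div_le_iff₀ g4] at h3
  have h8 : ‖Gamma (σ + t * I)‖ * Real.Gamma (σ' - σ) ≤
      (Real.Gamma σ / Real.Gamma σ' * ‖Gamma (σ' + t * I)‖) * Real.Gamma (σ' - σ) := by
    refine h3.trans (le_of_eq ?_); ring
  exact le_of_mul_le_mul_right h8 g2

/-- On Re s = 1/2 one has 1 - s = conj s, so the reflection formula gives the modulus exactly. -/
lemma norm_Gamma_half_sq (t : ℝ) : ‖Gamma (1 / 2 + t * I)‖ ^ 2 = Real.pi / Real.cosh (Real.pi * t) := by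
  have h1 := Complex.Gamma_mul_Gamma_one_sub (1 / 2 + t * I)
  have h2 : (1 : ℂ) - (1 / 2 + t * I) = (starRingEnd ℂ) (1 / 2 + t * I) := by
    simp [map_add, Complex.ext_iff]; norm_num
  rw [h2, Complex.Gamma_conj, Complex.mul_conj, Complex.normSq_eq_norm_sq] at h1
  have h3 : Complex.sin (Real.pi * (1 / 2 + t * I)) = (Real.cosh (Real.pi * t) : ℂ) := by
    rw [show (Real.pi * (1 / 2 + t * I) : ℂ) = (Real.pi * t : ℂ) * I + Real.pi / 2 by ring,
      Complex.sin_add_pi_div_two, Complex.cos_mul_I]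
    push_cast; rfl
  rw [h3] at h1
  exact_mod_cast h1

lemma norm_Gamma_half_le (t : ℝ) :
    ‖Gamma (1 / 2 + t * I)‖ ≤ Real.sqrt (2 * Real.pi) * Real.exp (-(Real.pi / 2) * |t|) := by
  refine le_of_sq_le_sq ?_ (by positivity)
  rw [norm_Gamma_half_sq, mul_pow, Real.sq_sqrt (by positivity), ← Real.exp_nat_mul,
    div_le_iff₀ (Real.cosh_pos _)]
  have h1 : Real.exp (Real.pi * |t|) ≤ 2 * Real.cosh (Real.pi * t) := by
    rw [← Real.cosh_abs, abs_mul, abs_of_pos Real.pi_pos, Real.cosh_eq]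
    linarith [Real.exp_pos (-(Real.pi * |t|))]
  have h2 : Real.exp ((2:ℕ) * (-(Real.pi / 2) * |t|)) * Real.exp (Real.pi * |t|) = 1 := by
    rw [← Real.exp_add]; norm_num; ring
  have := Real.exp_pos ((2:ℕ) * (-(Real.pi / 2) * |t|))
  calc Real.pi = Real.pi * (Real.exp ((2:ℕ) * (-(Real.pi / 2) * |t|)) * Real.exp (Real.pi * |t|)) := by
        rw [h2, mul_one]
    _ ≤ Real.pi * (Real.exp ((2:ℕ) * (-(Real.pi / 2) * |t|)) * (2 * Real.cosh (Real.pi * t))) := by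
        gcongr
    _ = _ := by ring

lemma le_norm_Gamma_half (t : ℝ) :
    Real.sqrt Real.pi * Real.exp (-(Real.pi / 2) * |t|) ≤ ‖Gamma (1 / 2 + t * I)‖ := by
  refine le_of_sq_le_sq ?_ (by positivity)
  rw [norm_Gamma_half_sq, mul_pow, Real.sq_sqrt (by positivity), ← Real.exp_nat_mul,
    le_div_iff₀ (Real.cosh_pos _)]
  have h1 : Real.cosh (Real.pi * t) ≤ Real.exp (Real.pi * |t|) := by
    rw [← Real.cosh_abs, abs_mul, abs_of_pos Real.pi_pos, Real.cosh_eq]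
    have := Real.exp_le_exp.2 (show -(Real.pi * |t|) ≤ Real.pi * |t| by
      have : 0 ≤ Real.pi * |t| := by positivity
      linarith)
    linarith
  have h2 : Real.exp ((2:ℕ) * (-(Real.pi / 2) * |t|)) * Real.exp (Real.pi * |t|) = 1 := by
    rw [← Real.exp_add]; norm_num; ring
  have := Real.exp_pos ((2:ℕ) * (-(Real.pi / 2) * |t|))
  calc Real.pi * Real.exp ((2:ℕ) * (-(Real.pi / 2) * |t|)) * Real.cosh (Real.pi * t)
      ≤ Real.pi * Real.exp ((2:ℕ) * (-(Real.pi / 2) * |t|)) * Real.exp (Real.pi * |t|) := by gcongr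
    _ = _ := by rw [mul_assoc, h2, mul_one]

/-- Each use of Γ(s+1) = sΓ(s) costs one power of 1 + |t|; the exponential rate -π/2 comes from the
line Re s = 1/2. -/
lemma stripGrowth_Gamma_half : ∀ N : ℕ, ∃ C : ℝ, ∃ K : ℕ, 0 ≤ C ∧ ∀ t : ℝ,
    ‖Gamma ((N + 1 / 2 : ℝ) + t * I)‖ ≤ C * (1 + |t|) ^ K * Real.exp (-(Real.pi / 2) * |t|)
  | 0 => ⟨Real.sqrt (2 * Real.pi), 0, by positivity, fun t => by
      simpa using norm_Gamma_half_le t⟩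
  | N + 1 => by
      obtain ⟨C, K, hC, h⟩ := stripGrowth_Gamma_half N
      refine ⟨(N + 1) * C, K + 1, by positivity, fun t => ?_⟩
      have h1 : Gamma (((N + 1 : ℕ) + 1 / 2 : ℝ) + t * I) =
          ((N + 1 / 2 : ℝ) + t * I) * Gamma ((N + 1 / 2 : ℝ) + t * I) := by
        rw [← Complex.Gamma_add_one]
        · congr 1; push_cast; ring
        · intro h0
          have := congrArg Complex.re h0
          simp at this
          have h5 : (0:ℝ) ≤ N := by positivity
          linarith
      have h2 : ‖((N + 1 / 2 : ℝ) + t * I : ℂ)‖ ≤ (N + 1) * (1 + |t|) := by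
        refine (Complex.norm_le_abs_re_add_abs_im _).trans ?_
        have h5 : (0:ℝ) ≤ N := by positivity
        simp only [add_re, ofReal_re, mul_re, I_re, mul_zero, ofReal_im, I_im, mul_one, sub_self,
          add_zero, add_im, mul_im, zero_add]
        rw [abs_of_nonneg (by positivity)]
        nlinarith [abs_nonneg t]
      rw [h1, norm_mul]
      calc _ ≤ ((N + 1) * (1 + |t|)) * (C * (1 + |t|) ^ K * Real.exp (-(Real.pi / 2) * |t|)) := by
            gcongr; exact h t
        _ = _ := by ring

/-- Monotonicity in σ compares every line of the strip with one half-integer line to its right. -/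
lemma stripGrowth_Gamma {a b : ℝ} (ha : 0 < a) :
    StripGrowth (-(Real.pi / 2)) Gamma a b := by
  obtain ⟨N, hN⟩ := exists_nat_gt b
  obtain ⟨C, K, hC, h⟩ := stripGrowth_Gamma_half N
  have hcont : ContinuousOn Real.Gamma (Icc a b) := fun x hx =>
    (Real.differentiableAt_Gamma (fun m => by
      have h5 : (0:ℝ) ≤ m := by positivity
      linarith [hx.1])).continuousAt.continuousWithinAt
  obtain ⟨D, hD⟩ := isCompact_Icc.exists_bound_of_continuousOn hcont
  have hg : 0 < Real.Gamma (N + 1 / 2) := Real.Gamma_pos_of_pos (by positivity)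
  refine ⟨|D| / Real.Gamma (N + 1 / 2) * C, K, by positivity, fun s h1 h2 => ?_⟩
  have h3 := norm_Gamma_le_of_re_lt (σ := s.re) (σ' := N + 1 / 2) (t := s.im) (by linarith)
    (by linarith)
  rw [Complex.re_add_im] at h3
  refine h3.trans ?_
  have h4 := hD s.re ⟨h1, h2⟩
  have h5 : Real.Gamma s.re ≤ |D| := (le_abs_self _).trans (h4.trans (le_abs_self _))
  calc _ ≤ |D| / Real.Gamma (N + 1 / 2) * (C * (1 + |s.im|) ^ K * Real.exp (-(Real.pi / 2) * |s.im|)) := by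
        gcongr; exact h s.im
    _ = _ := by ring

/-- Here the comparison runs the other way: |Γ| is bounded below by its exact size on Re s = 1/2. -/
lemma stripGrowth_Gamma_inv_of_half {a b : ℝ} (ha : 1 / 2 < a) :
    StripGrowth (Real.pi / 2) (fun s => (Gamma s)⁻¹) a b := by
  have hcont : ContinuousOn (fun x => (Real.Gamma x)⁻¹) (Icc a b) := fun x hx =>
    ((Real.differentiableAt_Gamma (fun m => by
      have h5 : (0:ℝ) ≤ m := by positivity
      linarith [hx.1])).continuousAt.inv₀
        (Real.Gamma_pos_of_pos (by linarith [hx.1])).ne').continuousWithinAt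
  obtain ⟨D, hD⟩ := isCompact_Icc.exists_bound_of_continuousOn hcont
  refine ⟨|D|, 0, by positivity, fun s h1 h2 => ?_⟩
  have h3 := norm_Gamma_le_of_re_lt (σ := 1 / 2) (σ' := s.re) (t := s.im) (by norm_num)
    (by linarith)
  rw [Complex.re_add_im, Real.Gamma_one_half_eq] at h3
  have h4 := (le_norm_Gamma_half s.im)
  have h4' : Real.sqrt Real.pi * Real.exp (-(Real.pi / 2) * |s.im|) ≤ 
     Real.sqrt Real.pi / Real.Gamma s.re * ‖Gamma s‖ := by
    refine h4.trans (le_trans (le_of_eq ?_) h3)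
    push_cast; rfl
  have hg : 0 < Real.Gamma s.re := Real.Gamma_pos_of_pos (by linarith)
  have hn : 0 < ‖Gamma s‖ := norm_pos_iff.2 (Complex.Gamma_ne_zero_of_re_pos (by linarith))
  have h5 : (Real.Gamma s.re)⁻¹ ≤ |D| := (le_abs_self _).trans ((hD s.re ⟨h1, h2⟩).trans (le_abs_self _))
  have hp : 0 < Real.sqrt Real.pi := by positivity
  have h6 : Real.exp (-(Real.pi / 2) * |s.im|) ≤ (Real.Gamma s.re)⁻¹ * ‖Gamma s‖ := by
    refine le_of_mul_le_mul_left ?_ hp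
    refine h4'.trans (le_of_eq ?_); ring
  have h7 : Real.exp (-(Real.pi / 2) * |s.im|) ≤ |D| * ‖Gamma s‖ := h6.trans (by gcongr)
  rw [norm_inv, inv_le_iff_one_le_mul₀ hn, pow_zero, mul_one]
  calc (1:ℝ) = Real.exp (-(Real.pi / 2) * |s.im|) * Real.exp (Real.pi / 2 * |s.im|) := by
        rw [← Real.exp_add]; simp
    _ ≤ |D| * ‖Gamma s‖ * Real.exp (Real.pi / 2 * |s.im|) := by gcongr
    _ = _ := by ring

/-- Since 1/Γ is entire, 1/Γ(s) = s/Γ(s+1) extends the bound to the left without any exception;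
after N steps the strip lies to the right of 1/2. -/
lemma stripGrowth_Gamma_inv_of_nat : ∀ (N : ℕ) {a b : ℝ}, 1 / 2 < a + N →
    StripGrowth (Real.pi / 2) (fun s => (Gamma s)⁻¹) a b
  | 0, a, b, h => stripGrowth_Gamma_inv_of_half (by simpa using h)
  | N + 1, a, b, h => by
      have h1 := stripGrowth_Gamma_inv_of_nat N (a := a + 1) (b := b + 1) (by push_cast at h; linarith)
      have h2 := StripGrowth.id.mul_zero_left
        (StripGrowth.comp_add_const (a := a) (b := b) 1 (by simpa using h1))
      refine h2.congr fun s _ _ => ?_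
      simpa using (Complex.one_div_Gamma_eq_self_mul_one_div_Gamma_add_one s).symm

lemma stripGrowth_Gamma_inv {a b : ℝ} : StripGrowth (Real.pi / 2) (fun s => (Gamma s)⁻¹) a b := by
  obtain ⟨N, hN⟩ := exists_nat_gt (1 / 2 - a)
  exact stripGrowth_Gamma_inv_of_nat N (by linarith)

lemma stripGrowth_Gamma_add (c : ℂ) {a b : ℝ} (h : 0 < a + c.re) :
    StripGrowth (-(Real.pi / 2)) (fun s => Gamma (s + c)) a b :=
  StripGrowth.comp_add_const c (stripGrowth_Gamma h)

lemma stripGrowth_Gamma_sub (c : ℂ) {a b : ℝ} (h : b < c.re) :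
    StripGrowth (-(Real.pi / 2)) (fun s => Gamma (c - s)) a b := by
  have := StripGrowth.comp_neg (a := a) (b := b) (stripGrowth_Gamma_add c (a := -b) (b := -a)
    (by linarith))
  simpa [neg_add_eq_sub] using this

lemma stripGrowth_Gamma_inv_add (c : ℂ) {a b : ℝ} :
    StripGrowth (Real.pi / 2) (fun s => (Gamma (s + c))⁻¹) a b :=
  StripGrowth.comp_add_const (f := fun s => (Gamma s)⁻¹) c stripGrowth_Gamma_inv

lemma stripGrowth_Gamma_inv_sub (c : ℂ) {a b : ℝ} :
    StripGrowth (Real.pi / 2) (fun s => (Gamma (c - s))⁻¹) a b := by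
  have := StripGrowth.comp_neg (a := a) (b := b) (stripGrowth_Gamma_inv_add c (a := -b) (b := -a))
  simpa [neg_add_eq_sub] using this

/-! ### Integrals over vertical lines: shifts and residues -/

/-- The integral of `Φ` over the vertical line `Re s = σ` with respect to `Im s`. -/
def vint (σ : ℝ) (Φ : ℂ → ℂ) : ℂ := ∫ t : ℝ, Φ (σ + t * I)

/-- `Φ` is holomorphic and `O((1 + |Im s|²)⁻¹)` in the closed strip `a ≤ Re s ≤ b`. -/
def StripDecay (Φ : ℂ → ℂ) (a b : ℝ) : Prop :=
  (∀ s : ℂ, a ≤ s.re → s.re ≤ b → DifferentiableAt ℂ Φ s) ∧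
    ∃ C : ℝ, 0 ≤ C ∧ ∀ s : ℂ, a ≤ s.re → s.re ≤ b → ‖Φ s‖ ≤ C / (1 + s.im ^ 2)

lemma StripGrowth.stripDecay {r a b : ℝ} {f : ℂ → ℂ} (hf : StripGrowth r f a b) (hr : r < 0)
    (hd : ∀ s : ℂ, a ≤ s.re → s.re ≤ b → DifferentiableAt ℂ f s) : StripDecay f a b :=
  ⟨hd, hf.quad_decay hr⟩

lemma vline_re (σ t : ℝ) : ((σ : ℂ) + t * I).re = σ := by simp

lemma vline_im (σ t : ℝ) : ((σ : ℂ) + t * I).im = t := by simp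

lemma continuous_vline {Φ : ℂ → ℂ} {σ : ℝ} (hd : ∀ s : ℂ, s.re = σ → DifferentiableAt ℂ Φ s) :
    Continuous fun t : ℝ => Φ (σ + t * I) := by
  rw [continuous_iff_continuousAt]
  intro t
  have h2 : ContinuousAt (fun t : ℝ => (σ : ℂ) + t * I) t := by fun_prop
  exact ContinuousAt.comp (f := fun t : ℝ => (σ : ℂ) + t * I) (hd _ (by simp)).continuousAt h2

lemma integrable_vline {Φ : ℂ → ℂ} {σ C : ℝ} (hd : ∀ s : ℂ, s.re = σ → DifferentiableAt ℂ Φ s)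
    (hC : ∀ s : ℂ, s.re = σ → ‖Φ s‖ ≤ C / (1 + s.im ^ 2)) :
    Integrable fun t : ℝ => Φ (σ + t * I) := by
  refine Integrable.mono' (integrable_inv_one_add_sq.const_mul C)
    (continuous_vline hd).aestronglyMeasurable (Eventually.of_forall fun t => ?_)
  simpa [div_eq_mul_inv] using hC (σ + t * I) (by simp)

lemma StripDecay.integrable {Φ : ℂ → ℂ} {a b σ : ℝ} (h : StripDecay Φ a b) (h1 : a ≤ σ)
    (h2 : σ ≤ b) : Integrable fun t : ℝ => Φ (σ + t * I) := by
  obtain ⟨C, hC, hb⟩ := h.2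
  exact integrable_vline (fun s hs => h.1 s (hs ▸ h1) (hs ▸ h2))
    (fun s hs => hb s (hs ▸ h1) (hs ▸ h2))

lemma vint_congr {Φ Ψ : ℂ → ℂ} {σ : ℝ} (h : ∀ s : ℂ, s.re = σ → Φ s = Ψ s) :
    vint σ Φ = vint σ Ψ :=
  integral_congr_ae (Eventually.of_forall fun t => h _ (by simp))

lemma vint_add_one (σ : ℝ) (Φ : ℂ → ℂ) : vint σ (fun s => Φ (s + 1)) = vint (σ + 1) Φ := by
  refine integral_congr_ae (Eventually.of_forall fun t => ?_)
  simp only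
  congr 1; push_cast; ring

/-- The integral over a vertical line may be shifted inside a strip of holomorphy. -/
lemma vint_shift {Φ : ℂ → ℂ} {a b : ℝ} (hab : a ≤ b) (h : StripDecay Φ a b) :
    vint a Φ = vint b Φ := by
  obtain ⟨C, hC, hb⟩ := h.2
  have h1 : ∀ T : ℝ, (∫ t in (-T)..T, Φ (b + t * I)) - (∫ t in (-T)..T, Φ (a + t * I)) =
      I * ((∫ x in a..b, Φ (x + (-T : ℝ) * I)) - ∫ x in a..b, Φ (x + T * I)) := by
    intro T
    have h2 := Complex.integral_boundary_rect_eq_zero_of_differentiableOn Φ (a + (-T : ℝ) * I)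
      (b + T * I) (by
        intro s hs
        rw [Complex.mem_reProdIm, vline_re, vline_re, uIcc_of_le hab] at hs
        exact (h.1 s hs.1.1 hs.1.2).differentiableWithinAt)
    simp only [vline_re, vline_im, smul_eq_mul] at h2
    have hI : I * I = -1 := I_mul_I
    linear_combination (-I) * h2 + ((∫ t in (-T)..T, Φ (b + t * I)) - (∫ t in (-T)..T, Φ (a + t * I))) * hI
  have h3 : Tendsto (fun T : ℝ => (∫ t in (-T)..T, Φ (b + t * I)) - (∫ t in (-T)..T, Φ (a + t * I)))
      atTop (𝓝 (vint b Φ - vint a Φ)) :=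
    (intervalIntegral_tendsto_integral (h.integrable hab le_rfl) tendsto_neg_atTop_atBot
      tendsto_id).sub (intervalIntegral_tendsto_integral (h.integrable le_rfl hab)
        tendsto_neg_atTop_atBot tendsto_id)
  have h4 : Tendsto (fun T : ℝ => (∫ t in (-T)..T, Φ (b + t * I)) - (∫ t in (-T)..T, Φ (a + t * I)))
      atTop (𝓝 0) := by
    -- The two horizontal sides of the rectangle at heights ±T have length b - a and integrand at
    -- most C/(1+T²).
    have h5 : Tendsto (fun T : ℝ => 2 * (C / (1 + T ^ 2) * (b - a))) atTop (𝓝 0) := by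
      have h7 : Tendsto (fun T : ℝ => 1 + T ^ 2) atTop atTop :=
        tendsto_atTop_add_const_left _ _ (tendsto_pow_atTop two_ne_zero)
      have h6 := ((tendsto_const_nhds (x := C)).div_atTop h7).mul_const (b - a) |>.const_mul 2
      simpa using h6
    refine squeeze_zero_norm (fun T => ?_) h5
    have h8 : ∀ T : ℝ, ‖∫ x in a..b, Φ (x + T * I)‖ ≤ C / (1 + T ^ 2) * (b - a) := by
      intro T
      have := intervalIntegral.norm_integral_le_of_norm_le_const (a := a) (b := b)
        (f := fun x : ℝ => Φ (x + T * I)) (C := C / (1 + T ^ 2)) (fun x hx => by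
          rw [uIoc_of_le hab] at hx
          simpa using hb (x + T * I) (by simpa using hx.1.le) (by simpa using hx.2))
      rwa [abs_of_nonneg (by linarith)] at this
    rw [h1, norm_mul, norm_I, one_mul]
    refine (norm_sub_le _ _).trans ?_
    have h9 := h8 (-T)
    rw [neg_sq] at h9
    linarith [h8 T]
  exact (sub_eq_zero.1 (tendsto_nhds_unique h3 h4)).symm

/-- Up to the factor IK, the integrand is the derivative of log((α+it)/(α+K+it)). The quotient stays
in the right half-plane and tends to 1 at both ends. -/
lemma vint_inv_mul_inv_of_pos {α K : ℝ} (hα : 0 < α) (hK : 0 < K) :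
    ∫ t : ℝ, ((α + t * I) * (α + K + t * I) : ℂ)⁻¹ = 0 := by
  have hne : ∀ β : ℝ, 0 < β → ∀ t : ℝ, (β + t * I : ℂ) ≠ 0 := fun β hβ t h => by
    have := congrArg Complex.re h
    simp at this; linarith
  have h1 : ∀ t : ℝ, HasDerivAt (fun t : ℝ => Complex.log ((α + t * I) / ((α + K : ℝ) + t * I)))
      (I * K * ((α + t * I) * (α + K + t * I) : ℂ)⁻¹) t := by
    intro t
    have e1 := hne α hα t
    have e2 := hne (α + K) (by linarith) t
    have hd : ∀ β : ℝ, HasDerivAt (fun t : ℝ => (β + t * I : ℂ)) I t := fun β => by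
      have := ((hasDerivAt_id t).ofReal_comp.mul_const I).const_add (β : ℂ)
      simpa using this
    have h2 := (hd α).fun_div (hd (α + K)) e2
    have h3 : ((α + t * I) / ((α + K : ℝ) + t * I) : ℂ) ∈ slitPlane := by
      left
      rw [Complex.div_re]
      have h4 : 0 < Complex.normSq ((α + K : ℝ) + t * I) := Complex.normSq_pos.2 e2
      have h5 : 0 < α * (α + K) / Complex.normSq ((α + K : ℝ) + t * I) := by positivity
      have h6 : 0 ≤ t * t / Complex.normSq ((α + K : ℝ) + t * I) :=
        div_nonneg (mul_self_nonneg t) h4.le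
      simpa [-ofReal_add] using add_pos_of_pos_of_nonneg h5 h6
    have h7 := h2.clog_real h3
    convert h7 using 1
    push_cast at e2 ⊢
    field_simp
    ring
  have h0 : Tendsto (fun t : ℝ => (t : ℂ)⁻¹) (cocompact ℝ) (𝓝 0) := by
    rw [tendsto_zero_iff_norm_tendsto_zero]
    simp only [norm_inv, norm_real]
    exact tendsto_inv_atTop_zero.comp (tendsto_norm_cocompact_atTop)
  have hlim : Tendsto (fun t : ℝ => Complex.log ((α + t * I) / ((α + K : ℝ) + t * I)))
      (cocompact ℝ) (𝓝 0) := by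
    have h2 : Tendsto (fun t : ℝ => ((α * (t : ℂ)⁻¹ + I) / ((α + K : ℝ) * (t : ℂ)⁻¹ + I) : ℂ))
        (cocompact ℝ) (𝓝 1) := by
      have := ((h0.const_mul (α : ℂ)).add_const I).div ((h0.const_mul ((α + K : ℝ) : ℂ)).add_const I)
        (by simp)
      rw [mul_zero, mul_zero, zero_add, div_self I_ne_zero] at this
      exact this
    have h3 : Tendsto (fun t : ℝ => ((α + t * I) / ((α + K : ℝ) + t * I) : ℂ))
        (cocompact ℝ) (𝓝 1) := by
      refine h2.congr' ?_
      have : ∀ᶠ t : ℝ in cocompact ℝ, t ≠ 0 := by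
        have := (tendsto_norm_cocompact_atTop (E := ℝ)).eventually (eventually_gt_atTop 0)
        filter_upwards [this] with t ht using norm_pos_iff.1 ht
      filter_upwards [this] with t ht
      have e2 := hne (α + K) (by linarith) t
      have ht' : (t : ℂ) ≠ 0 := ofReal_ne_zero.2 ht
      have e3 : (((α + K : ℝ) : ℂ) * (t : ℂ)⁻¹ + I) ≠ 0 := by
        intro h
        apply e2
        have := congrArg (fun z => z * (t : ℂ)) h
        simp only [add_mul, mul_assoc, inv_mul_cancel₀ ht', zero_mul, mul_one] at this
        rw [← this]; ring
      rw [div_eq_div_iff e3 e2]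
      field_simp
    have h4 := (continuousAt_clog (x := 1) (by simp)).tendsto.comp h3
    rw [log_one] at h4
    exact h4
  have hint : Integrable fun t : ℝ => (I * K * ((α + t * I) * (α + K + t * I) : ℂ)⁻¹) := by
    refine Integrable.const_mul ?_ _
    have hmin : 0 < min (α ^ 2) 1 := by positivity
    refine Integrable.mono' (integrable_inv_one_add_sq.const_mul (min (α ^ 2) 1)⁻¹)
      (Continuous.aestronglyMeasurable ?_) (Eventually.of_forall fun t => ?_)
    · refine Continuous.inv₀ (by fun_prop) fun t => ?_
      refine mul_ne_zero (hne α hα t) ?_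
      have := hne (α + K) (by linarith) t
      push_cast at this; exact this
    · rw [norm_inv, ← mul_inv]
      refine inv_anti₀ (by positivity) ?_
      rw [norm_mul]
      have h8 : ∀ β : ℝ, α ≤ β → Real.sqrt (α ^ 2 + t ^ 2) ≤ ‖(β + t * I : ℂ)‖ := by
        intro β hβ
        rw [Complex.norm_add_mul_I]
        gcongr
      have h9 := h8 (α + K) (by linarith)
      push_cast at h9
      calc min (α ^ 2) 1 * (1 + t ^ 2) ≤ α ^ 2 + t ^ 2 := by
            nlinarith [min_le_left (α ^ 2) 1, min_le_right (α ^ 2) 1, sq_nonneg t]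
        _ = Real.sqrt (α ^ 2 + t ^ 2) * Real.sqrt (α ^ 2 + t ^ 2) :=
            (Real.mul_self_sqrt (by positivity)).symm
        _ ≤ _ := mul_le_mul (h8 α le_rfl) h9 (Real.sqrt_nonneg _) (norm_nonneg _)
  have h2 := integral_of_hasDerivAt_of_tendsto h1 hint
    (hlim.mono_left (by rw [cocompact_eq_atBot_atTop]; exact le_sup_left))
    (hlim.mono_left (by rw [cocompact_eq_atBot_atTop]; exact le_sup_right))
  rw [integral_const_mul, sub_zero, mul_eq_zero] at h2
  rcases h2 with h2 | h2
  · simp [I_ne_zero, hK.ne'] at h2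
  · exact h2

lemma vint_inv_mul_inv_symm {κ : ℝ} (hκ : 0 < κ) :
    ∫ t : ℝ, ((-κ + t * I) * (κ + t * I) : ℂ)⁻¹ = -(Real.pi / κ) := by
  have h1 : ∀ t : ℝ, ((-κ + t * I) * (κ + t * I) : ℂ)⁻¹ =
      ((-(κ ^ 2)⁻¹ * (1 + (κ⁻¹ * t) ^ 2)⁻¹ : ℝ) : ℂ) := by
    intro t
    have : ((-κ + t * I) * (κ + t * I) : ℂ) = ((-(κ ^ 2 * (1 + (κ⁻¹ * t) ^ 2)) : ℝ) : ℂ) := by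
      have hk : (κ : ℂ) ≠ 0 := ofReal_ne_zero.2 hκ.ne'
      push_cast
      field_simp
      linear_combination (t:ℂ) ^ 2 * I_sq
    rw [this, ← ofReal_inv, inv_neg, mul_inv, neg_mul]
  simp_rw [h1]
  rw [integral_complex_ofReal, integral_const_mul,
    Measure.integral_comp_mul_left (fun t : ℝ => (1 + t ^ 2)⁻¹) κ⁻¹, integral_univ_inv_one_add_sq]
  rw [inv_inv, abs_of_pos hκ, smul_eq_mul]
  push_cast
  have hk : (κ : ℂ) ≠ 0 := ofReal_ne_zero.2 hκ.ne'
  field_simp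

/-- Moving a vertical line across a simple pole. -/
lemma vint_sub_vint_of_pole {g : ℂ → ℂ} {a b : ℝ} {s₀ : ℂ} (ha : a < s₀.re) (hb : s₀.re < b)
    (h : StripDecay g a b) :
    vint b (fun s => g s / (s - s₀)) - vint a (fun s => g s / (s - s₀)) = 2 * Real.pi * g s₀ := by
  obtain ⟨C, hC, hbd⟩ := h.2
  set κ : ℝ := s₀.re - a with hκ
  have hκ0 : 0 < κ := by simp only [hκ]; linarith
  have hne : ∀ s : ℂ, a ≤ s.re → s - s₀ + 2 * κ ≠ 0 := by
    intro s hs h0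
    have := congrArg Complex.re h0
    simp at this; linarith
  set φ : ℂ → ℂ := fun s => g s - g s₀ * (2 * κ / (s - s₀ + 2 * κ)) with hφ
  have hκc : (κ : ℂ) ≠ 0 := ofReal_ne_zero.2 hκ0.ne'
  have hφ0 : φ s₀ = 0 := by simp [hφ, hκc]
  have hφd : ∀ s : ℂ, a ≤ s.re → s.re ≤ b → DifferentiableAt ℂ φ s := by
    intro s h1 h2
    refine (h.1 s h1 h2).sub (DifferentiableAt.const_mul ?_ _)
    exact DifferentiableAt.div (by fun_prop) (by fun_prop) (hne s h1)
  have hds : ∀ s : ℂ, s ≠ s₀ → dslope φ s₀ s = φ s / (s - s₀) := by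
    intro s hs
    rw [dslope_of_ne _ hs, slope_def_field, hφ0, sub_zero]
  have hnhds : {s : ℂ | a < s.re ∧ s.re < b} ∈ 𝓝 s₀ := by
    refine IsOpen.mem_nhds ?_ ⟨ha, hb⟩
    exact (isOpen_lt continuous_const continuous_re).inter (isOpen_lt continuous_re continuous_const)
  have hdd : ∀ s : ℂ, a ≤ s.re → s.re ≤ b → DifferentiableAt ℂ (dslope φ s₀) s := by
    intro s h1 h2
    rcases eq_or_ne s s₀ with rfl | hs
    · have : DifferentiableOn ℂ (dslope φ s) {s : ℂ | a < s.re ∧ s.re < b} :=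
        (Complex.differentiableOn_dslope hnhds).2 fun w hw =>
          (hφd w hw.1.le hw.2.le).differentiableWithinAt
      exact this.differentiableAt hnhds
    · exact (differentiableAt_dslope_of_ne hs).2 (hφd s h1 h2)
  have hdecay : StripDecay (dslope φ s₀) a b := by
    refine ⟨hdd, ?_⟩
    have hcomp : IsCompact (Icc a b ×ℂ Icc (s₀.im - 1) (s₀.im + 1)) :=
      isCompact_Icc.reProdIm isCompact_Icc
    obtain ⟨D, hD⟩ := hcomp.exists_bound_of_continuousOn (f := dslope φ s₀) fun s hs =>
      (hdd s hs.1.1 hs.1.2).continuousAt.continuousWithinAt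
    set L : ℝ := 1 + (|s₀.im| + 1) ^ 2 with hL
    refine ⟨|D| * L + C + ‖g s₀‖ * (2 * κ) * (L * 4), by positivity, fun s h1 h2 => ?_⟩
    rw [le_div_iff₀ (by positivity)]
    by_cases hs : |s.im - s₀.im| ≤ 1
    · have h3 := hD s ⟨⟨h1, h2⟩, by constructor <;> linarith [(abs_le.1 hs).1, (abs_le.1 hs).2]⟩
      have h4 : 1 + s.im ^ 2 ≤ L := by
        have : |s.im| ≤ |s₀.im| + 1 := by
          have := abs_sub_abs_le_abs_sub s.im s₀.im
          linarith
        rw [hL, ← sq_abs]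
        gcongr
      calc ‖dslope φ s₀ s‖ * (1 + s.im ^ 2) ≤ |D| * L := by
            gcongr; exact h3.trans (le_abs_self _)
        _ ≤ _ := by
            have : 0 ≤ ‖g s₀‖ * (2 * κ) * (L * 4) := by positivity
            linarith
    · rw [not_le] at hs
      have hsne : s ≠ s₀ := by rintro rfl; simp at hs; linarith
      rw [hds s hsne, hφ]
      have h5 : |s.im - s₀.im| ≤ ‖s - s₀‖ := by simpa using Complex.abs_im_le_norm (s - s₀)
      have h5' : |s.im - s₀.im| ≤ ‖s - s₀ + 2 * κ‖ := by
        simpa using Complex.abs_im_le_norm (s - s₀ + 2 * κ)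
      have h6 : 1 ≤ ‖s - s₀‖ := hs.le.trans h5
      have h7 : ‖g s‖ * (1 + s.im ^ 2) ≤ C := by
        have := hbd s h1 h2
        rwa [le_div_iff₀ (by positivity)] at this
      have h8 : 1 + s.im ^ 2 ≤ L * 4 * (|s.im - s₀.im| * |s.im - s₀.im|) := by
        set d := |s.im - s₀.im|
        have h9 : |s.im| ≤ |s₀.im| + d := by
          have := abs_sub_abs_le_abs_sub s.im s₀.im
          linarith
        rw [← sq_abs s.im]
        have h10 : |s.im| ^ 2 ≤ (|s₀.im| + d) ^ 2 := by gcongr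
        have h11 : |s₀.im| + d ≤ (|s₀.im| + 1) * d := by nlinarith [abs_nonneg s₀.im]
        have h12 : (|s₀.im| + d) ^ 2 ≤ ((|s₀.im| + 1) * d) ^ 2 := by
          gcongr
        rw [hL]
        nlinarith [sq_nonneg (|s₀.im| + 1), sq_nonneg ((|s₀.im| + 1) * d)]
      calc ‖(g s - g s₀ * (2 * κ / (s - s₀ + 2 * κ))) / (s - s₀)‖ * (1 + s.im ^ 2)
          ≤ (‖g s‖ / ‖s - s₀‖ + ‖g s₀‖ * (2 * κ) / (‖s - s₀ + 2 * κ‖ * ‖s - s₀‖)) *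
              (1 + s.im ^ 2) := by
            gcongr
            rw [norm_div]
            rw [← div_div (‖g s₀‖ * (2 * κ)), ← add_div]
            gcongr
            refine (norm_sub_le _ _).trans (le_of_eq ?_)
            rw [norm_mul, norm_div, norm_mul, norm_real, Real.norm_of_nonneg hκ0.le]
            simp [mul_div_assoc]
        _ ≤ ‖g s‖ * (1 + s.im ^ 2) + ‖g s₀‖ * (2 * κ) * (L * 4) := by
            rw [add_mul]
            refine add_le_add ?_ ?_
            · gcongr
              exact div_le_self (norm_nonneg _) h6
            · rw [div_mul_eq_mul_div, div_le_iff₀ (by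
                refine mul_pos (lt_of_lt_of_le (by linarith) h5') (by linarith))]
              have h13 : |s.im - s₀.im| * |s.im - s₀.im| ≤ ‖s - s₀ + 2 * κ‖ * ‖s - s₀‖ :=
                mul_le_mul h5' h5 (abs_nonneg _) (norm_nonneg _)
              calc ‖g s₀‖ * (2 * κ) * (1 + s.im ^ 2) ≤
                    ‖g s₀‖ * (2 * κ) * (L * 4 * (|s.im - s₀.im| * |s.im - s₀.im|)) := by gcongr
                _ ≤ ‖g s₀‖ * (2 * κ) * (L * 4 * (‖s - s₀ + 2 * κ‖ * ‖s - s₀‖)) := by gcongr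
                _ = _ := by ring
        _ ≤ _ := by
            have : 0 ≤ |D| * L := by positivity
            linarith
  have hshift := vint_shift (ha.trans hb).le hdecay
  have hne0 : ∀ σ : ℝ, σ ≠ s₀.re → ∀ t : ℝ, (σ + t * I : ℂ) ≠ s₀ := by
    intro σ hσ t h0
    exact hσ (by simpa using congrArg Complex.re h0)
  have key : ∀ σ : ℝ, a ≤ σ → σ ≤ b → σ ≠ s₀.re →
      Integrable (fun t : ℝ => g (σ + t * I) / (σ + t * I - s₀)) →
      vint σ (fun s => g s / (s - s₀)) - vint σ (dslope φ s₀) = g s₀ * (2 * κ) *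
        ∫ t : ℝ, (((σ - s₀.re : ℝ) + t * I) * ((σ - s₀.re : ℝ) + 2 * κ + t * I) : ℂ)⁻¹ := by
    intro σ h1 h2 h3 hi
    rw [vint, vint, ← integral_sub hi (hdecay.integrable h1 h2)]
    have : ∀ t : ℝ, g (σ + t * I) / (σ + t * I - s₀) - dslope φ s₀ (σ + t * I) =
        g s₀ * (2 * κ) * (((σ - s₀.re : ℝ) + (t - s₀.im : ℝ) * I) *
          ((σ - s₀.re : ℝ) + 2 * κ + (t - s₀.im : ℝ) * I) : ℂ)⁻¹ := by
      intro t
      have e1 := hne0 σ h3 t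
      have e2 : (σ + t * I - s₀ : ℂ) ≠ 0 := sub_ne_zero.2 e1
      have e3 := hne (σ + t * I) (by simpa using h1)
      have e4 : (((σ - s₀.re : ℝ) : ℂ) + (t - s₀.im : ℝ) * I) = σ + t * I - s₀ := by
        conv_rhs => rw [← Complex.re_add_im s₀]
        push_cast; ring
      have e5 : (((σ - s₀.re : ℝ) : ℂ) + 2 * κ + (t - s₀.im : ℝ) * I) = σ + t * I - s₀ + 2 * κ := by
        rw [← e4]; ring
      rw [hds _ e1, e4, e5, hφ]
      field_simp
      ring
    simp_rw [this]
    rw [integral_const_mul, integral_sub_right_eq_self (fun t : ℝ =>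
      (((σ - s₀.re : ℝ) + (t : ℝ) * I) * ((σ - s₀.re : ℝ) + 2 * κ + (t : ℝ) * I) : ℂ)⁻¹) s₀.im]
  have hint : ∀ σ : ℝ, a ≤ σ → σ ≤ b → σ ≠ s₀.re →
      Integrable (fun t : ℝ => g (σ + t * I) / (σ + t * I - s₀)) := by
    intro σ h1 h2 h3
    have hpos : 0 < |σ - s₀.re| := abs_pos.2 (sub_ne_zero.2 h3)
    refine integrable_vline (Φ := fun s => g s / (s - s₀)) (C := C / |σ - s₀.re|)
      (fun s hs => ?_) (fun s hs => ?_)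
    · refine (h.1 s (hs ▸ h1) (hs ▸ h2)).div (by fun_prop) (sub_ne_zero.2 ?_)
      rintro rfl
      exact h3 hs.symm
    · rw [norm_div, div_right_comm]
      have h4 : |σ - s₀.re| ≤ ‖s - s₀‖ := by
        rw [← hs]; simpa using Complex.abs_re_le_norm (s - s₀)
      gcongr
      exact hbd s (hs ▸ h1) (hs ▸ h2)
  have k1 := key b (ha.trans hb).le le_rfl hb.ne' (hint b (ha.trans hb).le le_rfl hb.ne')
  have k2 := key a le_rfl (ha.trans hb).le ha.ne (hint a le_rfl (ha.trans hb).le ha.ne)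
  have i1 := vint_inv_mul_inv_of_pos (α := b - s₀.re) (K := 2 * κ) (by linarith) (by linarith)
  have i2 := vint_inv_mul_inv_symm hκ0
  -- On the line Re s = a the two factors have real parts -κ and κ: this is why the auxiliary pole
  -- was placed at distance 2κ. On Re s = b both real parts are positive and the integral vanishes.
  have i3 : (∫ t : ℝ, (((a - s₀.re : ℝ) + t * I) * ((a - s₀.re : ℝ) + 2 * κ + t * I) : ℂ)⁻¹) =
      -(Real.pi / κ) := by
    rw [← i2]
    refine integral_congr_ae (Eventually.of_forall fun t => ?_)
    simp only [hκ]
    congr 1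
    push_cast; ring
  push_cast at i1 i3 k1 k2
  rw [i1] at k1
  rw [i3] at k2
  rw [← hshift] at k1
  have : g s₀ * (2 * κ) * -(Real.pi / κ) = -(2 * Real.pi * g s₀) := by
    field_simp
  rw [this] at k2
  linear_combination k1 - k2

/-! ### Mellin–Barnes integrals and their differential equations -/

section

/-- `Φ` is holomorphic and decays exponentially in the closed strip `a ≤ Re s ≤ b`. -/
def StripExp (Φ : ℂ → ℂ) (a b : ℝ) : Prop :=
  (∃ r < 0, StripGrowth r Φ a b) ∧ ∀ s : ℂ, a ≤ s.re → s.re ≤ b → DifferentiableAt ℂ Φ s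

namespace StripExp

variable {Φ p : ℂ → ℂ} {a b : ℝ}

lemma mul_left (h : StripExp Φ a b) (hp : StripGrowth 0 p a b)
    (hd : ∀ s : ℂ, a ≤ s.re → s.re ≤ b → DifferentiableAt ℂ p s) :
    StripExp (fun s => p s * Φ s) a b := by
  obtain ⟨⟨r, hr, hg⟩, h2⟩ := h
  exact ⟨⟨r, hr, hp.mul_zero_left hg⟩, fun s h1 h3 => (hd s h1 h3).mul (h2 s h1 h3)⟩

lemma mul_exp (h : StripExp Φ a b) (ξ : ℝ) : StripExp (fun s => Φ s * cexp (-s * ξ)) a b := by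
  have := h.mul_left (StripGrowth.cexp_mul ξ) (fun s _ _ => by fun_prop)
  simpa only [mul_comm (cexp _)] using this

lemma stripDecay (h : StripExp Φ a b) : StripDecay Φ a b := by
  obtain ⟨⟨r, hr, hg⟩, h2⟩ := h
  exact hg.stripDecay hr h2

lemma mono {a' b' : ℝ} (h : StripExp Φ a b) (ha : a ≤ a') (hb : b' ≤ b) : StripExp Φ a' b' := by
  obtain ⟨⟨r, hr, hg⟩, h2⟩ := h
  exact ⟨⟨r, hr, hg.mono ha hb⟩, fun s h1 h3 => h2 s (ha.trans h1) (h3.trans hb)⟩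

lemma neg_pow_mul (h : StripExp Φ a b) (k : ℕ) : StripExp (fun s => (-s) ^ k * Φ s) a b := by
  induction k with
  | zero => simpa using h
  | succ k ih =>
    have := ih.mul_left (p := fun s => -s) StripGrowth.id.neg (fun s _ _ => by fun_prop)
    convert this using 2 with s
    ring

end StripExp

/-- The Mellin–Barnes integral of `Φ` over `Re s = σ` at the point `x = exp ξ`, without the factor
`1 / (2 π)`. -/
def barnes (σ : ℝ) (Φ : ℂ → ℂ) (ξ : ℝ) : ℂ := vint σ fun s => Φ s * cexp (-s * ξ)

variable {Φ Ψ : ℂ → ℂ} {σ : ℝ}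

lemma norm_cexp_vline (σ t ξ : ℝ) : ‖cexp (-(σ + t * I) * ξ)‖ = Real.exp (-σ * ξ) := by
  rw [Complex.norm_exp]
  simp

lemma StripExp.integrable_barnes (h : StripExp Φ σ σ) (ξ : ℝ) :
    Integrable fun t : ℝ => Φ (σ + t * I) * cexp (-(σ + t * I) * ξ) :=
  (h.mul_exp ξ).stripDecay.integrable le_rfl le_rfl

lemma StripExp.hasDerivAt_barnes (h : StripExp Φ σ σ) (ξ : ℝ) :
    HasDerivAt (barnes σ Φ) (barnes σ (fun s => -s * Φ s) ξ) ξ := by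
  have h1 : StripExp (fun s => -s * Φ s) σ σ := by simpa using h.neg_pow_mul 1
  obtain ⟨C, hC, hb⟩ := h1.stripDecay.2
  refine (hasDerivAt_integral_of_dominated_loc_of_deriv_le
    (F := fun (ξ : ℝ) (t : ℝ) => Φ (σ + t * I) * cexp (-(σ + t * I) * ξ))
    (F' := fun (ξ : ℝ) (t : ℝ) => -(σ + t * I) * Φ (σ + t * I) * cexp (-(σ + t * I) * ξ))
    (bound := fun t => C * Real.exp (|σ| * (|ξ| + 1)) * (1 + t ^ 2)⁻¹)
    (Metric.ball_mem_nhds ξ one_pos) ?_ (h.integrable_barnes ξ)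
    (h1.integrable_barnes ξ).aestronglyMeasurable ?_
    (integrable_inv_one_add_sq.const_mul _) ?_).2
  · exact Eventually.of_forall fun ξ' => (h.integrable_barnes ξ').aestronglyMeasurable
  · refine Eventually.of_forall fun t ξ' hξ' => ?_
    rw [norm_mul, norm_cexp_vline]
    have h2 := hb (σ + t * I) (by simp) (by simp)
    rw [vline_im] at h2
    have h3 : Real.exp (-σ * ξ') ≤ Real.exp (|σ| * (|ξ| + 1)) := by
      refine Real.exp_le_exp.2 ((le_abs_self _).trans ?_)
      rw [abs_mul, abs_neg]
      gcongr
      rw [Metric.mem_ball, Real.dist_eq] at hξ'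
      have := abs_sub_abs_le_abs_sub ξ' ξ
      linarith
    calc _ ≤ C / (1 + t ^ 2) * Real.exp (|σ| * (|ξ| + 1)) := by gcongr
      _ = _ := by rw [div_eq_mul_inv]; ring
  · refine Eventually.of_forall fun t ξ' _ => ?_
    have h4 : HasDerivAt (fun ξ : ℝ => cexp (-(σ + t * I) * ξ))
        (cexp (-(σ + t * I) * ξ') * (-(σ + t * I))) ξ' := by
      have := ((hasDerivAt_id ξ').ofReal_comp.const_mul (-(σ + t * I : ℂ))).cexp
      simpa using this
    exact (h4.const_mul (Φ (σ + t * I))).congr_deriv (by ring)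

/-- The derivatives of a Mellin–Barnes integral with respect to `ξ`. -/
def barnesD (σ : ℝ) (Φ : ℂ → ℂ) (k : ℕ) : ℝ → ℂ := barnes σ fun s => (-s) ^ k * Φ s

lemma StripExp.hasDerivAt_barnesD (h : StripExp Φ σ σ) (k : ℕ) (ξ : ℝ) :
    HasDerivAt (barnesD σ Φ k) (barnesD σ Φ (k + 1) ξ) ξ := by
  have := (h.neg_pow_mul k).hasDerivAt_barnes ξ
  simpa only [barnesD, pow_succ', mul_assoc] using this

lemma barnesD_zero : barnesD σ Φ 0 = barnes σ Φ := by
  simp [barnesD]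

/-- A Mellin–Barnes integral is `O(exp (-σ ξ))`. -/
lemma exists_norm_barnes_le (σ : ℝ) (Φ : ℂ → ℂ) :
    ∃ C : ℝ, 0 ≤ C ∧ ∀ ξ : ℝ, ‖barnes σ Φ ξ‖ ≤ C * Real.exp (-σ * ξ) := by
  refine ⟨∫ t : ℝ, ‖Φ (σ + t * I)‖, integral_nonneg fun _ => norm_nonneg _, fun ξ => ?_⟩
  rw [← integral_mul_const]
  refine (norm_integral_le_integral_norm _).trans (le_of_eq ?_)
  refine integral_congr_ae (Eventually.of_forall fun t => ?_)
  simp only [norm_mul, norm_cexp_vline]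

lemma isBigO_barnes (σ : ℝ) (Φ : ℂ → ℂ) (l : Filter ℝ) :
    barnes σ Φ =O[l] fun ξ => Real.exp (-σ * ξ) := by
  obtain ⟨C, _, hC⟩ := exists_norm_barnes_le σ Φ
  refine IsBigO.of_bound C (Eventually.of_forall fun ξ => ?_)
  rw [Real.norm_of_nonneg (Real.exp_pos _).le]
  exact hC ξ

/-- The functional equation of `Φ` yields a differential equation for its Mellin–Barnes integral. -/
lemma barnes_recurrence {L R : ℂ → ℂ} (h : StripExp Ψ σ (σ + 1))
    (h1 : ∀ s : ℂ, s.re = σ → L s * Φ s = Ψ (s + 1)) (h2 : ∀ s : ℂ, s.re = σ → R s * Φ s = Ψ s)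
    (ξ : ℝ) : barnes σ (fun s => L s * Φ s) ξ = Real.exp ξ * barnes σ (fun s => R s * Φ s) ξ := by
  have e1 : barnes σ (fun s => L s * Φ s) ξ =
      vint σ fun s => Real.exp ξ * ((fun s => Ψ s * cexp (-s * ξ)) (s + 1)) := by
    refine vint_congr fun s hs => ?_
    simp only
    rw [h1 s hs, ofReal_exp, show -(s + 1) * (ξ : ℂ) = -s * ξ - ξ by ring, Complex.exp_sub]
    field_simp
  have e2 : barnes σ (fun s => R s * Φ s) ξ = vint σ fun s => Ψ s * cexp (-s * ξ) :=
    vint_congr fun s hs => congrArg (· * cexp (-s * ξ)) (h2 s hs)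
  have e3 : (vint σ fun s => Real.exp ξ * ((fun s => Ψ s * cexp (-s * ξ)) (s + 1))) =
      Real.exp ξ * vint σ (fun s => (fun s => Ψ s * cexp (-s * ξ)) (s + 1)) := by
    simp only [vint]
    rw [integral_const_mul]
  -- Replacing s + 1 by s moves the line to Re s = σ + 1, with a factor exp ξ; holomorphy of Ψ in
  -- between brings it back to σ.
  rw [e1, e2, e3, vint_add_one σ fun s => Ψ s * cexp (-s * ξ), vint_shift (by linarith) (h.mul_exp ξ).stripDecay]

/-- Differentiation in ξ multiplies the symbol by -s, so a cubic symbol is a third order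
differential operator, with signs alternating. -/
lemma StripExp.barnes_cubic (h : StripExp Φ σ σ) (c₀ c₁ c₂ c₃ : ℂ) (ξ : ℝ) :
    barnes σ (fun s => (c₀ + c₁ * s + c₂ * s ^ 2 + c₃ * s ^ 3) * Φ s) ξ =
      c₀ * barnesD σ Φ 0 ξ - c₁ * barnesD σ Φ 1 ξ + c₂ * barnesD σ Φ 2 ξ - c₃ * barnesD σ Φ 3 ξ := by
  simp only [barnesD, barnes, vint]
  have hi := fun k => (h.neg_pow_mul k).integrable_barnes ξ
  have e1 := integral_sub ((hi 0).const_mul c₀) ((hi 1).const_mul c₁)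
  have e2 := integral_add (((hi 0).const_mul c₀).sub ((hi 1).const_mul c₁)) ((hi 2).const_mul c₂)
  have e3 := integral_sub ((((hi 0).const_mul c₀).sub ((hi 1).const_mul c₁)).add
    ((hi 2).const_mul c₂)) ((hi 3).const_mul c₃)
  simp only [Pi.sub_apply, Pi.add_apply] at e2 e3
  rw [← integral_const_mul, ← integral_const_mul, ← integral_const_mul, ← integral_const_mul,
    ← e1, ← e2, ← e3]
  refine integral_congr_ae (Eventually.of_forall fun t => ?_)
  simp only
  ring

/-! ### The Legendre equation and its symmetric square -/

/-- The logistic function `x / (1 + x)` at `x = exp ξ`. -/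
def mOf (ξ : ℝ) : ℝ := Real.exp ξ / (1 + Real.exp ξ)

lemma mOf_pos (ξ : ℝ) : 0 < mOf ξ := by unfold mOf; positivity

lemma mOf_lt_one (ξ : ℝ) : mOf ξ < 1 := by
  unfold mOf
  rw [div_lt_one (by positivity)]
  linarith

lemma one_sub_mOf (ξ : ℝ) : 1 - mOf ξ = (1 + Real.exp ξ)⁻¹ := by
  unfold mOf
  have : 1 + Real.exp ξ ≠ 0 := by positivity
  field_simp
  ring

lemma hasDerivAt_mOf (ξ : ℝ) : HasDerivAt mOf (mOf ξ * (1 - mOf ξ)) ξ := by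
  have h1 : 1 + Real.exp ξ ≠ 0 := by positivity
  refine ((Real.hasDerivAt_exp ξ).fun_div ((Real.hasDerivAt_exp ξ).const_add 1) h1).congr_deriv ?_
  rw [one_sub_mOf, mOf]
  field_simp
  ring

lemma hasDerivAt_mOf_ofReal (ξ : ℝ) :
    HasDerivAt (fun ξ => (mOf ξ : ℂ)) (mOf ξ * (1 - mOf ξ) : ℂ) ξ := by
  simpa using (hasDerivAt_mOf ξ).ofReal_comp

lemma tendsto_mOf_atBot : Tendsto mOf atBot (𝓝 0) := by
  have h := Real.tendsto_exp_atBot.div (Real.tendsto_exp_atBot.const_add 1) (by norm_num)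
  rw [zero_div] at h
  exact h

/-- The coefficient of `q` in the Legendre equation. -/
def coeffB (b : ℂ) (τ : ℝ) (ξ : ℝ) : ℂ :=
  (τ ^ 2 * (1 - mOf ξ) + b * (1 - b) * mOf ξ) / 4

/-- `q`, with derivative `q₁`, solves the Legendre equation, written for the function
`x^{-1/4} P(√((1+x)/x))` of `ξ = log x`. -/
def IsSol₂ (b : ℂ) (τ : ℝ) (q q₁ : ℝ → ℂ) : Prop :=
  ∀ ξ, HasDerivAt q (q₁ ξ) ξ ∧ HasDerivAt q₁ (-(mOf ξ / 2 * q₁ ξ + coeffB b τ ξ * q ξ)) ξ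

/-- `u`, with derivatives `u₁` and `u₂`, solves the symmetric square of the Legendre equation. -/
def IsSol₃ (b : ℂ) (τ : ℝ) (u u₁ u₂ : ℝ → ℂ) : Prop :=
  ∀ ξ, HasDerivAt u (u₁ ξ) ξ ∧ HasDerivAt u₁ (u₂ ξ) ξ ∧
    HasDerivAt u₂ (-(3 / 2 * mOf ξ * u₂ ξ +
      (mOf ξ / 2 + τ ^ 2 * (1 - mOf ξ) + b * (1 - b) * mOf ξ) * u₁ ξ +
      mOf ξ / 2 * (b * (1 - b)) * u ξ)) ξ

variable {b : ℂ} {τ : ℝ} {q q₁ r r₁ u u₁ u₂ v v₁ v₂ : ℝ → ℂ}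

lemma IsSol₂.add (hq : IsSol₂ b τ q q₁) (hr : IsSol₂ b τ r r₁) :
    IsSol₂ b τ (fun ξ => q ξ + r ξ) (fun ξ => q₁ ξ + r₁ ξ) := fun ξ => by
  refine ⟨(hq ξ).1.add (hr ξ).1, ?_⟩
  exact ((hq ξ).2.add (hr ξ).2).congr_deriv (by ring)

lemma IsSol₂.const_mul (c : ℂ) (hq : IsSol₂ b τ q q₁) :
    IsSol₂ b τ (fun ξ => c * q ξ) (fun ξ => c * q₁ ξ) := fun ξ => by
  refine ⟨(hq ξ).1.const_mul c, ?_⟩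
  exact ((hq ξ).2.const_mul c).congr_deriv (by ring)

lemma IsSol₃.add (hu : IsSol₃ b τ u u₁ u₂) (hv : IsSol₃ b τ v v₁ v₂) :
    IsSol₃ b τ (fun ξ => u ξ + v ξ) (fun ξ => u₁ ξ + v₁ ξ) (fun ξ => u₂ ξ + v₂ ξ) := fun ξ => by
  refine ⟨(hu ξ).1.add (hv ξ).1, (hu ξ).2.1.add (hv ξ).2.1, ?_⟩
  exact ((hu ξ).2.2.add (hv ξ).2.2).congr_deriv (by ring)

lemma IsSol₃.const_mul (c : ℂ) (hu : IsSol₃ b τ u u₁ u₂) :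
    IsSol₃ b τ (fun ξ => c * u ξ) (fun ξ => c * u₁ ξ) (fun ξ => c * u₂ ξ) := fun ξ => by
  refine ⟨(hu ξ).1.const_mul c, (hu ξ).2.1.const_mul c, ?_⟩
  exact ((hu ξ).2.2.const_mul c).congr_deriv (by ring)

lemma hasDerivAt_coeffB (b : ℂ) (τ ξ : ℝ) :
    HasDerivAt (coeffB b τ) ((b * (1 - b) - τ ^ 2) * (mOf ξ * (1 - mOf ξ)) / 4) ξ := by
  have h := hasDerivAt_mOf_ofReal ξ
  have := (((h.const_sub 1).const_mul ((τ : ℂ) ^ 2)).fun_add (h.const_mul (b * (1 - b)))).div_const 4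
  exact this.congr_deriv (by ring)

/-- The product of two solutions of the Legendre equation. -/
lemma IsSol₂.fun_mul (hq : IsSol₂ b τ q q₁) (hr : IsSol₂ b τ r r₁) :
    IsSol₃ b τ (fun ξ => q ξ * r ξ) (fun ξ => q₁ ξ * r ξ + q ξ * r₁ ξ)
      (fun ξ => 2 * (q₁ ξ * r₁ ξ) - mOf ξ / 2 * (q₁ ξ * r ξ + q ξ * r₁ ξ) -
        2 * coeffB b τ ξ * (q ξ * r ξ)) := fun ξ => by
  have h1 := (hq ξ).1.fun_mul (hr ξ).1
  have h2 := ((hq ξ).2.fun_mul (hr ξ).1).fun_add ((hq ξ).1.fun_mul (hr ξ).2)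
  have h3 := ((hq ξ).2.fun_mul (hr ξ).2).const_mul 2
  have hm := hasDerivAt_mOf_ofReal ξ
  have hB := hasDerivAt_coeffB b τ ξ
  refine ⟨h1, ?_, ?_⟩
  · exact h2.congr_deriv (by ring)
  · have h4 := ((h3.fun_sub ((hm.div_const 2).fun_mul h2)).fun_sub ((hB.const_mul 2).fun_mul h1))
    exact h4.congr_deriv (by simp only [coeffB]; ring)

/-- The Wronskian. -/
lemma IsSol₂.wronskian (hq : IsSol₂ b τ q q₁) (hr : IsSol₂ b τ r r₁) :
    ∃ c : ℂ, ∀ ξ, (q ξ * r₁ ξ - q₁ ξ * r ξ) * Real.sqrt (1 + Real.exp ξ) = c := by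
  have hd : ∀ ξ, HasDerivAt
      (fun ξ => (q ξ * r₁ ξ - q₁ ξ * r ξ) * (Real.sqrt (1 + Real.exp ξ) : ℂ)) 0 ξ := by
    intro ξ
    have hpos : 0 < 1 + Real.exp ξ := by positivity
    have h1 := ((hq ξ).1.fun_mul (hr ξ).2).fun_sub ((hq ξ).2.fun_mul (hr ξ).1)
    have h2 := ((((Real.hasDerivAt_exp ξ).const_add 1).sqrt hpos.ne')).ofReal_comp
    have h3 := h1.fun_mul h2
    refine h3.congr_deriv ?_
    have h4 : ((Real.exp ξ / (2 * Real.sqrt (1 + Real.exp ξ)) : ℝ) : ℂ) =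
        mOf ξ / 2 * Real.sqrt (1 + Real.exp ξ) := by
      rw [mOf]
      rw [← ofReal_ofNat, ← ofReal_div, ← ofReal_mul, ofReal_inj]
      have h5 : Real.sqrt (1 + Real.exp ξ) ≠ 0 := (Real.sqrt_pos.2 hpos).ne'
      have h6 := Real.mul_self_sqrt hpos.le
      field_simp
      rw [sq, h6]
    rw [h4]
    ring
  refine ⟨_, fun ξ => is_const_of_deriv_eq_zero (fun x => (hd x).differentiableAt)
    (fun x => (hd x).deriv) ξ 0⟩

/-- The polarized first integral of the symmetric square. -/
def symInt (b : ℂ) (τ : ℝ) (q q₁ r r₁ u u₁ u₂ : ℝ → ℂ) (ξ : ℝ) : ℂ :=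
  u ξ * (q₁ ξ * r₁ ξ) - u₁ ξ * (q ξ * r₁ ξ + q₁ ξ * r ξ) / 2 +
    (u₂ ξ + mOf ξ / 2 * u₁ ξ + 2 * coeffB b τ ξ * u ξ) * (q ξ * r ξ) / 2

lemma IsSol₃.symInt_const (hu : IsSol₃ b τ u u₁ u₂) (hq : IsSol₂ b τ q q₁)
    (hr : IsSol₂ b τ r r₁) :
    ∃ c : ℂ, ∀ ξ, symInt b τ q q₁ r r₁ u u₁ u₂ ξ * (1 + Real.exp ξ) = c := by
  have hd : ∀ ξ, HasDerivAt
      (fun ξ => symInt b τ q q₁ r r₁ u u₁ u₂ ξ * (1 + Real.exp ξ)) 0 ξ := by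
    intro ξ
    obtain ⟨hq0, hq1⟩ := hq ξ
    obtain ⟨hr0, hr1⟩ := hr ξ
    obtain ⟨hu0, hu1, hu2⟩ := hu ξ
    have hm := hasDerivAt_mOf_ofReal ξ
    have hB := hasDerivAt_coeffB b τ ξ
    have h1 := hu0.fun_mul (hq1.fun_mul hr1)
    have h2 := (hu1.fun_mul ((hq0.fun_mul hr1).fun_add (hq1.fun_mul hr0))).div_const 2
    have h3 := (((hu2.fun_add ((hm.div_const 2).fun_mul hu1)).fun_add ((hB.const_mul 2).fun_mul hu0)).fun_mul
      (hq0.fun_mul hr0)).div_const 2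
    have he : HasDerivAt (fun ξ : ℝ => (1 + Real.exp ξ : ℂ)) (mOf ξ * (1 + Real.exp ξ)) ξ := by
      have := ((Real.hasDerivAt_exp ξ).ofReal_comp).const_add (1 : ℂ)
      refine this.congr_deriv ?_
      simp only [mOf]
      have h5 : (1 + Real.exp ξ : ℂ) ≠ 0 := by
        exact_mod_cast (by positivity : (1 + Real.exp ξ) ≠ 0)
      push_cast at h5 ⊢
      field_simp
    have h4 := ((h1.fun_sub h2).fun_add h3).fun_mul he
    exact h4.congr_deriv (by simp only [coeffB]; ring)
  exact ⟨_, fun ξ => is_const_of_deriv_eq_zero (fun x => (hd x).differentiableAt)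
    (fun x => (hd x).deriv) ξ 0⟩

/-- `q`, with derivative `q₁`, is asymptotic to `exp (ρ ξ)` as `ξ → -∞`. -/
def IsAsymp (ρ : ℂ) (q q₁ : ℝ → ℂ) : Prop :=
  (fun ξ : ℝ => q ξ - cexp (ρ * ξ)) =o[atBot] (fun _ => (1 : ℝ)) ∧
    (fun ξ : ℝ => q₁ ξ - ρ * cexp (ρ * ξ)) =o[atBot] (fun _ => (1 : ℝ))

lemma isBigO_cexp_mul {ρ : ℂ} (hρ : ρ.re = 0) (l : Filter ℝ) :
    (fun ξ : ℝ => cexp (ρ * ξ)) =O[l] (fun _ => (1 : ℝ)) := by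
  refine IsBigO.of_bound 1 (Eventually.of_forall fun ξ => ?_)
  simp [Complex.norm_exp, hρ]

lemma IsAsymp.isBigO {ρ : ℂ} (hρ : ρ.re = 0) (h : IsAsymp ρ q q₁) :
    q =O[atBot] (fun _ => (1 : ℝ)) ∧ q₁ =O[atBot] (fun _ => (1 : ℝ)) := by
  have h1 := h.1.isBigO.add (isBigO_cexp_mul hρ atBot)
  have h2 := h.2.isBigO.add ((isBigO_cexp_mul hρ atBot).const_mul_left ρ)
  simp only [sub_add_cancel] at h1 h2
  exact ⟨h1, h2⟩

lemma isBigO_mOf : (fun ξ => (mOf ξ : ℂ)) =O[atBot] (fun _ => (1 : ℝ)) := by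
  refine IsBigO.of_bound 1 (Eventually.of_forall fun ξ => ?_)
  rw [norm_real, Real.norm_of_nonneg (mOf_pos ξ).le]
  simpa using (mOf_lt_one ξ).le

lemma isBigO_coeffB (b : ℂ) (τ : ℝ) : coeffB b τ =O[atBot] (fun _ => (1 : ℝ)) := by
  have h0 : (fun _ : ℝ => (1 : ℂ)) =O[atBot] (fun _ => (1 : ℝ)) := isBigO_const_const _ one_ne_zero _
  have h1 := ((h0.sub isBigO_mOf).const_mul_left ((τ : ℂ) ^ 2)).add
    (isBigO_mOf.const_mul_left (b * (1 - b)))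
  have h2 := h1.const_mul_left (4⁻¹ : ℂ)
  refine h2.congr_left fun ξ => ?_
  simp only [coeffB]
  ring

lemma isLittleO_mul_one {f g : ℝ → ℂ} {l : Filter ℝ} (hf : f =o[l] (fun _ => (1 : ℝ)))
    (hg : g =O[l] (fun _ => (1 : ℝ))) : (fun ξ => f ξ * g ξ) =o[l] (fun _ => (1 : ℝ)) := by
  simpa using hf.mul_isBigO hg

lemma isBigO_mul_one {f g : ℝ → ℂ} {l : Filter ℝ} (hf : f =O[l] (fun _ => (1 : ℝ)))
    (hg : g =O[l] (fun _ => (1 : ℝ))) : (fun ξ => f ξ * g ξ) =O[l] (fun _ => (1 : ℝ)) := by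
  simpa using hf.mul hg

lemma tendsto_sqrt_one_add_exp :
    Tendsto (fun ξ => (Real.sqrt (1 + Real.exp ξ) : ℂ)) atBot (𝓝 1) := by
  have h1 : Tendsto (fun ξ => Real.sqrt (1 + Real.exp ξ)) atBot (𝓝 (Real.sqrt (1 + 0))) :=
    (Real.continuous_sqrt.tendsto _).comp (Real.tendsto_exp_atBot.const_add 1)
  have h2 := (continuous_ofReal.tendsto _).comp h1
  simpa [Function.comp_def] using h2

lemma tendsto_one_add_exp : Tendsto (fun ξ => (1 + Real.exp ξ : ℂ)) atBot (𝓝 1) := by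
  have h2 := ((continuous_ofReal.tendsto _).comp Real.tendsto_exp_atBot).const_add (1 : ℂ)
  simpa [Function.comp_def] using h2

/-- By Abel's identity the Wronskian times √(1 + exp ξ) is constant, and its limit at -∞ is -2ρ. -/
lemma wronskian_ne_zero {ρ : ℂ} (hρ : ρ.re = 0) (hρ0 : ρ ≠ 0) (hq : IsSol₂ b τ q q₁)
    (hr : IsSol₂ b τ r r₁) (aq : IsAsymp ρ q q₁) (ar : IsAsymp (-ρ) r r₁) (ξ : ℝ) :
    q ξ * r₁ ξ - q₁ ξ * r ξ ≠ 0 := by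
  have hρ' : (-ρ).re = 0 := by simp [hρ]
  have hlim : (fun ξ => (q ξ * r₁ ξ - q₁ ξ * r ξ) + 2 * ρ) =o[atBot] (fun _ => (1 : ℝ)) := by
    have h1 := isLittleO_mul_one aq.1 (ar.isBigO hρ').2
    have h2 := isLittleO_mul_one ar.2 (isBigO_cexp_mul hρ atBot)
    have h3 := isLittleO_mul_one aq.2 (ar.isBigO hρ').1
    have h4 := (isLittleO_mul_one ar.1 (isBigO_cexp_mul hρ atBot)).const_mul_left ρ
    refine (((h1.add h2).sub h3).sub h4).congr_left fun ξ => ?_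
    have e : cexp (-ρ * ξ) * cexp (ρ * ξ) = 1 := by rw [← Complex.exp_add]; simp
    linear_combination (2 * ρ) * e
  rw [isLittleO_one_iff] at hlim
  obtain ⟨c, hc⟩ := hq.wronskian hr
  have h5 := (hlim.add_const (-(2 * ρ))).mul tendsto_sqrt_one_add_exp
  have h6 : c = -(2 * ρ) := by
    refine tendsto_nhds_unique (tendsto_const_nhds (x := c) (f := (atBot : Filter ℝ))) ?_
    simpa [hc] using h5
  intro h0
  have := hc ξ
  rw [h0, zero_mul, h6] at this
  simp [hρ0] at this

/-- A solution of the Legendre equation that vanishes at `ξ = -∞` is zero. -/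
lemma IsSol₂.eq_zero {ρ : ℂ} (hρ : ρ.re = 0) (hρ0 : ρ ≠ 0) (hq : IsSol₂ b τ q q₁)
    (hr : IsSol₂ b τ r r₁) (aq : IsAsymp ρ q q₁) (ar : IsAsymp (-ρ) r r₁)
    (hv : IsSol₂ b τ v v₁) (h0 : v =o[atBot] (fun _ => (1 : ℝ)))
    (h1 : v₁ =o[atBot] (fun _ => (1 : ℝ))) (ξ : ℝ) : v ξ = 0 := by
  have key : ∀ {p p₁ : ℝ → ℂ}, IsSol₂ b τ p p₁ → p =O[atBot] (fun _ => (1 : ℝ)) →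
      p₁ =O[atBot] (fun _ => (1 : ℝ)) → ∀ ξ, v ξ * p₁ ξ - v₁ ξ * p ξ = 0 := by
    intro p p₁ hp hO hO₁ ξ
    obtain ⟨c, hc⟩ := hv.wronskian hp
    have h2 := (isLittleO_one_iff ℝ).1 ((isLittleO_mul_one h0 hO₁).sub (isLittleO_mul_one h1 hO))
    have h3 := h2.mul tendsto_sqrt_one_add_exp
    have h4 : c = 0 := by
      refine tendsto_nhds_unique (tendsto_const_nhds (x := c) (f := (atBot : Filter ℝ))) ?_
      simpa [hc] using h3
    have h5 := hc ξ
    rw [h4, mul_eq_zero] at h5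
    exact h5.resolve_right (ofReal_ne_zero.2 (Real.sqrt_pos.2 (by positivity)).ne')
  have hρ' : (-ρ).re = 0 := by simp [hρ]
  have e1 := key hq (aq.isBigO hρ).1 (aq.isBigO hρ).2 ξ
  have e2 := key hr (ar.isBigO hρ').1 (ar.isBigO hρ').2 ξ
  have hW := wronskian_ne_zero hρ hρ0 hq hr aq ar ξ
  -- Both Wronskians of v with the basis vanish, and eliminating v₁ leaves v times the Wronskian of
  -- the basis.
  have : v ξ * (q ξ * r₁ ξ - q₁ ξ * r ξ) = 0 := by linear_combination q ξ * e2 - r ξ * e1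
  exact (mul_eq_zero.1 this).resolve_right hW

/-- A solution of the symmetric square that vanishes at `ξ = -∞` is zero. -/
lemma IsSol₃.eq_zero {ρ : ℂ} (hρ : ρ.re = 0) (hρ0 : ρ ≠ 0) (hq : IsSol₂ b τ q q₁)
    (hr : IsSol₂ b τ r r₁) (aq : IsAsymp ρ q q₁) (ar : IsAsymp (-ρ) r r₁)
    (hv : IsSol₃ b τ v v₁ v₂) (h0 : v =o[atBot] (fun _ => (1 : ℝ)))
    (h1 : v₁ =o[atBot] (fun _ => (1 : ℝ))) (h2 : v₂ =o[atBot] (fun _ => (1 : ℝ)))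
    (ξ : ℝ) : v ξ = 0 := by
  have key : ∀ {p p₁ s s₁ : ℝ → ℂ}, IsSol₂ b τ p p₁ → p =O[atBot] (fun _ => (1 : ℝ)) →
      p₁ =O[atBot] (fun _ => (1 : ℝ)) → IsSol₂ b τ s s₁ → s =O[atBot] (fun _ => (1 : ℝ)) →
      s₁ =O[atBot] (fun _ => (1 : ℝ)) → ∀ ξ, symInt b τ p p₁ s s₁ v v₁ v₂ ξ = 0 := by
    intro p p₁ s s₁ hp pO pO₁ hs sO sO₁ ξ
    obtain ⟨c, hc⟩ := hv.symInt_const hp hs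
    have t1 := isLittleO_mul_one h0 (isBigO_mul_one pO₁ sO₁)
    have t2 := (isLittleO_mul_one h1 ((isBigO_mul_one pO sO₁).add (isBigO_mul_one pO₁ sO))).const_mul_left
      (2⁻¹ : ℂ)
    have t3 := isLittleO_mul_one h2 (isBigO_mul_one pO sO)
    have t4 := isLittleO_mul_one h1 (isBigO_mul_one isBigO_mOf (isBigO_mul_one pO sO))
    have t5 := isLittleO_mul_one h0 (isBigO_mul_one (isBigO_coeffB b τ) (isBigO_mul_one pO sO))
    have t6 : symInt b τ p p₁ s s₁ v v₁ v₂ =o[atBot] (fun _ => (1 : ℝ)) := by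
      refine ((((t1.sub t2).add (t3.const_mul_left (2⁻¹ : ℂ))).add
        (t4.const_mul_left (4⁻¹ : ℂ))).add t5).congr_left fun ξ => ?_
      simp only [symInt]
      ring
    have h3 := ((isLittleO_one_iff ℝ).1 t6).mul tendsto_one_add_exp
    have h4 : c = 0 := by
      refine tendsto_nhds_unique (tendsto_const_nhds (x := c) (f := (atBot : Filter ℝ))) ?_
      simp only [hc, zero_mul] at h3
      exact h3
    have h5 := hc ξ
    rw [h4, mul_eq_zero] at h5
    refine h5.resolve_right ?_
    exact_mod_cast (by positivity : (1 + Real.exp ξ) ≠ 0)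
  have hρ' : (-ρ).re = 0 := by simp [hρ]
  obtain ⟨q0, q1⟩ := aq.isBigO hρ
  obtain ⟨r0, r1⟩ := ar.isBigO hρ'
  have e1 := key hq q0 q1 hq q0 q1 ξ
  have e2 := key hq q0 q1 hr r0 r1 ξ
  have e3 := key hr r0 r1 hr r0 r1 ξ
  have hW := wronskian_ne_zero hρ hρ0 hq hr aq ar ξ
  simp only [symInt] at e1 e2 e3
  -- The three polarized first integrals form a linear system in v, v₁ and v₂. In this combination
  -- the terms other than v cancel, and the coefficient of v is the squared Wronskian.
  have : v ξ * (q ξ * r₁ ξ - q₁ ξ * r ξ) ^ 2 = 0 := by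
    linear_combination r ξ ^ 2 * e1 - 2 * q ξ * r ξ * e2 + q ξ ^ 2 * e3
  exact (mul_eq_zero.1 this).resolve_right (pow_ne_zero 2 hW)

end

section

/-! ### The hypergeometric equation -/

section Hypergeometric

variable {a b c : ℂ}

lemma ne_neg_nat_of_re_pos {a : ℂ} (ha : 0 < a.re) (k : ℕ) : (k : ℂ) ≠ -a := fun h => by
  have := congrArg Complex.re h
  simp at this
  have h2 : (0:ℝ) ≤ k := by positivity
  linarith

lemma hypergeometric_coeff_succ (hc : 0 < c.re) (n : ℕ) :
    (n + 1) * (c + n) * ordinaryHypergeometricCoefficient a b c (n + 1) =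
      (a + n) * (b + n) * ordinaryHypergeometricCoefficient a b c n := by
  have h1 : (ascPochhammer ℂ n).eval c ≠ 0 := by
    rw [Ne, ascPochhammer_eval_eq_zero_iff]
    rintro ⟨k, _, hk⟩
    exact ne_neg_nat_of_re_pos hc k hk
  have h2 : c + n ≠ 0 := fun h => ne_neg_nat_of_re_pos hc n (eq_neg_of_add_eq_zero_right h)
  have h3 : (n.factorial : ℂ) ≠ 0 := by exact_mod_cast n.factorial_ne_zero
  have h4 : (n + 1 : ℂ) ≠ 0 := by exact_mod_cast n.succ_ne_zero
  simp only [ordinaryHypergeometricCoefficient, ascPochhammer_succ_eval, Nat.factorial_succ]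
  push_cast
  field_simp

/-- The sum of a power series and that of its derivative, at a point inside the unit disc. -/
lemma hasSum_deriv_of_hasSum {u : ℕ → ℂ} {f : ℂ → ℂ}
    (hf : HasFPowerSeriesOnBall f (FormalMultilinearSeries.ofScalars ℂ u) 0 1) {x : ℂ}
    (hx : ‖x‖ < 1) : HasSum (fun n : ℕ => (n + 1) * u (n + 1) * x ^ n) (deriv f x) := by
  have hx' : x ∈ Metric.eball (0 : ℂ) 1 := by
    rw [Metric.mem_eball, edist_zero_right]
    exact_mod_cast (by simpa [enorm_eq_nnnorm, ← NNReal.coe_lt_coe] using hx)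
  have h1 := hf.fderiv.hasSum_sub hx'
  have h2 := (ContinuousLinearMap.apply ℂ ℂ (1 : ℂ)).hasSum h1
  simp only [ContinuousLinearMap.apply_apply, sub_zero, fderiv_apply_one_eq_deriv] at h2
  refine h2.congr_fun fun n => ?_
  simp only [FormalMultilinearSeries.apply_eq_pow_smul_coeff, smul_apply,
    FormalMultilinearSeries.derivSeries_coeff_one, FormalMultilinearSeries.coeff_ofScalars]
  simp
  ring

lemma hasFPowerSeriesOnBall_hypergeometric (ha : 0 < a.re) (hb : 0 < b.re) (hc : 0 < c.re) :
    HasFPowerSeriesOnBall (ordinaryHypergeometric a b c : ℂ → ℂ)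
      (FormalMultilinearSeries.ofScalars ℂ (ordinaryHypergeometricCoefficient a b c)) 0 1 := by
  have h1 := ordinaryHypergeometricSeries_radius_eq_one ℂ a b c fun k =>
    ⟨ne_neg_nat_of_re_pos ha k, ne_neg_nat_of_re_pos hb k, ne_neg_nat_of_re_pos hc k⟩
  have h2 := (ordinaryHypergeometricSeries ℂ a b c).hasFPowerSeriesOnBall (by rw [h1]; simp)
  rw [h1] at h2
  exact h2

/-- Gauss's differential equation. -/
lemma hypergeometric_ode (ha : 0 < a.re) (hb : 0 < b.re) (hc : 0 < c.re) {x : ℂ}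
    (hx : ‖x‖ < 1) :
    x * (1 - x) * deriv (deriv (ordinaryHypergeometric a b c)) x +
      (c - (a + b + 1) * x) * deriv (ordinaryHypergeometric a b c) x -
      a * b * ordinaryHypergeometric a b c x = 0 := by
  set F : ℂ → ℂ := ordinaryHypergeometric a b c
  set u := ordinaryHypergeometricCoefficient a b c
  have hF : HasFPowerSeriesOnBall F (FormalMultilinearSeries.ofScalars ℂ u) 0 1 :=
    hasFPowerSeriesOnBall_hypergeometric ha hb hc
  have hx' : x ∈ Metric.eball (0 : ℂ) 1 := by
    rw [Metric.mem_eball, edist_zero_right]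
    exact_mod_cast (by simpa [enorm_eq_nnnorm, ← NNReal.coe_lt_coe] using hx)
  have s0 : HasSum (fun n : ℕ => u n * x ^ n) (F x) := by
    have := hF.hasSum_sub hx'
    simpa [FormalMultilinearSeries.ofScalars_apply_eq, mul_comm] using this
  have s1 := hasSum_deriv_of_hasSum hF hx
  have hF1 : HasFPowerSeriesOnBall (deriv F)
      (FormalMultilinearSeries.ofScalars ℂ fun n => (n + 1) * u (n + 1)) 0 1 := by
    have h1 : HasFPowerSeriesOnBall (deriv F) _ 0 1 :=
      (ContinuousLinearMap.apply ℂ ℂ (1 : ℂ)).comp_hasFPowerSeriesOnBall hF.fderiv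
    convert h1 using 1
    ext n
    simp [FormalMultilinearSeries.ofScalars]
  have s2 := hasSum_deriv_of_hasSum hF1 hx
  -- Multiplication by x moves each coefficient up by one, and w 0 = 0 fills the vacant constant
  -- term. The instances t1, t2, t3 are the expansions of x F', x F'' and x² F''.
  have shift : ∀ {w : ℕ → ℂ} {S : ℂ}, HasSum (fun n => w (n + 1) * x ^ n) S → w 0 = 0 →
      HasSum (fun n => w n * x ^ n) (x * S) := by
    intro w S h h0
    rw [← hasSum_nat_add_iff' 1]
    simp only [Finset.range_one, Finset.sum_singleton, h0, zero_mul, sub_zero]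
    exact (h.mul_left x).congr_fun fun n => by ring
  have t1 := shift (w := fun n : ℕ => n * u n) (S := deriv F x) (by simpa using s1) (by simp)
  have t2 := shift (w := fun n : ℕ => n * (n + 1) * u (n + 1)) (S := deriv (deriv F) x)
    (s2.congr_fun fun n => by push_cast; ring) (by simp)
  have t3 := shift (w := fun n : ℕ => n * (n - 1) * u n) (S := x * deriv (deriv F) x)
    (t2.congr_fun fun n => by push_cast; ring) (by simp)
  have h := (((t2.sub t3).add (s1.mul_left c)).sub (t1.mul_left (a + b + 1))).sub
    (s0.mul_left (a * b))
  have h0 : HasSum (fun _ : ℕ => (0 : ℂ)) 0 := hasSum_zero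
  have := h.unique (h0.congr_fun ?_)
  · linear_combination this
  · intro n
    have := hypergeometric_coeff_succ (a := a) (b := b) hc n
    change (n + 1) * (c + n) * u (n + 1) = (a + n) * (b + n) * u n at this
    linear_combination (x ^ n) * this

end Hypergeometric

end

section

variable {b ρ : ℂ} {τ : ℝ}

lemma differentiableOn_hypergeometric {A B C : ℂ} (hA : 0 < A.re) (hB : 0 < B.re) (hC : 0 < C.re) :
    DifferentiableOn ℂ (ordinaryHypergeometric A B C : ℂ → ℂ) (Metric.ball 0 1) := by
  have h : Metric.eball (0 : ℂ) 1 = Metric.ball 0 1 := by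
    rw [← ENNReal.ofReal_one, Metric.eball_ofReal]
  rw [← h]
  exact (hasFPowerSeriesOnBall_hypergeometric hA hB hC).analyticOnNhd.differentiableOn

lemma hasDerivAt_hypergeometric {A B C x : ℂ} (hA : 0 < A.re) (hB : 0 < B.re) (hC : 0 < C.re)
    (hx : ‖x‖ < 1) :
    HasDerivAt (ordinaryHypergeometric A B C : ℂ → ℂ)
      (deriv (ordinaryHypergeometric A B C) x) x :=
  ((differentiableOn_hypergeometric hA hB hC).differentiableAt
    (Metric.isOpen_ball.mem_nhds (by simpa using hx))).hasDerivAt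

lemma hasDerivAt_deriv_hypergeometric {A B C x : ℂ} (hA : 0 < A.re) (hB : 0 < B.re)
    (hC : 0 < C.re) (hx : ‖x‖ < 1) :
    HasDerivAt (deriv (ordinaryHypergeometric A B C))
      (deriv (deriv (ordinaryHypergeometric A B C)) x) x :=
  (((differentiableOn_hypergeometric hA hB hC).deriv Metric.isOpen_ball).differentiableAt
    (Metric.isOpen_ball.mem_nhds (by simpa using hx))).hasDerivAt

lemma norm_ofReal_lt_one {x : ℝ} (h0 : 0 ≤ x) (h1 : x < 1) : ‖(x : ℂ)‖ < 1 := by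
  rwa [norm_real, Real.norm_of_nonneg h0]

/-! ### Solutions of the second kind -/

/-- The hypergeometric factor of a solution of the second kind. -/
def hypQ (b ρ : ℂ) : ℂ → ℂ := ordinaryHypergeometric (b / 2 + ρ + 1 / 2) (b / 2 + ρ) (1 + 2 * ρ)

/-- The elementary factor of a solution of the second kind. -/
def elemQ (b ρ : ℂ) (ξ : ℝ) : ℂ := cexp (ρ * ξ + (b / 2 + ρ) * (Real.log (1 - mOf ξ) : ℝ))

/-- The solution of the Legendre equation asymptotic to `exp (ρ ξ)` as `ξ → -∞`. -/
def solQ (b ρ : ℂ) (ξ : ℝ) : ℂ := elemQ b ρ ξ * hypQ b ρ (mOf ξ)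

/-- The derivative of `solQ`. -/
def solQ₁ (b ρ : ℂ) (ξ : ℝ) : ℂ :=
  elemQ b ρ ξ * ((ρ - (b / 2 + ρ) * mOf ξ) * hypQ b ρ (mOf ξ) +
    mOf ξ * (1 - mOf ξ) * deriv (hypQ b ρ) (mOf ξ))

lemma hasDerivAt_elemQ (b ρ : ℂ) (ξ : ℝ) :
    HasDerivAt (elemQ b ρ) (elemQ b ρ ξ * (ρ - (b / 2 + ρ) * mOf ξ)) ξ := by
  have h1 : HasDerivAt (fun ξ => Real.log (1 - mOf ξ)) (-mOf ξ) ξ := by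
    have h2 : 1 - mOf ξ ≠ 0 := by linarith [mOf_lt_one ξ]
    refine (((hasDerivAt_mOf ξ).const_sub 1).log h2).congr_deriv ?_
    field_simp
  have h3 := (((hasDerivAt_id ξ).ofReal_comp.const_mul ρ).fun_add
    (h1.ofReal_comp.const_mul (b / 2 + ρ))).cexp
  refine h3.congr_deriv ?_
  simp only [elemQ, id]
  push_cast
  ring

/-- With m = x/(1+x), the ansatz e^{ρξ}(1-m)^{b/2+ρ}F(m) reduces the Legendre equation to Gauss's
equation in m. The condition on ρ is the indicial equation at m = 0, that is, at ξ = -∞. -/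
lemma isSol₂_solQ (hb : 0 < b.re) (hρ : ρ.re = 0) (hτ : 4 * ρ ^ 2 = -(τ : ℂ) ^ 2) :
    IsSol₂ b τ (solQ b ρ) (solQ₁ b ρ) := by
  intro ξ
  have hA : 0 < (b / 2 + ρ + 1 / 2).re := by simp [hρ]; linarith
  have hB : 0 < (b / 2 + ρ).re := by simp [hρ]; linarith
  have hC : 0 < (1 + 2 * ρ).re := by simp [hρ]
  have hx : ‖(mOf ξ : ℂ)‖ < 1 := norm_ofReal_lt_one (mOf_pos ξ).le (mOf_lt_one ξ)
  have ode := hypergeometric_ode hA hB hC hx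
  have hm := hasDerivAt_mOf_ofReal ξ
  have d0 : HasDerivAt (fun ξ : ℝ => hypQ b ρ (mOf ξ)) _ ξ :=
    (hasDerivAt_hypergeometric hA hB hC hx).comp ξ hm
  have d1 : HasDerivAt (fun ξ : ℝ => deriv (hypQ b ρ) (mOf ξ)) _ ξ :=
    HasDerivAt.comp (h₂ := deriv (hypQ b ρ)) ξ (hasDerivAt_deriv_hypergeometric hA hB hC hx) hm
  have dE := hasDerivAt_elemQ b ρ ξ
  refine ⟨(dE.fun_mul d0).congr_deriv ?_, ?_⟩
  · simp only [solQ₁, hypQ]; ring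
  · have h := dE.fun_mul ((((hm.const_mul (b / 2 + ρ)).const_sub ρ).fun_mul d0).fun_add
      ((hm.fun_mul (hm.const_sub 1)).fun_mul d1))
    refine h.congr_deriv ?_
    simp only [solQ₁, solQ, coeffB, hypQ] at ode ⊢
    linear_combination elemQ b ρ ξ * mOf ξ * (1 - mOf ξ) * ode +
      (elemQ b ρ ξ * ordinaryHypergeometric (b / 2 + ρ + 1 / 2) (b / 2 + ρ) (1 + 2 * ρ) (mOf ξ : ℂ) *
        (1 - mOf ξ) / 4) * hτ

lemma isAsymp_solQ (hb : 0 < b.re) (hρ : ρ.re = 0) : IsAsymp ρ (solQ b ρ) (solQ₁ b ρ) := by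
  have hA : 0 < (b / 2 + ρ + 1 / 2).re := by simp [hρ]; linarith
  have hB : 0 < (b / 2 + ρ).re := by simp [hρ]; linarith
  have hC : 0 < (1 + 2 * ρ).re := by simp [hρ]
  have h0 : ‖(0:ℂ)‖ < 1 := by simp
  have hm : Tendsto (fun ξ => (mOf ξ : ℂ)) atBot (𝓝 0) := by
    simpa [Function.comp_def] using (continuous_ofReal.tendsto _).comp tendsto_mOf_atBot
  have hF : Tendsto (fun ξ => hypQ b ρ (mOf ξ)) atBot (𝓝 1) := by
    have := (hasDerivAt_hypergeometric hA hB hC h0).continuousAt.tendsto.comp hm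
    simpa [Function.comp_def, hypQ] using this
  have hF1 : Tendsto (fun ξ => deriv (hypQ b ρ) (mOf ξ)) atBot (𝓝 (deriv (hypQ b ρ) 0)) :=
    (hasDerivAt_deriv_hypergeometric hA hB hC h0).continuousAt.tendsto.comp hm
  have hE : Tendsto (fun ξ => cexp ((b / 2 + ρ) * (Real.log (1 - mOf ξ) : ℝ))) atBot (𝓝 1) := by
    have h1 : Tendsto (fun ξ => Real.log (1 - mOf ξ)) atBot (𝓝 (Real.log (1 - 0))) :=
      (Real.continuousAt_log (by norm_num)).tendsto.comp (tendsto_mOf_atBot.const_sub 1)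
    have h2 := (continuous_ofReal.tendsto _).comp h1
    have h3 := (Complex.continuous_exp.tendsto _).comp (h2.const_mul (b / 2 + ρ))
    simpa [Function.comp_def] using h3
  have hsplit : ∀ ξ, elemQ b ρ ξ = cexp ((b / 2 + ρ) * (Real.log (1 - mOf ξ) : ℝ)) * cexp (ρ * ξ) := by
    intro ξ
    rw [elemQ, add_comm, Complex.exp_add]
  constructor
  · have h1 := (isLittleO_one_iff ℝ).2 (by simpa using (hE.mul hF).sub_const 1)
    refine (isLittleO_mul_one h1 (isBigO_cexp_mul hρ atBot)).congr_left fun ξ => ?_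
    simp only [solQ, hsplit]
    ring
  · have h2 : Tendsto (fun ξ => cexp ((b / 2 + ρ) * (Real.log (1 - mOf ξ) : ℝ)) *
        ((ρ - (b / 2 + ρ) * mOf ξ) * hypQ b ρ (mOf ξ) +
          mOf ξ * (1 - mOf ξ) * deriv (hypQ b ρ) (mOf ξ)) - ρ) atBot (𝓝 0) := by
      have := (hE.mul ((((hm.const_mul (b / 2 + ρ)).const_sub ρ).mul hF).add
        ((hm.mul (hm.const_sub 1)).mul hF1))).sub_const ρ
      simpa using this
    refine (isLittleO_mul_one ((isLittleO_one_iff ℝ).2 h2) (isBigO_cexp_mul hρ atBot)).congr_left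
      fun ξ => ?_
    simp only [solQ₁, hsplit]
    ring

/-! ### The solution of the first kind -/

/-- `√((1+x)/x)` at `x = exp ξ`. -/
def zOf (ξ : ℝ) : ℝ := Real.sqrt (1 + Real.exp (-ξ))

lemma zOf_sq (ξ : ℝ) : zOf ξ ^ 2 = 1 + Real.exp (-ξ) := Real.sq_sqrt (by positivity)

lemma one_lt_zOf (ξ : ℝ) : 1 < zOf ξ := by
  rw [zOf, Real.lt_sqrt (by norm_num)]
  linarith [Real.exp_pos (-ξ)]

lemma arg_exp (ξ : ℝ) : arg (Real.exp ξ) = zOf ξ := by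
  rw [arg, zOf, Real.exp_neg]
  congr 1
  field_simp
  ring

/-- `(z-1)/(z+1)` for `z = √((1+x)/x)`, `x = exp ξ`. -/
def nOf (ξ : ℝ) : ℝ := (zOf ξ - 1) / (zOf ξ + 1)

lemma nOf_pos (ξ : ℝ) : 0 < nOf ξ :=
  div_pos (by linarith [one_lt_zOf ξ]) (by linarith [one_lt_zOf ξ])

lemma nOf_lt_one (ξ : ℝ) : nOf ξ < 1 := by
  rw [nOf, div_lt_one (by linarith [one_lt_zOf ξ])]
  linarith

lemma mOf_eq_zOf (ξ : ℝ) : mOf ξ = (zOf ξ ^ 2)⁻¹ := by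
  rw [zOf_sq, mOf, Real.exp_neg]
  field_simp
  ring

lemma zOf_eq_nOf (ξ : ℝ) : zOf ξ = (1 + nOf ξ) / (1 - nOf ξ) := by
  have h := one_lt_zOf ξ
  have h1 : zOf ξ + 1 ≠ 0 := by linarith
  rw [nOf]
  field_simp
  ring

lemma mOf_eq_nOf (ξ : ℝ) : mOf ξ = ((1 - nOf ξ) / (1 + nOf ξ)) ^ 2 := by
  rw [mOf_eq_zOf, zOf_eq_nOf, ← inv_pow, inv_div]

/-- This is z² - 1 = exp(-ξ) with z = (1+n)/(1-n). -/
lemma exp_mul_nOf (ξ : ℝ) : 4 * nOf ξ * Real.exp ξ = (1 - nOf ξ) ^ 2 := by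
  have h := one_lt_zOf ξ
  have h1 : zOf ξ + 1 ≠ 0 := by linarith
  have h2 : zOf ξ ^ 2 * Real.exp ξ = Real.exp ξ + 1 := by
    rw [zOf_sq, add_mul, ← Real.exp_add]; simp
  rw [nOf]
  field_simp
  linear_combination 4 * h2

lemma hasDerivAt_nOf (ξ : ℝ) : HasDerivAt nOf (-(nOf ξ * (1 - nOf ξ) / (1 + nOf ξ))) ξ := by
  have h := one_lt_zOf ξ
  have h1 : zOf ξ + 1 ≠ 0 := by linarith
  have h0 : zOf ξ ≠ 0 := by linarith
  have hz : HasDerivAt zOf (-(Real.exp (-ξ)) / (2 * zOf ξ)) ξ := by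
    have := ((((hasDerivAt_id ξ).fun_neg).exp).const_add 1).sqrt
      (by simp only [id]; positivity : 1 + Real.exp (-id ξ) ≠ 0)
    exact this.congr_deriv (by simp [zOf])
  refine ((hz.sub_const 1).fun_div (hz.add_const 1) h1).congr_deriv ?_
  have h2 : Real.exp (-ξ) = zOf ξ ^ 2 - 1 := by rw [zOf_sq]; ring
  have h3 : 1 + nOf ξ = 2 * zOf ξ / (zOf ξ + 1) := by rw [nOf]; field_simp; ring
  have h4 : 1 - nOf ξ = 2 / (zOf ξ + 1) := by rw [nOf]; field_simp; ring
  rw [h2, h3, h4, nOf]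
  field_simp
  ring

lemma hasDerivAt_nOf_ofReal (ξ : ℝ) :
    HasDerivAt (fun ξ => (nOf ξ : ℂ)) (-(nOf ξ * (1 - nOf ξ) / (1 + nOf ξ)) : ℂ) ξ := by
  simpa using (hasDerivAt_nOf ξ).ofReal_comp

/-- The hypergeometric factor of the solution of the first kind. -/
def hypP (b : ℂ) (τ : ℝ) : ℂ → ℂ := ordinaryHypergeometric (1 / 2 - I * τ) (b - I * τ) (b + 1 / 2)

/-- The elementary factor of the solution of the first kind. -/
def elemP (b : ℂ) (τ : ℝ) (ξ : ℝ) : ℂ :=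
  cexp (-(b / 2) * ξ + (b - I * τ) * (Real.log (1 - nOf ξ) : ℝ))

/-- The solution of the Legendre equation asymptotic to `exp (-b ξ / 2)` as `ξ → ∞`. -/
def solP (b : ℂ) (τ : ℝ) (ξ : ℝ) : ℂ := elemP b τ ξ * hypP b τ (nOf ξ)

/-- The derivative of `solP`. -/
def solP₁ (b : ℂ) (τ : ℝ) (ξ : ℝ) : ℂ :=
  elemP b τ ξ * ((-(b / 2) + (b - I * τ) * (nOf ξ / (1 + nOf ξ))) * hypP b τ (nOf ξ) -
    nOf ξ * (1 - nOf ξ) / (1 + nOf ξ) * deriv (hypP b τ) (nOf ξ))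

lemma hasDerivAt_elemP (b : ℂ) (τ ξ : ℝ) :
    HasDerivAt (elemP b τ) (elemP b τ ξ * (-(b / 2) + (b - I * τ) * (nOf ξ / (1 + nOf ξ)))) ξ := by
  have h1 : HasDerivAt (fun ξ => Real.log (1 - nOf ξ)) (nOf ξ / (1 + nOf ξ)) ξ := by
    have h2 : 1 - nOf ξ ≠ 0 := by linarith [nOf_lt_one ξ]
    have h3 : 1 + nOf ξ ≠ 0 := by linarith [nOf_pos ξ]
    refine (((hasDerivAt_nOf ξ).const_sub 1).log h2).congr_deriv ?_
    field_simp
  have h3 := (((hasDerivAt_id ξ).ofReal_comp.const_mul (-(b / 2))).fun_add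
    (h1.ofReal_comp.const_mul (b - I * τ))).cexp
  refine h3.congr_deriv ?_
  simp only [elemP, id]
  push_cast
  ring

/-- The variable n = (z-1)/(z+1) sends ξ = +∞ to 0 and satisfies m = ((1-n)/(1+n))². In n the
Legendre equation is again of Gauss's type, now with the exponent -b/2 at +∞ factored out. -/
lemma isSol₂_solP (hb : 0 < b.re) (τ : ℝ) : IsSol₂ b τ (solP b τ) (solP₁ b τ) := by
  intro ξ
  have hA : 0 < (1 / 2 - I * τ : ℂ).re := by simp
  have hB : 0 < (b - I * τ).re := by simpa
  have hC : 0 < (b + 1 / 2).re := by simp; linarith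
  have hx : ‖(nOf ξ : ℂ)‖ < 1 := norm_ofReal_lt_one (nOf_pos ξ).le (nOf_lt_one ξ)
  have ode := hypergeometric_ode hA hB hC hx
  have hn := hasDerivAt_nOf_ofReal ξ
  have d0 : HasDerivAt (fun ξ : ℝ => hypP b τ (nOf ξ)) _ ξ :=
    (hasDerivAt_hypergeometric hA hB hC hx).comp ξ hn
  have d1 : HasDerivAt (fun ξ : ℝ => deriv (hypP b τ) (nOf ξ)) _ ξ :=
    HasDerivAt.comp (h₂ := deriv (hypP b τ)) ξ (hasDerivAt_deriv_hypergeometric hA hB hC hx) hn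
  have dE := hasDerivAt_elemP b τ ξ
  have hne : (1 + nOf ξ : ℂ) ≠ 0 := by
    exact_mod_cast (by linarith [nOf_pos ξ] : (1 + nOf ξ) ≠ 0)
  refine ⟨(dE.fun_mul d0).congr_deriv ?_, ?_⟩
  · simp only [solP₁, hypP]; ring
  · have h := dE.fun_mul ((((hn.fun_div (hn.const_add 1) hne).const_mul (b - I * τ)).const_add
      (-(b / 2))).fun_mul d0 |>.fun_sub
      (((hn.fun_mul (hn.const_sub 1)).fun_div (hn.const_add 1) hne).fun_mul d1))
    refine h.congr_deriv ?_
    simp only [solP₁, solP, coeffB, hypP, mOf_eq_nOf] at ode ⊢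
    push_cast
    set F := ordinaryHypergeometric (1 / 2 - I * τ) (b - I * τ) (b + 1 / 2) (nOf ξ : ℂ)
    set F1 := deriv (ordinaryHypergeometric (1 / 2 - I * τ) (b - I * τ) (b + 1 / 2)) (nOf ξ : ℂ)
    set F2 := deriv (deriv (ordinaryHypergeometric (1 / 2 - I * τ) (b - I * τ) (b + 1 / 2)))
      (nOf ξ : ℂ)
    set n : ℂ := (nOf ξ : ℂ)
    set E := elemP b τ ξ
    have hI : I ^ 2 = -1 := I_sq
    -- Gauss's equation multiplied by the factor that the two changes of variable produce, ready for
    -- clearing denominators.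
    have e : E * (n * (1 - n) / (1 + n) ^ 2) *
      (n * (1 - n) * F2 + (b + 1 / 2 - (1 / 2 - I * τ + (b - I * τ) + 1) * n) * F1 -
        (1 / 2 - I * τ) * (b - I * τ) * F) = 0 := by rw [ode, mul_zero]
    field_simp at e ⊢
    linear_combination 8 * (1 + n) * e + 16 * E * τ ^ 2 * F * n * (1 + n) * hI

end

section

variable {b ρ : ℂ} {τ : ℝ} {v v₁ : ℝ → ℂ}

/-! ### The Legendre functions -/

lemma ofReal_cpow_eq_exp {x : ℝ} (hx : 0 < x) (c : ℂ) : (x : ℂ) ^ c = cexp (c * (Real.log x : ℝ)) := by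
  rw [cpow_def_of_ne_zero (ofReal_ne_zero.2 hx.ne'), ← ofReal_log hx.le, mul_comm]

lemma log_zOf (ξ : ℝ) : Real.log (zOf ξ) = -(ξ + Real.log (1 - mOf ξ)) / 2 := by
  have h1 : Real.log (zOf ξ ^ 2) = 2 * Real.log (zOf ξ) := by simp
  have h2 : (0:ℝ) < 1 + Real.exp ξ := by positivity
  have h3 : zOf ξ ^ 2 = (Real.exp ξ)⁻¹ * (1 - mOf ξ)⁻¹ := by
    rw [zOf_sq, one_sub_mOf, inv_inv, Real.exp_neg]
    field_simp
    ring
  rw [h3, Real.log_mul (by positivity) (by rw [one_sub_mOf]; positivity), Real.log_inv,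
    Real.log_inv, Real.log_exp] at h1
  linarith

/-- Since z² - 1 = exp(-ξ) and z⁻² = m, all elementary factors combine to e^{ξ/4} times `elemQ`. The
degree is -1/2 + 2ρ, so ρ = ±iτ/2 gives the two functions of the second kind. -/
lemma legendreQ_arg_exp (μ ρ : ℂ) (ξ : ℝ) :
    legendreQ (-μ) (-1 / 2 + 2 * ρ) (arg (Real.exp ξ)) =
      cexp (-(I * μ * Real.pi)) * (Real.sqrt Real.pi : ℂ) * Gamma (1 / 2 - μ + 2 * ρ) /
        ((2 : ℂ) ^ (1 / 2 + 2 * ρ) * Gamma (1 + 2 * ρ)) * cexp (ξ / 4) *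
        solQ (1 / 2 - μ) ρ ξ := by
  have hz : 0 < zOf ξ := by linarith [one_lt_zOf ξ]
  have e1 : zOf ξ ^ 2 - 1 = Real.exp (-ξ) := by rw [zOf_sq]; ring
  have e2 : (1 : ℂ) / (zOf ξ : ℂ) ^ 2 = mOf ξ := by
    rw [mOf_eq_zOf]; push_cast; rw [one_div]
  rw [arg_exp, legendreQ, e1, e2, ofReal_cpow_eq_exp (Real.exp_pos _), Real.log_exp,
    ofReal_cpow_eq_exp hz, log_zOf, solQ, hypQ, elemQ]
  rw [show (-1 / 2 + 2 * ρ + -μ) / 2 + 1 = (1 / 2 - μ) / 2 + ρ + 1 / 2 by ring,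
    show (-1 / 2 + 2 * ρ + -μ + 1) / 2 = (1 / 2 - μ) / 2 + ρ by ring,
    show -1 / 2 + 2 * ρ + 3 / 2 = 1 + 2 * ρ by ring,
    show -1 / 2 + 2 * ρ + -μ + 1 = 1 / 2 - μ + 2 * ρ by ring,
    show -1 / 2 + 2 * ρ + 1 = 1 / 2 + 2 * ρ by ring,
    show I * -μ * Real.pi = -(I * μ * Real.pi) by ring]
  have e3 : cexp (-μ / 2 * ((-ξ : ℝ) : ℂ)) *
      cexp ((-(-1 / 2 + 2 * ρ) - -μ - 1) * ((-(ξ + Real.log (1 - mOf ξ)) / 2 : ℝ) : ℂ)) =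
      cexp (ξ / 4) * cexp (ρ * ξ + ((1 / 2 - μ) / 2 + ρ) * (Real.log (1 - mOf ξ) : ℝ)) := by
    rw [← Complex.exp_add, ← Complex.exp_add]
    congr 1
    push_cast
    ring
  linear_combination (cexp (-(I * μ * Real.pi)) * (Real.sqrt Real.pi : ℂ) *
    Gamma (1 / 2 - μ + 2 * ρ) / ((2 : ℂ) ^ (1 / 2 + 2 * ρ) * Gamma (1 + 2 * ρ)) *
    ordinaryHypergeometric ((1 / 2 - μ) / 2 + ρ + 1 / 2) ((1 / 2 - μ) / 2 + ρ) (1 + 2 * ρ)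
      (mOf ξ : ℂ)) * e3

/-- For w = (1-z)/2, the Pfaff variable w/(w-1) is exactly n, so the continued Gauss function is a
power series in n with n in (0,1). The factor 2^μ comes from 4n exp ξ = (1-n)². -/
lemma legendreP_arg_exp (μ : ℂ) (τ ξ : ℝ) :
    legendreP μ (-1 / 2 + I * τ) (arg (Real.exp ξ)) =
      (2 : ℂ) ^ μ / Gamma (1 - μ) * cexp (ξ / 4) * solP (1 / 2 - μ) τ ξ := by
  have hz := one_lt_zOf ξ
  have hn := nOf_pos ξ
  have hn1 := nOf_lt_one ξ
  have h1 : zOf ξ + 1 ≠ 0 := by linarith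
  have e1 : (zOf ξ + 1) / (zOf ξ - 1) = (nOf ξ)⁻¹ := by rw [nOf, inv_div]
  have e2 : (1 : ℂ) - (1 - zOf ξ) / 2 = (((1 - nOf ξ)⁻¹ : ℝ) : ℂ) := by
    have : 1 - nOf ξ = 2 / (zOf ξ + 1) := by rw [nOf]; field_simp; ring
    rw [this, inv_div]; push_cast; ring
  have e3 : ((1 : ℂ) - zOf ξ) / 2 / ((1 - zOf ξ) / 2 - 1) = nOf ξ := by
    have h2 : (zOf ξ + 1 : ℂ) ≠ 0 := by exact_mod_cast h1
    have h3 : ((1 : ℂ) - zOf ξ) / 2 - 1 = -((zOf ξ + 1) / 2) := by ring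
    rw [h3, nOf]; push_cast; field_simp; ring
  have e4 : Real.log (nOf ξ) = 2 * Real.log (1 - nOf ξ) - 2 * Real.log 2 - ξ := by
    have h2 := congrArg Real.log (exp_mul_nOf ξ)
    rw [Real.log_mul (by positivity) (by positivity), Real.log_mul (by norm_num) hn.ne',
      Real.log_exp, Real.log_pow, show (4:ℝ) = 2 ^ 2 by norm_num, Real.log_pow] at h2
    push_cast at h2
    linarith
  rw [arg_exp, legendreP, gaussF, e1, e2, e3, ofReal_cpow_eq_exp (by positivity), Real.log_inv, e4,
    ofReal_cpow_eq_exp (inv_pos.2 (by linarith)), Real.log_inv, solP, hypP, elemP,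
    show (2 : ℂ) ^ μ = cexp (μ * (Real.log 2 : ℝ)) by
      rw [← ofReal_cpow_eq_exp (by norm_num)]; norm_num]
  rw [show -(-1 / 2 + I * (τ : ℂ)) = 1 / 2 - I * τ by ring,
    show 1 - μ - (-1 / 2 + I * (τ : ℂ) + 1) = 1 / 2 - μ - I * τ by ring,
    show 1 / 2 - μ + 1 / 2 = 1 - μ by ring]
  have e5 : cexp (μ / 2 * ((-(2 * Real.log (1 - nOf ξ) - 2 * Real.log 2 - ξ) : ℝ) : ℂ)) *
      cexp (-(1 / 2 - I * τ) * ((-Real.log (1 - nOf ξ) : ℝ) : ℂ)) =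
      cexp (μ * (Real.log 2 : ℝ)) * cexp (ξ / 4) *
        cexp (-((1 / 2 - μ) / 2) * ξ + (1 / 2 - μ - I * τ) * (Real.log (1 - nOf ξ) : ℝ)) := by
    rw [← Complex.exp_add, ← Complex.exp_add, ← Complex.exp_add]
    congr 1
    push_cast
    ring
  linear_combination (1 / Gamma (1 - μ) *
    ordinaryHypergeometric (1 / 2 - I * τ) (1 / 2 - μ - I * τ) (1 - μ) (nOf ξ : ℂ)) * e5

/-! ### Behaviour of the solution of the first kind at `+∞` -/

lemma nOf_le (ξ : ℝ) : nOf ξ ≤ Real.exp (-ξ) := by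
  have h := exp_mul_nOf ξ
  have h1 := nOf_pos ξ
  have h2 := nOf_lt_one ξ
  rw [Real.exp_neg, ← one_div, le_div_iff₀ (Real.exp_pos _)]
  nlinarith

lemma isBigO_nOf : (fun ξ => (nOf ξ : ℂ)) =O[atTop] fun ξ => Real.exp (-ξ) := by
  refine IsBigO.of_bound 1 (Eventually.of_forall fun ξ => ?_)
  rw [norm_real, Real.norm_of_nonneg (nOf_pos ξ).le, Real.norm_of_nonneg (Real.exp_pos _).le,
    one_mul]
  exact nOf_le ξ

lemma tendsto_nOf : Tendsto (fun ξ => (nOf ξ : ℂ)) atTop (𝓝 0) :=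
  isBigO_nOf.trans_tendsto (Real.tendsto_exp_neg_atTop_nhds_zero)

/-- A function of n differentiable at 0 differs from its value there by O(n), and 0 < n ≤ exp(-ξ)
gains one full exponential. -/
lemma isBigO_exp_mul_comp_nOf {G : ℂ → ℂ} (hG : DifferentiableAt ℂ G 0) (b : ℂ) :
    (fun ξ : ℝ => cexp (-(b / 2) * ξ) * (G (nOf ξ) - G 0)) =O[atTop]
      fun ξ => Real.exp (-(b.re / 2 + 1) * ξ) := by
  have h1 := (hG.isBigO_sub.comp_tendsto tendsto_nOf)
  have h2 : (fun ξ : ℝ => G (nOf ξ) - G 0) =O[atTop] fun ξ => Real.exp (-ξ) := by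
    refine IsBigO.trans ?_ isBigO_nOf
    simpa [Function.comp_def] using h1
  have h3 : (fun ξ : ℝ => cexp (-(b / 2) * ξ)) =O[atTop] fun ξ => Real.exp (-(b.re / 2) * ξ) := by
    refine IsBigO.of_bound 1 (Eventually.of_forall fun ξ => ?_)
    rw [Complex.norm_exp, Real.norm_of_nonneg (Real.exp_pos _).le, one_mul]
    simp
  refine (h3.mul h2).congr_right fun ξ => ?_
  rw [← Real.exp_add]
  ring_nf

lemma elemP_eq (b : ℂ) (τ ξ : ℝ) :
    elemP b τ ξ = cexp (-(b / 2) * ξ) * cexp ((b - I * τ) * log (1 - nOf ξ)) := by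
  rw [elemP, Complex.exp_add, ofReal_log (by linarith [nOf_lt_one ξ])]
  push_cast
  rfl

lemma differentiableAt_exp_log (c : ℂ) :
    DifferentiableAt ℂ (fun n => cexp (c * log (1 - n))) 0 := by
  have : DifferentiableAt ℂ (fun n : ℂ => log (1 - n)) 0 :=
    DifferentiableAt.clog (by fun_prop) (by simp)
  fun_prop

lemma isBigO_solP_sub (hb : 0 < b.re) (τ : ℝ) :
    (fun ξ : ℝ => solP b τ ξ - cexp (-(b / 2) * ξ)) =O[atTop]
      fun ξ => Real.exp (-(b.re / 2 + 1) * ξ) := by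
  have hA : 0 < (1 / 2 - I * τ : ℂ).re := by simp
  have hB : 0 < (b - I * τ).re := by simpa
  have hC : 0 < (b + 1 / 2).re := by simp; linarith
  have h0 : ‖(0:ℂ)‖ < 1 := by simp
  have hd : DifferentiableAt ℂ (hypP b τ) 0 := (hasDerivAt_hypergeometric hA hB hC h0).differentiableAt
  have hG : DifferentiableAt ℂ (fun n => cexp ((b - I * τ) * log (1 - n)) * hypP b τ n) 0 :=
    (differentiableAt_exp_log _).mul hd
  refine (isBigO_exp_mul_comp_nOf hG b).congr_left fun ξ => ?_
  have : hypP b τ 0 = 1 := by simp [hypP]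
  simp only [solP, elemP_eq, this]
  simp
  ring

lemma isBigO_solP₁_sub (hb : 0 < b.re) (τ : ℝ) :
    (fun ξ : ℝ => solP₁ b τ ξ - -(b / 2) * cexp (-(b / 2) * ξ)) =O[atTop]
      fun ξ => Real.exp (-(b.re / 2 + 1) * ξ) := by
  have hA : 0 < (1 / 2 - I * τ : ℂ).re := by simp
  have hB : 0 < (b - I * τ).re := by simpa
  have hC : 0 < (b + 1 / 2).re := by simp; linarith
  have h0 : ‖(0:ℂ)‖ < 1 := by simp
  have hd : DifferentiableAt ℂ (hypP b τ) 0 := (hasDerivAt_hypergeometric hA hB hC h0).differentiableAt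
  have hd1 : DifferentiableAt ℂ (deriv (hypP b τ)) 0 :=
    (hasDerivAt_deriv_hypergeometric hA hB hC h0).differentiableAt
  have hi : DifferentiableAt ℂ (fun n : ℂ => n / (1 + n)) 0 :=
    DifferentiableAt.fun_div (by fun_prop) (by fun_prop) (by simp)
  have hi1 : DifferentiableAt ℂ (fun n : ℂ => n * (1 - n) / (1 + n)) 0 :=
    DifferentiableAt.fun_div (by fun_prop) (by fun_prop) (by simp)
  have hG : DifferentiableAt ℂ (fun n => cexp ((b - I * τ) * log (1 - n)) *
      ((-(b / 2) + (b - I * τ) * (n / (1 + n))) * hypP b τ n -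
        n * (1 - n) / (1 + n) * deriv (hypP b τ) n)) 0 :=
    (differentiableAt_exp_log _).mul ((((hi.const_mul _).const_add _).mul hd).sub (hi1.mul hd1))
  refine (isBigO_exp_mul_comp_nOf hG b).congr_left fun ξ => ?_
  have : hypP b τ 0 = 1 := by simp [hypP]
  simp only [solP₁, elemP_eq, this]
  simp
  ring

/-! ### Uniqueness -/

/-- As 0 < m < 1, the coefficients are bounded on the whole line, so the first order system is
Lipschitz with one constant for all ξ. -/
lemma IsSol₂.eq_zero_of_initial (hv : IsSol₂ b τ v v₁) {ξ₀ : ℝ} (h0 : v ξ₀ = 0) (h1 : v₁ ξ₀ = 0)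
    (ξ : ℝ) : v ξ = 0 := by
  have hA : ∀ t, ‖(mOf t / 2 : ℂ)‖ ≤ 1 := fun t => by
    rw [norm_div, norm_real, Real.norm_of_nonneg (mOf_pos t).le]
    have := mOf_lt_one t
    norm_num
    linarith
  have hB : ∀ t, ‖coeffB b τ t‖ ≤ τ ^ 2 + ‖b * (1 - b)‖ := fun t => by
    have h1 := mOf_pos t
    have h2 := mOf_lt_one t
    rw [coeffB, norm_div]
    have h3 : ‖(τ : ℂ) ^ 2 * (1 - mOf t)‖ ≤ τ ^ 2 := by
      have : ((τ : ℂ) ^ 2 * (1 - mOf t)) = ((τ ^ 2 * (1 - mOf t) : ℝ) : ℂ) := by push_cast; ring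
      rw [this, norm_real, Real.norm_of_nonneg (mul_nonneg (sq_nonneg _) (by linarith))]
      nlinarith [sq_nonneg τ]
    have h4 : ‖b * (1 - b) * mOf t‖ ≤ ‖b * (1 - b)‖ := by
      rw [norm_mul _ (mOf t : ℂ), norm_real, Real.norm_of_nonneg h1.le]
      exact mul_le_of_le_one_right (norm_nonneg _) h2.le
    have h5 := (norm_add_le _ _).trans (add_le_add h3 h4)
    norm_num at h5 ⊢
    have := norm_nonneg ((τ : ℂ) ^ 2 * (1 - ↑(mOf t)) + b * (1 - b) * ↑(mOf t))
    linarith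
  set M : ℝ := τ ^ 2 + ‖b * (1 - b)‖ + 1 with hM
  have hM0 : 0 ≤ M := by positivity
  have key : (fun t => (v t, v₁ t)) = fun _ => ((0 : ℂ), (0 : ℂ)) := by
    refine ODE_solution_unique_univ (K := M.toNNReal) (s := fun _ => univ) (t₀ := ξ₀)
      (v := fun t p => (p.2, -(mOf t / 2 * p.2 + coeffB b τ t * p.1))) ?_ ?_ ?_ ?_
    · intro t
      refine LipschitzOnWith.of_dist_le_mul fun p _ p' _ => ?_
      have e1 : dist p.1 p'.1 ≤ dist p p' := le_max_left _ _
      have e2 : dist p.2 p'.2 ≤ dist p p' := le_max_right _ _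
      rw [Prod.dist_eq]
      refine max_le ?_ ?_
      · refine e2.trans ?_
        have : 1 ≤ M := by rw [hM]; linarith [sq_nonneg τ, norm_nonneg (b * (1 - b))]
        rw [Real.coe_toNNReal M hM0]
        exact le_mul_of_one_le_left dist_nonneg this
      · simp only
        rw [dist_neg_neg, dist_eq_norm]
        have e3 : mOf t / 2 * p.2 + coeffB b τ t * p.1 - (mOf t / 2 * p'.2 + coeffB b τ t * p'.1) =
          mOf t / 2 * (p.2 - p'.2) + coeffB b τ t * (p.1 - p'.1) := by ring
        rw [e3]
        refine (norm_add_le _ _).trans ?_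
        rw [norm_mul, norm_mul, ← dist_eq_norm, ← dist_eq_norm]
        have e4 := mul_le_mul (hA t) e2 dist_nonneg zero_le_one
        have e5 := mul_le_mul (hB t) e1 dist_nonneg (by positivity)
        rw [Real.coe_toNNReal M hM0, hM]
        linarith
    · exact fun t => ⟨(hv t).1.prodMk (hv t).2, mem_univ _⟩
    · intro t
      refine ⟨?_, mem_univ _⟩
      exact (hasDerivAt_const t ((0 : ℂ), (0 : ℂ))).congr_deriv (by simp [Prod.ext_iff])
    · simp [h0, h1]
  exact congrArg Prod.fst (congrFun key ξ)

/-- A solution of the Legendre equation that is recessive at `ξ = +∞` relative to `exp (-b ξ / 2)`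
is zero. -/
lemma IsSol₂.eq_zero_of_isBigO (hb : 0 < b.re) {δ : ℝ} (hδ : 0 < δ) (hδb : 1 / 2 < b.re + δ)
    (hv : IsSol₂ b τ v v₁) (h0 : v =O[atTop] fun ξ => Real.exp (-(b.re / 2 + δ) * ξ))
    (h1 : v₁ =O[atTop] fun ξ => Real.exp (-(b.re / 2 + δ) * ξ)) (ξ : ℝ) : v ξ = 0 := by
  have hP := isSol₂_solP hb τ
  have hexp : ∀ c d : ℝ, c ≤ d → (fun ξ => Real.exp (c * ξ)) =O[atTop] fun ξ => Real.exp (d * ξ) := by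
    intro c d hcd
    refine IsBigO.of_bound 1 ?_
    filter_upwards [eventually_ge_atTop 0] with ξ hξ
    rw [Real.norm_of_nonneg (Real.exp_pos _).le, Real.norm_of_nonneg (Real.exp_pos _).le, one_mul]
    exact Real.exp_le_exp.2 (by gcongr)
  have hE : (fun ξ : ℝ => cexp (-(b / 2) * ξ)) =O[atTop] fun ξ => Real.exp (-(b.re / 2) * ξ) := by
    refine IsBigO.of_bound 1 (Eventually.of_forall fun ξ => ?_)
    rw [Complex.norm_exp, Real.norm_of_nonneg (Real.exp_pos _).le, one_mul]
    simp
  have hPO : solP b τ =O[atTop] fun ξ => Real.exp (-(b.re / 2) * ξ) := by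
    simpa using ((isBigO_solP_sub hb τ).trans (hexp _ (-(b.re / 2)) (by linarith))).add hE
  have hPO₁ : solP₁ b τ =O[atTop] fun ξ => Real.exp (-(b.re / 2) * ξ) := by
    simpa using ((isBigO_solP₁_sub hb τ).trans (hexp _ (-(b.re / 2)) (by linarith))).add
      (hE.const_mul_left (-(b / 2)))
  have hS : (fun ξ : ℝ => (Real.sqrt (1 + Real.exp ξ) : ℂ)) =O[atTop] fun ξ => Real.exp (1 / 2 * ξ) := by
    refine IsBigO.of_bound (Real.sqrt 2) ?_
    filter_upwards [eventually_ge_atTop 0] with ξ hξ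
    rw [norm_real, Real.norm_of_nonneg (Real.sqrt_nonneg _), Real.norm_of_nonneg (Real.exp_pos _).le,
      show Real.exp (1 / 2 * ξ) = Real.sqrt (Real.exp ξ) by
        rw [← Real.exp_half]; ring_nf, ← Real.sqrt_mul (by norm_num)]
    refine Real.sqrt_le_sqrt ?_
    linarith [Real.one_le_exp hξ]
  have hto : ∀ c : ℝ, c < 0 → Tendsto (fun ξ => Real.exp (c * ξ)) atTop (𝓝 0) := fun c hc =>
    Real.tendsto_exp_atBot.comp (tendsto_id.const_mul_atTop_of_neg hc)
  obtain ⟨c, hc⟩ := hv.wronskian hP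
  -- The other exponent at +∞ is -(1-b)/2. The condition `hδb` says that v decays faster than this
  -- too, so the weighted Wronskian with `solP` tends to 0.
  have hc0 : c = 0 := by
    have h2 := ((h0.mul hPO₁).sub (h1.mul hPO)).mul hS
    have h3 : Tendsto (fun ξ => Real.exp ((1 / 2 - b.re - δ) * ξ)) atTop (𝓝 0) := hto _ (by linarith)
    have h4 := (h2.congr_right (g₂ := fun ξ => Real.exp ((1 / 2 - b.re - δ) * ξ)) (fun ξ => by
      rw [← Real.exp_add, ← Real.exp_add]; ring_nf)).trans_tendsto h3
    simp only [hc] at h4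
    exact tendsto_nhds_unique tendsto_const_nhds h4
  have hW : ∀ ξ, v ξ * solP₁ b τ ξ - v₁ ξ * solP b τ ξ = 0 := fun ξ => by
    have h5 := hc ξ
    rw [hc0, mul_eq_zero] at h5
    exact h5.resolve_right (ofReal_ne_zero.2 (Real.sqrt_pos.2 (by positivity)).ne')
  -- Hence `solP` has no zeros near +∞. There v/`solP` has derivative 0 and limit 0, so v vanishes
  -- on a half-line, and uniqueness for the initial value problem does the rest.
  have hlim : Tendsto (fun ξ : ℝ => cexp (b / 2 * ξ) * solP b τ ξ) atTop (𝓝 1) := by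
    have hE' : (fun ξ : ℝ => cexp (b / 2 * ξ)) =O[atTop] fun ξ => Real.exp ((b.re / 2) * ξ) := by
      refine IsBigO.of_bound 1 (Eventually.of_forall fun ξ => ?_)
      rw [Complex.norm_exp, Real.norm_of_nonneg (Real.exp_pos _).le, one_mul]
      simp
    have h2 := ((hE'.mul (isBigO_solP_sub hb τ)).congr_right
      (g₂ := fun ξ => Real.exp (-1 * ξ)) (fun ξ => by rw [← Real.exp_add]; ring_nf)).trans_tendsto
      (hto _ (by norm_num))
    have h3 := h2.add_const 1
    rw [zero_add] at h3
    refine h3.congr fun ξ => ?_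
    have : cexp (b / 2 * ξ) * cexp (-(b / 2) * ξ) = 1 := by rw [← Complex.exp_add]; simp
    linear_combination -this
  obtain ⟨X, hX⟩ := eventually_atTop.1 (hlim.eventually_ne one_ne_zero)
  have hne : ∀ ξ, X ≤ ξ → solP b τ ξ ≠ 0 := fun ξ hξ h => hX ξ hξ (by rw [h, mul_zero])
  have hquot : ∀ ξ ∈ Ioi X, HasDerivAt (fun ξ => v ξ / solP b τ ξ) 0 ξ := fun ξ hξ => by
    have := (hv ξ).1.fun_div (hP ξ).1 (hne ξ (le_of_lt hξ))
    refine this.congr_deriv ?_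
    rw [show v₁ ξ * solP b τ ξ - v ξ * solP₁ b τ ξ = 0 by linear_combination -(hW ξ), zero_div]
  have hconst : ∀ ξ ∈ Ioi X, v ξ / solP b τ ξ = v (X + 1) / solP b τ (X + 1) := fun ξ hξ => by
    refine isOpen_Ioi.is_const_of_deriv_eq_zero (isPreconnected_Ioi)
      (fun x hx => (hquot x hx).differentiableAt.differentiableWithinAt)
      (fun x hx => (hquot x hx).deriv) hξ (by simp : X + 1 ∈ Ioi X)
  have hq0 : Tendsto (fun ξ => v ξ / solP b τ ξ) atTop (𝓝 0) := by
    have hE' : (fun ξ : ℝ => cexp (b / 2 * ξ)) =O[atTop] fun ξ => Real.exp ((b.re / 2) * ξ) := by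
      refine IsBigO.of_bound 1 (Eventually.of_forall fun ξ => ?_)
      rw [Complex.norm_exp, Real.norm_of_nonneg (Real.exp_pos _).le, one_mul]
      simp
    have h2 := ((h0.mul hE').congr_right
      (g₂ := fun ξ => Real.exp (-δ * ξ)) (fun ξ => by rw [← Real.exp_add]; ring_nf)).trans_tendsto
      (hto _ (by linarith))
    have h3 := h2.div hlim one_ne_zero
    rw [zero_div] at h3
    refine h3.congr fun ξ => ?_
    rw [Pi.div_apply, mul_comm (v ξ), mul_div_mul_left _ _ (Complex.exp_ne_zero _)]
  have hval : v (X + 1) / solP b τ (X + 1) = 0 := by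
    refine tendsto_nhds_unique (tendsto_const_nhds) (hq0.congr' ?_)
    filter_upwards [eventually_gt_atTop X] with ξ hξ using hconst ξ hξ
  have hv0 : ∀ ξ ∈ Ioi X, v ξ = 0 := fun ξ hξ => by
    have := hconst ξ hξ
    rw [hval, div_eq_zero_iff] at this
    exact this.resolve_right (hne ξ (le_of_lt hξ))
  have hv1 : v₁ (X + 1) = 0 := by
    have h2 : v =ᶠ[𝓝 (X + 1)] fun _ => 0 := by
      filter_upwards [isOpen_Ioi.mem_nhds (by simp : X + 1 ∈ Ioi X)] with ξ hξ using hv0 ξ hξ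
    exact (hv (X + 1)).1.unique ((hasDerivAt_const (X + 1) (0 : ℂ)).congr_of_eventuallyEq h2)
  exact hv.eq_zero_of_initial (hv0 (X + 1) (by simp)) hv1 ξ

end

section

variable {b : ℂ} {τ : ℝ}

/-! ### Residues -/

lemma integrable_vline_div_sub {g : ℂ → ℂ} {a c : ℝ} {s₀ : ℂ} (h : StripDecay g a c) {σ : ℝ}
    (h1 : a ≤ σ) (h2 : σ ≤ c) (hσ : σ ≠ s₀.re) :
    Integrable fun t : ℝ => g (σ + t * I) / (σ + t * I - s₀) := by
  have hne : ∀ t : ℝ, (σ + t * I - s₀ : ℂ) ≠ 0 := fun t h0 => hσ (by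
    have := congrArg Complex.re h0
    simp at this
    linarith)
  simp_rw [div_eq_inv_mul]
  refine (h.integrable h1 h2).bdd_mul (c := |σ - s₀.re|⁻¹) ?_ (Eventually.of_forall fun t => ?_)
  · exact (Continuous.inv₀ (by fun_prop) hne).aestronglyMeasurable
  · rw [norm_inv]
    have : |σ - s₀.re| ≤ ‖(σ + t * I - s₀ : ℂ)‖ := by
      simpa using Complex.abs_re_le_norm (σ + t * I - s₀ : ℂ)
    exact inv_anti₀ (abs_pos.2 (sub_ne_zero.2 hσ)) this

/-- Shifting a Mellin–Barnes integral across finitely many simple poles. -/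
lemma barnesD_sub_barnesD_of_poles {ι : Type*} [Fintype ι] {Φ g : ℂ → ℂ} {a c : ℝ} {p w : ι → ℂ}
    (hp : ∀ j, a < (p j).re ∧ (p j).re < c) (hg : StripExp g a c)
    (hΦ : ∀ s : ℂ, (s.re = a ∨ s.re = c) → Φ s = ∑ j, w j * (g s / (s - p j))) (k : ℕ) (ξ : ℝ) :
    barnesD c Φ k ξ - barnesD a Φ k ξ =
      ∑ j, 2 * Real.pi * w j * g (p j) * (-p j) ^ k * cexp (-p j * ξ) := by
  set G : ℂ → ℂ := fun s => (-s) ^ k * g s * cexp (-s * ξ) with hG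
  have hGd : StripDecay G a c := ((hg.neg_pow_mul k).mul_exp ξ).stripDecay
  have key : ∀ σ : ℝ, σ = a ∨ σ = c → a ≤ c → barnesD σ Φ k ξ =
      ∑ j, w j * vint σ (fun s => G s / (s - p j)) := by
    intro σ hσ hac
    have h1 : barnesD σ Φ k ξ = vint σ fun s => ∑ j, w j * (G s / (s - p j)) := by
      unfold barnesD barnes
      refine vint_congr fun s hs => ?_
      simp only
      rw [hΦ s (by rw [hs]; exact hσ), Finset.mul_sum, Finset.sum_mul]
      exact Finset.sum_congr rfl fun j _ => by simp only [hG]; ring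
    rw [h1, vint, integral_finsetSum]
    · exact Finset.sum_congr rfl fun j _ => by rw [integral_const_mul]; rfl
    · intro j _
      refine (integrable_vline_div_sub hGd ?_ ?_ ?_).const_mul _
      · rcases hσ with rfl | rfl <;> [exact le_rfl; exact hac]
      · rcases hσ with rfl | rfl <;> [exact hac; exact le_rfl]
      · rcases hσ with rfl | rfl
        · exact (hp j).1.ne
        · exact (hp j).2.ne'
  -- The inequality a ≤ c is read off from a pole. Without poles Φ vanishes on both lines.
  rcases isEmpty_or_nonempty ι with h0 | ⟨⟨j₀⟩⟩
  · have : ∀ σ : ℝ, σ = a ∨ σ = c → barnesD σ Φ k ξ = 0 := by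
      intro σ hσ
      have h1 : barnesD σ Φ k ξ = vint σ fun _ => 0 := by
        unfold barnesD barnes
        refine vint_congr fun s hs => ?_
        simp only
        rw [hΦ s (by rw [hs]; exact hσ)]
        simp
      rw [h1, vint, integral_zero]
    simp [this a (Or.inl rfl), this c (Or.inr rfl)]
  have hac : a ≤ c := ((hp j₀).1.trans (hp j₀).2).le
  rw [key c (Or.inr rfl) hac, key a (Or.inl rfl) hac, ← Finset.sum_sub_distrib]
  refine Finset.sum_congr rfl fun j _ => ?_
  rw [← mul_sub, vint_sub_vint_of_pole (hp j).1 (hp j).2 hGd]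
  simp only [hG]
  ring

lemma isBigO_barnesD (σ : ℝ) (Φ : ℂ → ℂ) (k : ℕ) (l : Filter ℝ) :
    barnesD σ Φ k =O[l] fun ξ => Real.exp (-σ * ξ) := isBigO_barnes _ _ _

lemma isLittleO_barnesD_atBot {σ : ℝ} (hσ : σ < 0) (Φ : ℂ → ℂ) (k : ℕ) :
    barnesD σ Φ k =o[atBot] fun _ => (1 : ℝ) := by
  refine (isBigO_barnesD σ Φ k atBot).trans_isLittleO ((isLittleO_one_iff ℝ).2 ?_)
  exact Real.tendsto_exp_atBot.comp (tendsto_id.const_mul_atBot (by linarith))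

lemma barnesD_shift {Φ : ℂ → ℂ} {a c : ℝ} (hac : a ≤ c) (h : StripExp Φ a c) (k : ℕ) (ξ : ℝ) :
    barnesD a Φ k ξ = barnesD c Φ k ξ :=
  vint_shift hac ((h.neg_pow_mul k).mul_exp ξ).stripDecay

/-! ### Products of Gamma functions -/

lemma differentiableAt_Gamma_of_re_pos {s : ℂ} (hs : 0 < s.re) : DifferentiableAt ℂ Gamma s :=
  differentiableAt_Gamma s fun m h => by
    rw [h] at hs
    simp at hs
    have : (0:ℝ) ≤ m := by positivity
    linarith

lemma differentiableAt_Gamma_add {s c : ℂ} (hs : 0 < s.re + c.re) :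
    DifferentiableAt ℂ (fun s => Gamma (s + c)) s :=
  DifferentiableAt.comp (g := Gamma) s (differentiableAt_Gamma_of_re_pos (by simpa using hs))
    (by fun_prop)

lemma differentiableAt_Gamma_sub {s c : ℂ} (hs : s.re < c.re) :
    DifferentiableAt ℂ (fun s => Gamma (c - s)) s :=
  DifferentiableAt.comp (g := Gamma) s (differentiableAt_Gamma_of_re_pos (by simpa using hs))
    (by fun_prop)

lemma differentiable_Gamma_inv_add (c : ℂ) : Differentiable ℂ (fun s => (Gamma (s + c))⁻¹) :=
  differentiable_one_div_Gamma.comp (by fun_prop : Differentiable ℂ fun s => s + c)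

lemma differentiable_Gamma_inv_sub (c : ℂ) : Differentiable ℂ (fun s => (Gamma (c - s))⁻¹) :=
  differentiable_one_div_Gamma.comp (by fun_prop : Differentiable ℂ fun s => c - s)

lemma Gamma_inv_eq (s : ℂ) : (Gamma s)⁻¹ = s * (Gamma (s + 1))⁻¹ :=
  one_div_Gamma_eq_self_mul_one_div_Gamma_add_one s

lemma ne_zero_of_re_ne {s : ℂ} (h : s.re ≠ 0) : s ≠ 0 := fun h0 => h (by simp [h0])

lemma Gamma_eq_div {s : ℂ} (h : s ≠ 0) : Gamma s = Gamma (s + 1) / s := by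
  rw [Gamma_add_one s h, mul_div_cancel_left₀ _ h]

/-! ### The Mellin–Barnes representation of the solution of the first kind -/

/-- The Mellin–Barnes integrand of the solution of the first kind. -/
def barnesP (b : ℂ) (τ : ℝ) (s : ℂ) : ℂ :=
  Gamma (s + I * τ / 2) * Gamma (s + -(I * τ / 2)) * Gamma (b / 2 - s) * (Gamma (s + (b + 1) / 2))⁻¹

lemma stripExp_quotient {c₁ c₂ c₃ c₄ : ℂ} {α β : ℝ} (h1 : 0 < α + c₁.re) (h2 : 0 < α + c₂.re)
    (h3 : β < c₃.re) :
    StripExp (fun s => Gamma (s + c₁) * Gamma (s + c₂) * Gamma (c₃ - s) * (Gamma (s + c₄))⁻¹) α β := by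
  refine ⟨⟨-(Real.pi / 2) + -(Real.pi / 2) + -(Real.pi / 2) + Real.pi / 2, by
    linarith [Real.pi_pos], ?_⟩, fun s hs hs' => ?_⟩
  · exact (((stripGrowth_Gamma_add c₁ h1).mul (stripGrowth_Gamma_add c₂ h2)).mul
      (stripGrowth_Gamma_sub c₃ h3)).mul (stripGrowth_Gamma_inv_add c₄)
  · exact (((differentiableAt_Gamma_add (by linarith)).mul (differentiableAt_Gamma_add (by linarith))).mul
      (differentiableAt_Gamma_sub (by linarith))).mul (differentiable_Gamma_inv_add c₄ s)

lemma stripExp_barnesP {α β : ℝ} (hα : 0 < α) (hβ : β < b.re / 2) : StripExp (barnesP b τ) α β :=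
  stripExp_quotient (by simpa) (by simpa) (by simpa)

/-- Here L(s) = 4(s+iτ/2)(s-iτ/2) and R(s) = 4(b/2-s)(s+(b-1)/2) are the numerator and denominator
of Φ(s+1)/Φ(s). In Ψ the factor Γ(b/2-s) is raised to Γ(b/2+1-s), so that no pole lies between Re s
= σ and σ + 1. -/
lemma isSol₂_barnesP {σ : ℝ} (h0 : 0 < σ) (h1 : σ < b.re / 2) (τ : ℝ) :
    IsSol₂ b τ (barnesD σ (barnesP b τ) 0) (barnesD σ (barnesP b τ) 1) := by
  have hE : StripExp (barnesP b τ) σ σ := stripExp_barnesP h0 h1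
  intro ξ
  refine ⟨hE.hasDerivAt_barnesD 0 ξ, (hE.hasDerivAt_barnesD 1 ξ).congr_deriv ?_⟩
  have hrec := barnes_recurrence (σ := σ) (Φ := barnesP b τ)
    (L := fun s => τ ^ 2 + 0 * s + 4 * s ^ 2 + 0 * s ^ 3)
    (R := fun s => -(b * (1 - b)) + 2 * s + (-4) * s ^ 2 + 0 * s ^ 3)
    (Ψ := fun s => 4 * (Gamma (s + I * τ / 2) * Gamma (s + -(I * τ / 2)) * Gamma (b / 2 + 1 - s) *
      (Gamma (s + (b - 1) / 2))⁻¹)) ?_ ?_ ?_ ξ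
  · rw [hE.barnes_cubic, hE.barnes_cubic] at hrec
    have hne : (1 + Real.exp ξ : ℂ) ≠ 0 := by exact_mod_cast (by positivity : (1 + Real.exp ξ) ≠ 0)
    rw [coeffB, mOf]
    push_cast at hrec hne ⊢
    field_simp
    linear_combination 2 * hrec
  · refine (stripExp_quotient (by simpa) (by simpa) ?_).mul_left (StripGrowth.const 4)
      (fun s _ _ => by fun_prop)
    simp; linarith
  · intro s hs
    have e1 : s + I * τ / 2 ≠ 0 := ne_zero_of_re_ne (by simp [hs]; linarith)
    have e2 : s + -(I * τ / 2) ≠ 0 := ne_zero_of_re_ne (by simp [hs]; linarith)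
    simp only [barnesP]
    rw [show b / 2 + 1 - (s + 1) = b / 2 - s by ring,
      show s + 1 + (b - 1) / 2 = s + (b + 1) / 2 by ring,
      show s + 1 + I * (τ : ℂ) / 2 = s + I * τ / 2 + 1 by ring,
      show s + 1 + -(I * (τ : ℂ) / 2) = s + -(I * τ / 2) + 1 by ring, Gamma_add_one _ e1,
      Gamma_add_one _ e2]
    have e3 : (τ : ℂ) ^ 2 + 0 * s + 4 * s ^ 2 + 0 * s ^ 3 = 4 * ((s + I * τ / 2) * (s + -(I * τ / 2))) := by
      linear_combination (τ : ℂ) ^ 2 * I_sq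
    rw [e3]
    ring
  · intro s hs
    have e1 : b / 2 - s ≠ 0 := ne_zero_of_re_ne (by simp [hs]; linarith)
    simp only [barnesP]
    rw [Gamma_inv_eq (s + (b - 1) / 2), show b / 2 + 1 - s = b / 2 - s + 1 by ring,
      show s + (b - 1) / 2 + 1 = s + (b + 1) / 2 by ring, Gamma_add_one _ e1]
    ring

/-- The Mellin–Barnes representation of the solution of the first kind. -/
lemma barnesP_eq {σ : ℝ} (h0 : 0 < σ) (h1 : σ < b.re / 2) (τ ξ : ℝ) :
    barnesD σ (barnesP b τ) 0 ξ =
      2 * Real.pi * (Gamma (b / 2 + I * τ / 2) * Gamma (b / 2 + -(I * τ / 2)) *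
        (Gamma (b + 1 / 2))⁻¹) * solP b τ ξ := by
  have hb : 0 < b.re := by linarith
  -- With δ < 1 the new line passes only the pole b/2 and stops before b/2 + 1. The value 1/2 also
  -- meets the decay condition of the uniqueness lemma, since Re b > 0. That lemma does not need τ ≠
  -- 0.
  obtain ⟨δ, hδ0, hδ1, hδb⟩ : ∃ δ : ℝ, 0 < δ ∧ δ < 1 ∧ 1 / 2 < b.re + δ :=
    ⟨1 / 2, by norm_num, by norm_num, by linarith⟩
  set g : ℂ → ℂ := fun s => Gamma (s + I * τ / 2) * Gamma (s + -(I * τ / 2)) * Gamma (b / 2 + 1 - s) *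
    (Gamma (s + (b + 1) / 2))⁻¹ with hg
  set c : ℂ := 2 * Real.pi * (Gamma (b / 2 + I * τ / 2) * Gamma (b / 2 + -(I * τ / 2)) *
        (Gamma (b + 1 / 2))⁻¹) with hc
  have hgc : 2 * Real.pi * g (b / 2) = c := by
    simp only [hg, hc]
    rw [show b / 2 + 1 - b / 2 = 1 by ring, Gamma_one, show b / 2 + (b + 1) / 2 = b + 1 / 2 by ring]
    ring
  have hexp : ∀ k ξ, barnesD σ (barnesP b τ) k ξ = barnesD (b.re / 2 + δ) (barnesP b τ) k ξ +
      c * (-(b / 2)) ^ k * cexp (-(b / 2) * ξ) := by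
    intro k ξ
    -- The weight -1 is the sign in Γ(b/2-s) = -Γ(b/2+1-s)/(s-b/2).
    have := barnesD_sub_barnesD_of_poles (ι := Unit) (Φ := barnesP b τ) (g := g) (a := σ)
      (c := b.re / 2 + δ) (p := fun _ => b / 2) (w := fun _ => -1) (fun _ => by
        constructor <;> simp <;> linarith)
      (stripExp_quotient (by simpa) (by simpa) (by simp; linarith)) ?_ k ξ
    · simp only [Finset.univ_unique, Finset.sum_singleton] at this
      linear_combination -this + (-(b / 2)) ^ k * cexp (-(b / 2) * ξ) * hgc
    · intro s hs
      have e1 : b / 2 - s ≠ 0 := by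
        rcases hs with hs | hs <;> refine ne_zero_of_re_ne ?_ <;> simp [hs] <;> linarith
      have e2 : s - b / 2 ≠ 0 := by rw [← neg_sub]; exact neg_ne_zero.2 e1
      simp only [Finset.univ_unique, Finset.sum_singleton, barnesP, hg]
      rw [Gamma_eq_div e1, show b / 2 + 1 - s = b / 2 - s + 1 by ring, ← neg_sub s (b / 2)]
      field_simp
  have hsol : IsSol₂ b τ (fun ξ => barnesD σ (barnesP b τ) 0 ξ + (-c) * solP b τ ξ)
      (fun ξ => barnesD σ (barnesP b τ) 1 ξ + (-c) * solP₁ b τ ξ) :=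
    (isSol₂_barnesP h0 h1 τ).add ((isSol₂_solP hb τ).const_mul (-c))
  have hexpO : (fun ξ => Real.exp (-(b.re / 2 + 1) * ξ)) =O[atTop]
      fun ξ => Real.exp (-(b.re / 2 + δ) * ξ) := by
    refine IsBigO.of_bound 1 ?_
    filter_upwards [eventually_ge_atTop 0] with ξ hξ
    rw [Real.norm_of_nonneg (Real.exp_pos _).le, Real.norm_of_nonneg (Real.exp_pos _).le, one_mul]
    exact Real.exp_le_exp.2 (by gcongr)
  have hz := hsol.eq_zero_of_isBigO hb hδ0 hδb ?_ ?_ ξ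
  · linear_combination hz
  · refine ((isBigO_barnesD (b.re / 2 + δ) (barnesP b τ) 0 atTop).add
      (((isBigO_solP_sub hb τ).trans hexpO).const_mul_left (-c))).congr_left fun ξ => ?_
    rw [hexp 0 ξ]; ring
  · refine ((isBigO_barnesD (b.re / 2 + δ) (barnesP b τ) 1 atTop).add
      (((isBigO_solP₁_sub hb τ).trans hexpO).const_mul_left (-c))).congr_left fun ξ => ?_
    rw [hexp 1 ξ]; ring

end

/-! ### Identification of solutions by their behaviour at ξ = -∞ -/

section

variable {b : ℂ} {τ : ℝ} {q q₁ r r₁ u u₁ u₂ : ℝ → ℂ}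

lemma tendsto_coeffB (b : ℂ) (τ : ℝ) : Tendsto (coeffB b τ) atBot (𝓝 (τ ^ 2 / 4)) := by
  have hm : Tendsto (fun ξ => (mOf ξ : ℂ)) atBot (𝓝 0) := by
    simpa [Function.comp_def] using (continuous_ofReal.tendsto _).comp tendsto_mOf_atBot
  have := (((hm.const_sub 1).const_mul ((τ : ℂ) ^ 2)).add (hm.const_mul (b * (1 - b)))).div_const 4
  rw [mul_zero, sub_zero, mul_one, add_zero] at this
  exact this

lemma isLittleO_mul_sub_mul {f g F G : ℝ → ℂ} {l : Filter ℝ}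
    (hf : (fun ξ => f ξ - F ξ) =o[l] fun _ => (1 : ℝ)) (hg : (fun ξ => g ξ - G ξ) =o[l] fun _ => (1 : ℝ))
    (hF : F =O[l] fun _ => (1 : ℝ)) (hG : G =O[l] fun _ => (1 : ℝ)) :
    (fun ξ => f ξ * g ξ - F ξ * G ξ) =o[l] fun _ => (1 : ℝ) := by
  have hgO : g =O[l] fun _ => (1 : ℝ) := by simpa using hg.isBigO.add hG
  refine ((isLittleO_mul_one hf hgO).add (isLittleO_mul_one hg hF)).congr_left fun ξ => ?_
  ring

/-- The asymptotic behaviour of the product of two solutions and of its derivatives. -/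
lemma IsAsymp.fun_mul {ρ ρ' : ℂ} (hρ : ρ.re = 0) (hρ' : ρ'.re = 0) (hτ : 4 * ρ ^ 2 = -(τ : ℂ) ^ 2)
    (hτ' : 4 * ρ' ^ 2 = -(τ : ℂ) ^ 2) (aq : IsAsymp ρ q q₁) (ar : IsAsymp ρ' r r₁) (b : ℂ) :
    (fun ξ : ℝ => q ξ * r ξ - cexp ((ρ + ρ') * ξ)) =o[atBot] (fun _ => (1 : ℝ)) ∧
    (fun ξ : ℝ => (q₁ ξ * r ξ + q ξ * r₁ ξ) - (ρ + ρ') * cexp ((ρ + ρ') * ξ)) =o[atBot]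
      (fun _ => (1 : ℝ)) ∧
    (fun ξ : ℝ => (2 * (q₁ ξ * r₁ ξ) - mOf ξ / 2 * (q₁ ξ * r ξ + q ξ * r₁ ξ) -
        2 * coeffB b τ ξ * (q ξ * r ξ)) - (ρ + ρ') ^ 2 * cexp ((ρ + ρ') * ξ)) =o[atBot]
      (fun _ => (1 : ℝ)) := by
  have e : ∀ ξ : ℝ, cexp ((ρ + ρ') * ξ) = cexp (ρ * ξ) * cexp (ρ' * ξ) := fun ξ => by
    rw [← Complex.exp_add]; ring_nf
  have E := isBigO_cexp_mul hρ atBot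
  have E' := isBigO_cexp_mul hρ' atBot
  have h00 := isLittleO_mul_sub_mul aq.1 ar.1 E E'
  have h10 := isLittleO_mul_sub_mul aq.2 ar.1 (E.const_mul_left ρ) E'
  have h01 := isLittleO_mul_sub_mul aq.1 ar.2 E (E'.const_mul_left ρ')
  have h11 := isLittleO_mul_sub_mul aq.2 ar.2 (E.const_mul_left ρ) (E'.const_mul_left ρ')
  have hm : (fun ξ => (mOf ξ : ℂ)) =o[atBot] fun _ => (1 : ℝ) := by
    refine (isLittleO_one_iff ℝ).2 ?_
    simpa [Function.comp_def] using (continuous_ofReal.tendsto _).comp tendsto_mOf_atBot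
  have hB : (fun ξ => coeffB b τ ξ - τ ^ 2 / 4) =o[atBot] fun _ => (1 : ℝ) :=
    (isLittleO_one_iff ℝ).2 (sub_self ((τ : ℂ) ^ 2 / 4) ▸
      (tendsto_coeffB b τ).sub_const ((τ : ℂ) ^ 2 / 4))
  obtain ⟨qO, qO₁⟩ := aq.isBigO hρ
  obtain ⟨rO, rO₁⟩ := ar.isBigO hρ'
  have t1 := isLittleO_mul_one hm ((isBigO_mul_one qO₁ rO).add (isBigO_mul_one qO rO₁))
  have t2 := isLittleO_mul_one hB (isBigO_mul_one qO rO)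
  refine ⟨h00.congr_left fun ξ => by rw [e], (h10.add h01).congr_left fun ξ => by rw [e]; ring, ?_⟩
  refine ((((h11.const_mul_left 2).sub (t1.const_mul_left (1 / 2))).sub (t2.const_mul_left 2)).sub
    (h00.const_mul_left ((τ : ℂ) ^ 2 / 2))).congr_left fun ξ => ?_
  rw [e]
  linear_combination (cexp (ρ * ξ) * cexp (ρ' * ξ) / 4) * (hτ + hτ')

section

variable {ρ : ℂ}

/-- Identification of a solution of the Legendre equation by its behaviour at `ξ = -∞`. -/
lemma IsSol₂.eq_of_asymp (hb : 0 < b.re) (hρ : ρ.re = 0) (hρ0 : ρ ≠ 0)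
    (hτ : 4 * ρ ^ 2 = -(τ : ℂ) ^ 2) {c₁ c₂ : ℂ} (hu : IsSol₂ b τ u u₁)
    (h0 : (fun ξ : ℝ => u ξ - (c₁ * cexp (ρ * ξ) + c₂ * cexp (-ρ * ξ))) =o[atBot] fun _ => (1 : ℝ))
    (h1 : (fun ξ : ℝ => u₁ ξ - (c₁ * ρ * cexp (ρ * ξ) + c₂ * (-ρ) * cexp (-ρ * ξ))) =o[atBot]
      fun _ => (1 : ℝ)) (ξ : ℝ) :
    u ξ = c₁ * solQ b ρ ξ + c₂ * solQ b (-ρ) ξ := by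
  have hρ' : (-ρ).re = 0 := by simp [hρ]
  have hτ' : 4 * (-ρ) ^ 2 = -(τ : ℂ) ^ 2 := by rw [neg_sq]; exact hτ
  have sq := isSol₂_solQ hb hρ hτ
  have sr := isSol₂_solQ hb hρ' hτ'
  have aq := isAsymp_solQ hb hρ
  have ar := isAsymp_solQ hb hρ'
  have hv := (hu.add (sq.const_mul (-c₁))).add (sr.const_mul (-c₂))
  have := IsSol₂.eq_zero hρ hρ0 sq sr aq ar hv
    (((h0.sub (aq.1.const_mul_left c₁)).sub (ar.1.const_mul_left c₂)).congr_left fun ξ => by ring)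
    (((h1.sub (aq.2.const_mul_left c₁)).sub (ar.2.const_mul_left c₂)).congr_left fun ξ => by ring) ξ
  linear_combination this

/-- Identification of a solution of the symmetric square by its behaviour at `ξ = -∞`. -/
lemma IsSol₃.eq_of_asymp (hb : 0 < b.re) (hρ : ρ.re = 0) (hρ0 : ρ ≠ 0)
    (hτ : 4 * ρ ^ 2 = -(τ : ℂ) ^ 2) {c₀ c₁ c₂ : ℂ} (hu : IsSol₃ b τ u u₁ u₂)
    (h0 : (fun ξ : ℝ => u ξ - (c₀ + c₁ * cexp (2 * ρ * ξ) + c₂ * cexp (-(2 * ρ) * ξ))) =o[atBot]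
      fun _ => (1 : ℝ))
    (h1 : (fun ξ : ℝ => u₁ ξ - (c₁ * (2 * ρ) * cexp (2 * ρ * ξ) +
      c₂ * (-(2 * ρ)) * cexp (-(2 * ρ) * ξ))) =o[atBot] fun _ => (1 : ℝ))
    (h2 : (fun ξ : ℝ => u₂ ξ - (c₁ * (2 * ρ) ^ 2 * cexp (2 * ρ * ξ) +
      c₂ * (-(2 * ρ)) ^ 2 * cexp (-(2 * ρ) * ξ))) =o[atBot] fun _ => (1 : ℝ)) (ξ : ℝ) :
    u ξ = c₁ * solQ b ρ ξ ^ 2 + c₀ * (solQ b ρ ξ * solQ b (-ρ) ξ) + c₂ * solQ b (-ρ) ξ ^ 2 := by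
  have hρ' : (-ρ).re = 0 := by simp [hρ]
  have hτ' : 4 * (-ρ) ^ 2 = -(τ : ℂ) ^ 2 := by rw [neg_sq]; exact hτ
  have sq := isSol₂_solQ hb hρ hτ
  have sr := isSol₂_solQ hb hρ' hτ'
  have aq := isAsymp_solQ hb hρ
  have ar := isAsymp_solQ hb hρ'
  have hv := ((hu.add ((sq.fun_mul sq).const_mul (-c₁))).add ((sq.fun_mul sr).const_mul (-c₀))).add
    ((sr.fun_mul sr).const_mul (-c₂))
  obtain ⟨p0, p1, p2⟩ := aq.fun_mul hρ hρ hτ hτ aq b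
  obtain ⟨m0, m1, m2⟩ := aq.fun_mul hρ hρ' hτ hτ' ar b
  obtain ⟨n0, n1, n2⟩ := ar.fun_mul hρ' hρ' hτ' hτ' ar b
  have e1 : ρ + ρ = 2 * ρ := by ring
  have e2 : -ρ + -ρ = -(2 * ρ) := by ring
  have e3 : ρ + -ρ = 0 := by ring
  rw [e1] at p0 p1 p2
  rw [e2] at n0 n1 n2
  rw [e3] at m0 m1 m2
  have := hv.eq_zero hρ hρ0 sq sr aq ar
    ((((h0.sub (p0.const_mul_left c₁)).sub (m0.const_mul_left c₀)).sub
      (n0.const_mul_left c₂)).congr_left fun ξ => by simp only [zero_mul, Complex.exp_zero]; ring)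
    ((((h1.sub (p1.const_mul_left c₁)).sub (m1.const_mul_left c₀)).sub
      (n1.const_mul_left c₂)).congr_left fun ξ => by simp only [zero_mul, Complex.exp_zero]; ring)
    ((((h2.sub (p2.const_mul_left c₁)).sub (m2.const_mul_left c₀)).sub
      (n2.const_mul_left c₂)).congr_left fun ξ => by
        simp only [zero_mul, Complex.exp_zero]; ring) ξ
  linear_combination this

end

lemma Gamma_one_add {s : ℂ} (h : s ≠ 0) : Gamma (1 + s) = s * Gamma s := by
  rw [add_comm, Gamma_add_one s h]

lemma Gamma_one_sub {s : ℂ} (h : s ≠ 0) : Gamma (1 - s) = -s * Gamma (-s) := by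
  rw [sub_eq_add_neg, Gamma_one_add (neg_ne_zero.2 h)]

lemma I_mul_ofReal_ne_zero (hτ : τ ≠ 0) : I * (τ : ℂ) ≠ 0 :=
  mul_ne_zero I_ne_zero (ofReal_ne_zero.2 hτ)

lemma Gamma_ne_zero_of_re_zero {w : ℂ} (h : w ≠ 0) (hre : w.re = 0) : Gamma w ≠ 0 := fun h0 => by
  have := Gamma_ne_zero_of_re_pos (s := w + 1) (by simp [hre])
  rw [Gamma_add_one w h, h0, mul_zero] at this
  exact this rfl

/-- The expansion of the solution of the first kind in the solutions of the second kind. -/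
lemma solP_eq (hb : 0 < b.re) (hτ : τ ≠ 0) (ξ : ℝ) :
    Gamma (b / 2 + I * τ / 2) * Gamma (b / 2 + -(I * τ / 2)) * (Gamma (b + 1 / 2))⁻¹ * solP b τ ξ =
      Gamma (-(I * τ)) * Gamma (b / 2 + I * τ / 2) * (Gamma (b / 2 + -(I * τ / 2) + 1 / 2))⁻¹ *
        solQ b (I * τ / 2) ξ +
      Gamma (I * τ) * Gamma (b / 2 + -(I * τ / 2)) * (Gamma (b / 2 + I * τ / 2 + 1 / 2))⁻¹ *
        solQ b (-(I * τ / 2)) ξ := by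
  set ρ : ℂ := I * τ / 2 with hρd
  have hw : I * (τ : ℂ) = 2 * ρ := by rw [hρd]; ring
  have hρ0 : ρ ≠ 0 := by rw [hρd]; exact div_ne_zero (I_mul_ofReal_ne_zero hτ) two_ne_zero
  have hρ : ρ.re = 0 := by simp [hρd]
  have hρτ : 4 * ρ ^ 2 = -(τ : ℂ) ^ 2 := by
    rw [hρd]; linear_combination (τ : ℂ) ^ 2 * I_sq
  have h0 : 0 < b.re / 4 := by linarith
  have h1 : b.re / 4 < b.re / 2 := by linarith
  have hP := barnesP_eq h0 h1 τ ξ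
  set g : ℂ → ℂ := fun s => Gamma (s + (ρ + 1)) * Gamma (s + (-ρ + 1)) * Gamma (b / 2 - s) *
    (Gamma (s + (b + 1) / 2))⁻¹ with hg
  set A₁ : ℂ := Gamma (-(2 * ρ)) * Gamma (b / 2 + ρ) * (Gamma (b / 2 + -ρ + 1 / 2))⁻¹ with hA₁
  set A₂ : ℂ := Gamma (2 * ρ) * Gamma (b / 2 + -ρ) * (Gamma (b / 2 + ρ + 1 / 2))⁻¹ with hA₂
  have hexp : ∀ k ξ, barnesD (b.re / 4) (barnesP b τ) k ξ =
      barnesD (-(1 / 2)) (barnesP b τ) k ξ +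
      2 * Real.pi * (A₁ * ρ ^ k * cexp (ρ * ξ) + A₂ * (-ρ) ^ k * cexp (-ρ * ξ)) := by
    intro k ξ
    -- The line Re s = -1/2 separates the poles ±ρ from the next pair, on Re s = -1. The weights are
    -- the partial fractions of 1/((s+ρ)(s-ρ)), and ρ ≠ 0 keeps the poles simple.
    have := barnesD_sub_barnesD_of_poles (ι := Fin 2) (Φ := barnesP b τ) (g := g) (a := -(1 / 2))
      (c := b.re / 4) (p := ![-ρ, ρ]) (w := ![-(2 * ρ)⁻¹, (2 * ρ)⁻¹]) (fun j => by
        fin_cases j <;> simp [hρ] <;> linarith)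
      (stripExp_quotient (by simp [hρ]; norm_num) (by simp [hρ]; norm_num) (by simp; linarith)) ?_ k ξ
    · simp only [Fin.sum_univ_two, Matrix.cons_val_zero, Matrix.cons_val_one] at this
      have g1 : -(2 * ρ)⁻¹ * g (-ρ) = A₁ := by
        simp only [hg, hA₁]
        rw [show -ρ + (ρ + 1) = 1 by ring, Gamma_one, show -ρ + (-ρ + 1) = 1 - 2 * ρ by ring,
          Gamma_one_sub (mul_ne_zero two_ne_zero hρ0), sub_neg_eq_add,
          show -ρ + (b + 1) / 2 = b / 2 + -ρ + 1 / 2 by ring]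
        field_simp
      have g2 : (2 * ρ)⁻¹ * g ρ = A₂ := by
        simp only [hg, hA₂]
        rw [show ρ + (-ρ + 1) = 1 by ring, Gamma_one, show ρ + (ρ + 1) = 1 + 2 * ρ by ring,
          Gamma_one_add (mul_ne_zero two_ne_zero hρ0), sub_eq_add_neg,
          show ρ + (b + 1) / 2 = b / 2 + ρ + 1 / 2 by ring]
        field_simp
      rw [neg_neg] at this
      linear_combination this + 2 * Real.pi * ρ ^ k * cexp (ρ * ξ) * g1 +
        2 * Real.pi * (-ρ) ^ k * cexp (-ρ * ξ) * g2
    · intro s hs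
      have e1 : s + ρ ≠ 0 := by
        rcases hs with hs | hs <;> refine ne_zero_of_re_ne ?_ <;> simp [hs, hρ]; linarith
      have e2 : s - ρ ≠ 0 := by
        rcases hs with hs | hs <;> refine ne_zero_of_re_ne ?_ <;> simp [hs, hρ]; linarith
      have e3 : s + -ρ ≠ 0 := by rwa [← sub_eq_add_neg]
      simp only [Fin.sum_univ_two, Matrix.cons_val_zero, Matrix.cons_val_one, barnesP, hg]
      rw [← hρd, ← add_assoc, ← add_assoc, Gamma_add_one _ e1, Gamma_add_one _ e3, sub_neg_eq_add,
        ← sub_eq_add_neg]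
      field_simp
      ring
  have hsol := (isSol₂_barnesP h0 h1 τ).eq_of_asymp (c₁ := 2 * Real.pi * A₁) (c₂ := 2 * Real.pi * A₂)
    (by linarith) hρ hρ0 hρτ
    ((isLittleO_barnesD_atBot (σ := -(1 / 2)) (by norm_num) (barnesP b τ) 0).congr_left fun ξ => by
      rw [hexp]; ring)
    ((isLittleO_barnesD_atBot (σ := -(1 / 2)) (by norm_num) (barnesP b τ) 1).congr_left fun ξ => by
      rw [hexp]; ring) ξ
  rw [hP] at hsol
  have hpi : (2 * Real.pi : ℂ) ≠ 0 := by
    exact_mod_cast (by positivity : (2 * Real.pi) ≠ 0)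
  rw [hw]
  refine mul_left_cancel₀ hpi ?_
  linear_combination hsol

/-! ### The Mellin–Barnes integrals of products -/

lemma stripExp_quotient₂ {c₁ c₂ c₄ c₅ : ℂ} {N D : ℂ → ℂ} {α β : ℝ} (h1 : 0 < α + c₁.re)
    (h2 : 0 < α + c₂.re) (h4 : β < c₄.re) (hN : StripGrowth (-(Real.pi / 2)) N α β)
    (hNd : ∀ s : ℂ, α ≤ s.re → s.re ≤ β → DifferentiableAt ℂ N s)
    (hD : StripGrowth (Real.pi / 2) D α β) (hDd : Differentiable ℂ D) :
    StripExp (fun s => Gamma (s + c₁) * Gamma (s + c₂) * N s * Gamma (c₄ - s) *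
      (Gamma (s + c₅))⁻¹ * D s) α β := by
  refine ⟨⟨-(Real.pi / 2) + -(Real.pi / 2) + -(Real.pi / 2) + -(Real.pi / 2) + Real.pi / 2 +
    Real.pi / 2, by linarith [Real.pi_pos], ?_⟩, fun s hs hs' => ?_⟩
  · exact (((((stripGrowth_Gamma_add c₁ h1).mul (stripGrowth_Gamma_add c₂ h2)).mul hN).mul
      (stripGrowth_Gamma_sub c₄ h4)).mul (stripGrowth_Gamma_inv_add c₅)).mul hD
  · exact (((((differentiableAt_Gamma_add (by linarith)).mul
      (differentiableAt_Gamma_add (by linarith))).mul (hNd s hs hs')).mul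
      (differentiableAt_Gamma_sub (by linarith))).mul (differentiable_Gamma_inv_add c₅ s)).mul (hDd s)

/-- The Mellin–Barnes integrand of the square of the function of the first kind. -/
def barnesPP (b : ℂ) (τ : ℝ) (s : ℂ) : ℂ :=
  Gamma (s + I * τ) * Gamma (s + -(I * τ)) * Gamma (s + 0) * Gamma (b - s) * (Gamma (s + b))⁻¹ *
    (Gamma (s + 1 / 2))⁻¹

/-- The Mellin–Barnes integrand of the product of the functions of the first and second kind. -/
def barnesPQ (b : ℂ) (τ : ℝ) (s : ℂ) : ℂ :=
  Gamma (s + I * τ) * Gamma (s + -(I * τ)) * Gamma (1 / 2 - s) * Gamma (b - s) * (Gamma (s + b))⁻¹ *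
    (Gamma (1 - s))⁻¹

lemma stripExp_barnesPP {α β : ℝ} (hα : 0 < α) (hβ : β < b.re) : StripExp (barnesPP b τ) α β :=
  stripExp_quotient₂ (by simpa) (by simpa) hβ (stripGrowth_Gamma_add 0 (by simpa))
    (fun s h _ => differentiableAt_Gamma_add (by simp; linarith)) (stripGrowth_Gamma_inv_add _)
    (differentiable_Gamma_inv_add _)

lemma stripExp_barnesPQ {α β : ℝ} (hα : 0 < α) (hβ : β < b.re) (hβ' : β < 1 / 2) :
    StripExp (barnesPQ b τ) α β :=
  stripExp_quotient₂ (by simpa) (by simpa) hβ (stripGrowth_Gamma_sub _ (by norm_num; linarith))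
    (fun s _ h => differentiableAt_Gamma_sub (by norm_num; linarith)) (stripGrowth_Gamma_inv_sub _)
    (differentiable_Gamma_inv_sub _)

/-- Both product integrands satisfy this functional equation, for their ratio `barnesPP`/`barnesPQ`
is cot πs, which has period 1. The cubics are those of the symmetric square, with exponents 0 and
±iτ at ξ = -∞. -/
lemma isSol₃_of_recurrence {σ : ℝ} {Φ Ψ : ℂ → ℂ} (hE : StripExp Φ σ σ) (hΨ : StripExp Ψ σ (σ + 1))
    (h1 : ∀ s : ℂ, s.re = σ → s * (s + I * τ) * (s + -(I * τ)) * Φ s = Ψ (s + 1))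
    (h2 : ∀ s : ℂ, s.re = σ → (b - s) * (s - 1 / 2) * (s + b - 1) * Φ s = Ψ s) :
    IsSol₃ b τ (barnesD σ Φ 0) (barnesD σ Φ 1) (barnesD σ Φ 2) := by
  intro ξ
  refine ⟨hE.hasDerivAt_barnesD 0 ξ, hE.hasDerivAt_barnesD 1 ξ,
    (hE.hasDerivAt_barnesD 2 ξ).congr_deriv ?_⟩
  have hrec := barnes_recurrence (σ := σ) (Φ := Φ) (Ψ := Ψ)
    (L := fun s => 0 + τ ^ 2 * s + 0 * s ^ 2 + 1 * s ^ 3)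
    (R := fun s => b * (1 - b) / 2 + (-(1 / 2 + b * (1 - b))) * s + 3 / 2 * s ^ 2 + (-1) * s ^ 3)
    hΨ (fun s hs => by rw [← h1 s hs]; linear_combination (s * τ ^ 2 * Φ s) * I_sq)
    (fun s hs => by rw [← h2 s hs]; ring) ξ
  rw [hE.barnes_cubic, hE.barnes_cubic] at hrec
  have hne : (1 + Real.exp ξ : ℂ) ≠ 0 := by exact_mod_cast (by positivity : (1 + Real.exp ξ) ≠ 0)
  rw [mOf]
  push_cast at hrec hne ⊢
  field_simp
  linear_combination -2 * hrec

lemma isSol₃_barnesPP {σ : ℝ} (h0 : 0 < σ) (h1 : σ < b.re) (τ : ℝ) :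
    IsSol₃ b τ (barnesD σ (barnesPP b τ) 0) (barnesD σ (barnesPP b τ) 1)
      (barnesD σ (barnesPP b τ) 2) := by
  refine isSol₃_of_recurrence (stripExp_barnesPP h0 h1) (Ψ := fun s =>
    Gamma (s + I * τ) * Gamma (s + -(I * τ)) * Gamma (s + 0) * Gamma (b + 1 - s) *
      (Gamma (s + (b - 1)))⁻¹ * (Gamma (s + -(1 / 2)))⁻¹) ?_ ?_ ?_
  · exact stripExp_quotient₂ (by simpa) (by simpa) (by simpa) (stripGrowth_Gamma_add 0 (by simpa))
      (fun s h _ => differentiableAt_Gamma_add (by simp; linarith)) (stripGrowth_Gamma_inv_add _)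
      (differentiable_Gamma_inv_add _)
  · intro s hs
    have e1 : s + I * τ ≠ 0 := ne_zero_of_re_ne (by simp [hs]; linarith)
    have e2 : s + -(I * τ) ≠ 0 := ne_zero_of_re_ne (by simp [hs]; linarith)
    have e3 : s ≠ 0 := ne_zero_of_re_ne (by simp [hs]; linarith)
    simp only [barnesPP, add_zero]
    rw [show s + 1 + I * (τ : ℂ) = s + I * τ + 1 by ring,
      show s + 1 + -(I * (τ : ℂ)) = s + -(I * τ) + 1 by ring, Gamma_add_one _ e1,
      Gamma_add_one _ e2, Gamma_add_one _ e3, show b + 1 - (s + 1) = b - s by ring,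
      show s + 1 + (b - 1) = s + b by ring, show s + 1 + -(1 / 2) = s + 1 / 2 by ring]
    ring
  · intro s hs
    have e1 : b - s ≠ 0 := ne_zero_of_re_ne (by simp [hs]; linarith)
    simp only [barnesPP]
    rw [show b + 1 - s = b - s + 1 by ring, Gamma_add_one _ e1, Gamma_inv_eq (s + (b - 1)),
      Gamma_inv_eq (s + -(1 / 2)), show s + (b - 1) + 1 = s + b by ring,
      show s + -(1 / 2) + 1 = s + 1 / 2 by ring]
    ring

lemma isSol₃_barnesPQ {σ : ℝ} (h0 : 0 < σ) (h1 : σ < b.re) (h2 : σ < 1 / 2) (τ : ℝ) :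
    IsSol₃ b τ (barnesD σ (barnesPQ b τ) 0) (barnesD σ (barnesPQ b τ) 1)
      (barnesD σ (barnesPQ b τ) 2) := by
  refine isSol₃_of_recurrence (stripExp_barnesPQ h0 h1 h2) (Ψ := fun s =>
    -1 * (Gamma (s + I * τ) * Gamma (s + -(I * τ)) * Gamma (3 / 2 - s) * Gamma (b + 1 - s) *
      (Gamma (s + (b - 1)))⁻¹ * (Gamma (1 - s))⁻¹)) ?_ ?_ ?_
  · exact (stripExp_quotient₂ (by simpa) (by simpa) (by simpa)
      (stripGrowth_Gamma_sub _ (by norm_num; linarith))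
      (fun s _ h => differentiableAt_Gamma_sub (by norm_num; linarith)) (stripGrowth_Gamma_inv_sub _)
      (differentiable_Gamma_inv_sub _)).mul_left (StripGrowth.const (-1)) (fun s _ _ => by fun_prop)
  · intro s hs
    have e1 : s + I * τ ≠ 0 := ne_zero_of_re_ne (by simp [hs]; linarith)
    have e2 : s + -(I * τ) ≠ 0 := ne_zero_of_re_ne (by simp [hs]; linarith)
    simp only [barnesPQ]
    rw [show s + 1 + I * (τ : ℂ) = s + I * τ + 1 by ring,
      show s + 1 + -(I * (τ : ℂ)) = s + -(I * τ) + 1 by ring, Gamma_add_one _ e1,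
      Gamma_add_one _ e2, show b + 1 - (s + 1) = b - s by ring,
      show s + 1 + (b - 1) = s + b by ring, show 3 / 2 - (s + 1) = 1 / 2 - s by ring,
      show 1 - (s + 1) = -s by ring, Gamma_inv_eq (-s), show -s + 1 = 1 - s by ring]
    ring
  · intro s hs
    have e1 : b - s ≠ 0 := ne_zero_of_re_ne (by simp [hs]; linarith)
    have e2 : 1 / 2 - s ≠ 0 := ne_zero_of_re_ne (by simp [hs]; linarith)
    simp only [barnesPQ]
    rw [show b + 1 - s = b - s + 1 by ring, Gamma_add_one _ e1, Gamma_inv_eq (s + (b - 1)),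
      show s + (b - 1) + 1 = s + b by ring, show 3 / 2 - s = 1 / 2 - s + 1 by ring,
      Gamma_add_one _ e2]
    ring

end

/-! ### The two product kernels in terms of the solutions at ξ = -∞ -/

section

variable {b : ℂ} {τ : ℝ}

/-- Moving the line from σ to -1/2 crosses 0 and ±iτ, the three exponents of the symmetric square at
-∞. The residues are the coefficients of the mixed product and of the two squares. -/
lemma barnesPP_eq_solQ (hτ : τ ≠ 0) {σ : ℝ} (h0 : 0 < σ) (h1 : σ < b.re) (ξ : ℝ) :
    barnesD σ (barnesPP b τ) 0 ξ = 2 * Real.pi * (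
      Gamma (-(I * τ) * 2) * Gamma (-(I * τ)) * Gamma (b + I * τ) *
        (Gamma (b - I * τ))⁻¹ * (Gamma (-(I * τ) + 1 / 2))⁻¹ * solQ b (I * τ / 2) ξ ^ 2 +
      Gamma (I * τ) * Gamma (-(I * τ)) * (Real.sqrt Real.pi : ℂ)⁻¹ *
        (solQ b (I * τ / 2) ξ * solQ b (-(I * τ / 2)) ξ) +
      Gamma (I * τ * 2) * Gamma (I * τ) * Gamma (b - I * τ) *
        (Gamma (b + I * τ))⁻¹ * (Gamma (I * τ + 1 / 2))⁻¹ * solQ b (-(I * τ / 2)) ξ ^ 2) := by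
  have hb : 0 < b.re := by linarith
  set w : ℂ := I * τ with hw
  have hw0 : w ≠ 0 := I_mul_ofReal_ne_zero hτ
  have hwre : w.re = 0 := by simp [hw]
  have hw2 : w * 2 ≠ 0 := mul_ne_zero hw0 two_ne_zero
  have hρ0 : w / 2 ≠ 0 := div_ne_zero hw0 two_ne_zero
  have hρ : (w / 2).re = 0 := by simp [hwre]
  have hρτ : 4 * (w / 2) ^ 2 = -(τ : ℂ) ^ 2 := by
    rw [hw]; linear_combination (τ : ℂ) ^ 2 * I_sq
  have hρw : 2 * (w / 2) = w := by ring
  set g : ℂ → ℂ := fun s => Gamma (s + (w + 1)) * Gamma (s + (-w + 1)) * Gamma (s + 1) * Gamma (b - s) *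
    (Gamma (s + b))⁻¹ * (Gamma (s + 1 / 2))⁻¹ with hg
  set K₀ : ℂ := Gamma w * Gamma (-w) * (Real.sqrt Real.pi : ℂ)⁻¹ with hK₀
  set K₁ : ℂ := Gamma (-w * 2) * Gamma (-w) * Gamma (b + w) * (Gamma (b - w))⁻¹ *
    (Gamma (-w + 1 / 2))⁻¹ with hK₁
  set K₂ : ℂ := Gamma (w * 2) * Gamma w * Gamma (b - w) * (Gamma (b + w))⁻¹ *
    (Gamma (w + 1 / 2))⁻¹ with hK₂
  have hexp : ∀ k ξ, barnesD σ (barnesPP b τ) k ξ =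
      barnesD (-(1 / 2)) (barnesPP b τ) k ξ +
      2 * Real.pi * (K₀ * 0 ^ k + K₁ * w ^ k * cexp (w * ξ) + K₂ * (-w) ^ k * cexp (-w * ξ)) := by
    intro k ξ
    -- The weights are the partial fractions of 1/(s(s+w)(s-w)).
    have := barnesD_sub_barnesD_of_poles (ι := Fin 3) (Φ := barnesPP b τ) (g := g) (a := -(1 / 2))
      (c := σ) (p := ![0, -w, w]) (w := ![-(w ^ 2)⁻¹, (2 * w ^ 2)⁻¹, (2 * w ^ 2)⁻¹]) (fun j => by
        fin_cases j <;> simp [hwre] <;> linarith)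
      (stripExp_quotient₂ (by simp [hwre]; norm_num) (by simp [hwre]; norm_num) (by simpa)
        (stripGrowth_Gamma_add _ (by norm_num))
        (fun s h _ => differentiableAt_Gamma_add (by simp; linarith)) (stripGrowth_Gamma_inv_add _)
        (differentiable_Gamma_inv_add _)) ?_ k ξ
    · simp only [Fin.sum_univ_three, Matrix.cons_val_zero, Matrix.cons_val_one, Matrix.cons_val_two,
        Matrix.head_cons, Matrix.tail_cons] at this
      have g0 : -(w ^ 2)⁻¹ * g 0 = K₀ := by
        simp only [hg, hK₀, zero_add, sub_zero]
        have hbne : Gamma b ≠ 0 := Gamma_ne_zero_of_re_pos hb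
        rw [Gamma_one, Gamma_one_half_eq, show -w + 1 = 1 - w by ring, Gamma_one_sub hw0,
          Gamma_add_one _ hw0, show ((Real.pi : ℂ) ^ (1 / 2 : ℂ)) = (Real.sqrt Real.pi : ℂ) by
            rw [Real.sqrt_eq_rpow, ofReal_cpow Real.pi_pos.le]; norm_num]
        field_simp
      have g1 : (2 * w ^ 2)⁻¹ * g (-w) = K₁ := by
        simp only [hg, hK₁]
        rw [show -w + (w + 1) = 1 by ring, Gamma_one, show -w + (-w + 1) = 1 - w * 2 by ring,
          Gamma_one_sub hw2, sub_neg_eq_add, show -w + 1 = 1 - w by ring, Gamma_one_sub hw0,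
          show -w + b = b - w by ring, show -(w * 2) = -w * 2 by ring]
        field_simp
      have g2 : (2 * w ^ 2)⁻¹ * g w = K₂ := by
        simp only [hg, hK₂]
        rw [show w + (-w + 1) = 1 by ring, Gamma_one, show w + (w + 1) = 1 + w * 2 by ring,
          Gamma_one_add hw2, Gamma_add_one _ hw0, show w + b = b + w by ring]
        field_simp
      rw [neg_neg, neg_zero, zero_mul, Complex.exp_zero] at this
      linear_combination this + 2 * Real.pi * 0 ^ k * g0 + 2 * Real.pi * w ^ k * cexp (w * ξ) * g1 +
        2 * Real.pi * (-w) ^ k * cexp (-w * ξ) * g2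
    · intro s hs
      have hsre : s.re ≠ 0 := by
        rcases hs with hs | hs
        · rw [hs]; norm_num
        · rw [hs]; exact h0.ne'
      have e0 : s ≠ 0 := ne_zero_of_re_ne hsre
      have e1 : s + w ≠ 0 := ne_zero_of_re_ne (by simpa [hwre])
      have e2 : s - w ≠ 0 := ne_zero_of_re_ne (by simpa [hwre])
      have e3 : s + -w ≠ 0 := by rwa [← sub_eq_add_neg]
      simp only [Fin.sum_univ_three, Matrix.cons_val_zero, Matrix.cons_val_one, Matrix.cons_val_two,
        Matrix.head_cons, Matrix.tail_cons, barnesPP, hg]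
      rw [← hw, ← add_assoc, ← add_assoc, Gamma_add_one _ e1, Gamma_add_one _ e3, sub_neg_eq_add,
        ← sub_eq_add_neg, Gamma_add_one _ e0, add_zero, sub_zero]
      field_simp
      ring
  have hsol := (isSol₃_barnesPP h0 h1 τ).eq_of_asymp (c₀ := 2 * Real.pi * K₀)
    (c₁ := 2 * Real.pi * K₁) (c₂ := 2 * Real.pi * K₂) hb hρ hρ0 hρτ
    ((isLittleO_barnesD_atBot (σ := -(1 / 2)) (by norm_num) (barnesPP b τ) 0).congr_left fun ξ => by
      rw [hexp, hρw]; ring)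
    ((isLittleO_barnesD_atBot (σ := -(1 / 2)) (by norm_num) (barnesPP b τ) 1).congr_left fun ξ => by
      rw [hexp, hρw]; ring)
    ((isLittleO_barnesD_atBot (σ := -(1 / 2)) (by norm_num) (barnesPP b τ) 2).congr_left fun ξ => by
      rw [hexp, hρw]; ring) ξ
  rw [hsol]
  ring

/-- Here Γ(s)/Γ(s+1/2) is replaced by Γ(1/2-s)/Γ(1-s), which is regular at 0. The residue at 0
disappears, and with it the mixed product. -/
lemma barnesPQ_eq_solQ (hτ : τ ≠ 0) {σ : ℝ} (h0 : 0 < σ) (h1 : σ < b.re) (h2 : σ < 1 / 2) (ξ : ℝ) :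
    barnesD σ (barnesPQ b τ) 0 ξ = 2 * Real.pi * (
      Gamma (-(I * τ) * 2) * Gamma (I * τ + 1 / 2) * Gamma (b + I * τ) *
        (Gamma (b - I * τ))⁻¹ * (Gamma (1 + I * τ))⁻¹ * solQ b (I * τ / 2) ξ ^ 2 +
      Gamma (I * τ * 2) * Gamma (-(I * τ) + 1 / 2) * Gamma (b - I * τ) *
        (Gamma (b + I * τ))⁻¹ * (Gamma (1 - I * τ))⁻¹ * solQ b (-(I * τ / 2)) ξ ^ 2) := by
  have hb : 0 < b.re := by linarith
  set w : ℂ := I * τ with hw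
  have hw0 : w ≠ 0 := I_mul_ofReal_ne_zero hτ
  have hwre : w.re = 0 := by simp [hw]
  have hw2 : w * 2 ≠ 0 := mul_ne_zero hw0 two_ne_zero
  have hρ0 : w / 2 ≠ 0 := div_ne_zero hw0 two_ne_zero
  have hρ : (w / 2).re = 0 := by simp [hwre]
  have hρτ : 4 * (w / 2) ^ 2 = -(τ : ℂ) ^ 2 := by
    rw [hw]; linear_combination (τ : ℂ) ^ 2 * I_sq
  have hρw : 2 * (w / 2) = w := by ring
  set g : ℂ → ℂ := fun s => Gamma (s + (w + 1)) * Gamma (s + (-w + 1)) * Gamma (1 / 2 - s) *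
    Gamma (b - s) * (Gamma (s + b))⁻¹ * (Gamma (1 - s))⁻¹ with hg
  set K₁ : ℂ := Gamma (-w * 2) * Gamma (w + 1 / 2) * Gamma (b + w) * (Gamma (b - w))⁻¹ *
    (Gamma (1 + w))⁻¹ with hK₁
  set K₂ : ℂ := Gamma (w * 2) * Gamma (-w + 1 / 2) * Gamma (b - w) * (Gamma (b + w))⁻¹ *
    (Gamma (1 - w))⁻¹ with hK₂
  have hexp : ∀ k ξ, barnesD σ (barnesPQ b τ) k ξ =
      barnesD (-(1 / 2)) (barnesPQ b τ) k ξ +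
      2 * Real.pi * (K₁ * w ^ k * cexp (w * ξ) + K₂ * (-w) ^ k * cexp (-w * ξ)) := by
    intro k ξ
    have := barnesD_sub_barnesD_of_poles (ι := Fin 2) (Φ := barnesPQ b τ) (g := g) (a := -(1 / 2))
      (c := σ) (p := ![-w, w]) (w := ![-(2 * w)⁻¹, (2 * w)⁻¹]) (fun j => by
        fin_cases j <;> simp [hwre] <;> linarith)
      (stripExp_quotient₂ (by simp [hwre]; norm_num) (by simp [hwre]; norm_num) (by simpa)
        (stripGrowth_Gamma_sub _ (by norm_num; linarith))
        (fun s _ h => differentiableAt_Gamma_sub (by norm_num; linarith))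
        (stripGrowth_Gamma_inv_sub _) (differentiable_Gamma_inv_sub _)) ?_ k ξ
    · simp only [Fin.sum_univ_two, Matrix.cons_val_zero, Matrix.cons_val_one] at this
      have g1 : -(2 * w)⁻¹ * g (-w) = K₁ := by
        simp only [hg, hK₁]
        rw [show -w + (w + 1) = 1 by ring, Gamma_one, show -w + (-w + 1) = 1 - w * 2 by ring,
          Gamma_one_sub hw2, sub_neg_eq_add, show -w + b = b - w by ring,
          show -(w * 2) = -w * 2 by ring, sub_neg_eq_add, sub_neg_eq_add, add_comm (1 / 2) w]
        field_simp
      have g2 : (2 * w)⁻¹ * g w = K₂ := by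
        simp only [hg, hK₂]
        rw [show w + (-w + 1) = 1 by ring, Gamma_one, show w + (w + 1) = 1 + w * 2 by ring,
          Gamma_one_add hw2, show w + b = b + w by ring, show 1 / 2 - w = -w + 1 / 2 by ring]
        field_simp
      rw [neg_neg] at this
      linear_combination this + 2 * Real.pi * w ^ k * cexp (w * ξ) * g1 +
        2 * Real.pi * (-w) ^ k * cexp (-w * ξ) * g2
    · intro s hs
      have hsre : s.re ≠ 0 := by
        rcases hs with hs | hs
        · rw [hs]; norm_num
        · rw [hs]; exact h0.ne'
      have e1 : s + w ≠ 0 := ne_zero_of_re_ne (by simpa [hwre])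
      have e2 : s - w ≠ 0 := ne_zero_of_re_ne (by simpa [hwre])
      have e3 : s + -w ≠ 0 := by rwa [← sub_eq_add_neg]
      simp only [Fin.sum_univ_two, Matrix.cons_val_zero, Matrix.cons_val_one, barnesPQ, hg]
      rw [← hw, ← add_assoc, ← add_assoc, Gamma_add_one _ e1, Gamma_add_one _ e3, sub_neg_eq_add,
        ← sub_eq_add_neg]
      field_simp
      ring
  have hsol := (isSol₃_barnesPQ h0 h1 h2 τ).eq_of_asymp (c₀ := 0)
    (c₁ := 2 * Real.pi * K₁) (c₂ := 2 * Real.pi * K₂) hb hρ hρ0 hρτ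
    ((isLittleO_barnesD_atBot (σ := -(1 / 2)) (by norm_num) (barnesPQ b τ) 0).congr_left fun ξ => by
      rw [hexp, hρw]; ring)
    ((isLittleO_barnesD_atBot (σ := -(1 / 2)) (by norm_num) (barnesPQ b τ) 1).congr_left fun ξ => by
      rw [hexp, hρw]; ring)
    ((isLittleO_barnesD_atBot (σ := -(1 / 2)) (by norm_num) (barnesPQ b τ) 2).congr_left fun ξ => by
      rw [hexp, hρw]; ring) ξ
  rw [hsol]
  ring

lemma sqrt_pi_ne_zero : (Real.sqrt Real.pi : ℂ) ≠ 0 :=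
  ofReal_ne_zero.2 (Real.sqrt_pos.2 Real.pi_pos).ne'

lemma two_cpow_ne_zero (z : ℂ) : (2 : ℂ) ^ z ≠ 0 := by simp [cpow_eq_zero_iff]

/-- The connection formula. -/
lemma solP_eq_solQ (hb : 0 < b.re) (hτ : τ ≠ 0) (ξ : ℝ) :
    solP b τ ξ = Gamma (b + 1 / 2) * (2 : ℂ) ^ b * (2 * (Real.sqrt Real.pi : ℂ))⁻¹ *
      (Gamma (-(I * τ)) * ((2 : ℂ) ^ (I * τ))⁻¹ * (Gamma (b - I * τ))⁻¹ * solQ b (I * τ / 2) ξ +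
        Gamma (I * τ) * (2 : ℂ) ^ (I * τ) * (Gamma (b + I * τ))⁻¹ * solQ b (-(I * τ / 2)) ξ) := by
  have h := solP_eq hb hτ ξ
  set w : ℂ := I * τ with hw
  have hwre : w.re = 0 := by simp [hw]
  have n1 : Gamma (b / 2 + w / 2) ≠ 0 := Gamma_ne_zero_of_re_pos (by simp [hwre, hb])
  have n2 : Gamma (b / 2 + -(w / 2)) ≠ 0 := Gamma_ne_zero_of_re_pos (by simp [hwre, hb])
  have n3 : Gamma (b / 2 + w / 2 + 1 / 2) ≠ 0 :=
    Gamma_ne_zero_of_re_pos (by simp [hwre]; linarith)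
  have n4 : Gamma (b / 2 + -(w / 2) + 1 / 2) ≠ 0 :=
    Gamma_ne_zero_of_re_pos (by simp [hwre]; linarith)
  have n5 : Gamma (b + 1 / 2) ≠ 0 := Gamma_ne_zero_of_re_pos (by simp; linarith)
  have n6 : Gamma (b + w) ≠ 0 := Gamma_ne_zero_of_re_pos (by simp [hwre, hb])
  have n7 : Gamma (b - w) ≠ 0 := Gamma_ne_zero_of_re_pos (by simp [hwre, hb])
  -- Legendre's duplication formula trades the half-integer shifts in `solP_eq` for Γ(b ± w) and
  -- powers of 2.
  have d1 := Gamma_mul_Gamma_add_half (b / 2 + w / 2)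
  have d2 := Gamma_mul_Gamma_add_half (b / 2 + -(w / 2))
  rw [show 2 * (b / 2 + w / 2) = b + w by ring, show 1 - (b + w) = 1 - b - w by ring,
    cpow_sub _ _ two_ne_zero, cpow_sub _ _ two_ne_zero, cpow_one] at d1
  rw [show 2 * (b / 2 + -(w / 2)) = b - w by ring, show 1 - (b - w) = 1 - b + w by ring,
    cpow_add _ _ two_ne_zero, cpow_sub _ _ two_ne_zero, cpow_one] at d2
  have hX := two_cpow_ne_zero w
  have hY := two_cpow_ne_zero b
  have hs := sqrt_pi_ne_zero
  set X := (2 : ℂ) ^ w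
  set Y := (2 : ℂ) ^ b
  have i1 : (Gamma (b / 2 + w / 2 + 1 / 2))⁻¹ =
      Gamma (b / 2 + w / 2) * (Gamma (b + w))⁻¹ * Y * X * (2 * (Real.sqrt Real.pi : ℂ))⁻¹ := by
    generalize Gamma (b / 2 + w / 2 + 1 / 2) = G at *
    generalize Gamma (b / 2 + w / 2) = G' at *
    field_simp at d1 ⊢
    linear_combination -d1
  have i2 : (Gamma (b / 2 + -(w / 2) + 1 / 2))⁻¹ =
      Gamma (b / 2 + -(w / 2)) * (Gamma (b - w))⁻¹ * Y * X⁻¹ * (2 * (Real.sqrt Real.pi : ℂ))⁻¹ := by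
    generalize Gamma (b / 2 + -(w / 2) + 1 / 2) = G at *
    generalize Gamma (b / 2 + -(w / 2)) = G' at *
    field_simp at d2 ⊢
    linear_combination -d2
  rw [i1, i2] at h
  have hc : Gamma (b / 2 + w / 2) * Gamma (b / 2 + -(w / 2)) * (Gamma (b + 1 / 2))⁻¹ ≠ 0 :=
    mul_ne_zero (mul_ne_zero n1 n2) (inv_ne_zero n5)
  refine mul_left_cancel₀ hc ?_
  rw [h]
  generalize Gamma (b / 2 + -(w / 2)) = G' at *
  generalize Gamma (b / 2 + w / 2) = G at *
  generalize Gamma (b + 1 / 2) = G₁ at *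
  field_simp

/-- The Mellin–Barnes representation of the square of the function of the first kind. -/
lemma sqrt_pi_mul_gammaProd_mul_kernelPP {μ : ℂ} (hτ : τ ≠ 0) {σ : ℝ}
    (h0 : 0 < σ) (h1 : σ < 1 / 2 - μ.re) (ξ : ℝ) :
    2 * Real.pi * ((Real.sqrt Real.pi : ℂ) * gammaProd μ τ * kernelPP μ τ (Real.exp ξ)) =
      cexp (ξ / 2) * barnes σ (barnesPP (1 / 2 - μ) τ) ξ := by
  have hb : 0 < (1 / 2 - μ).re := by simp; linarith
  have h1' : σ < (1 / 2 - μ).re := by simpa using h1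
  rw [← barnesD_zero, barnesPP_eq_solQ hτ h0 h1', kernelPP, legendreP_arg_exp,
    solP_eq_solQ hb hτ, gammaProd, show 1 - μ = 1 / 2 - μ + 1 / 2 by ring,
    show 1 / 2 + I * (τ : ℂ) - μ = 1 / 2 - μ + I * τ by ring,
    show 1 / 2 - I * (τ : ℂ) - μ = 1 / 2 - μ - I * τ by ring]
  have hμb : (2 : ℂ) ^ μ * (2 : ℂ) ^ (1 / 2 - μ) = (2 : ℂ) ^ (1 / 2 : ℂ) := by
    rw [← cpow_add _ _ two_ne_zero]; congr 1; ring
  have h2 : ((2 : ℂ) ^ (1 / 2 : ℂ)) ^ 2 = 2 := by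
    rw [← cpow_nat_mul]; norm_num
  have hexp : cexp (ξ / 4) ^ 2 = cexp (ξ / 2) := by
    rw [← Complex.exp_nat_mul]; congr 1; push_cast; ring
  set b : ℂ := 1 / 2 - μ
  set w : ℂ := I * τ with hw
  have hwre : w.re = 0 := by simp [hw]
  have hw0 : w ≠ 0 := I_mul_ofReal_ne_zero hτ
  have n5 : Gamma (b + 1 / 2) ≠ 0 := Gamma_ne_zero_of_re_pos (by rw [add_re]; norm_num; linarith)
  have n6 : Gamma (b + w) ≠ 0 := Gamma_ne_zero_of_re_pos (by rw [add_re, hwre]; linarith)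
  have n7 : Gamma (b - w) ≠ 0 := Gamma_ne_zero_of_re_pos (by rw [sub_re, hwre]; linarith)
  have n8 : Gamma (w + 1 / 2) ≠ 0 := Gamma_ne_zero_of_re_pos (by simp [hwre])
  have n9 : Gamma (-w + 1 / 2) ≠ 0 := Gamma_ne_zero_of_re_pos (by simp [hwre])
  have d1 := Gamma_mul_Gamma_add_half w
  have d2 := Gamma_mul_Gamma_add_half (-w)
  rw [cpow_sub _ _ two_ne_zero, show 2 * w = w + w by ring, cpow_add _ _ two_ne_zero, cpow_one,
    show w + w = w * 2 by ring] at d1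
  rw [show 1 - 2 * -w = 1 + (w + w) by ring, cpow_add _ _ two_ne_zero, cpow_add _ _ two_ne_zero,
    cpow_one, show 2 * -w = -w * 2 by ring] at d2
  have hX := two_cpow_ne_zero w
  have hs := sqrt_pi_ne_zero
  set X := (2 : ℂ) ^ w
  set Y := (2 : ℂ) ^ b
  set M := (2 : ℂ) ^ μ
  have i1 : Gamma (w * 2) * (Gamma (w + 1 / 2))⁻¹ =
      Gamma w * X ^ 2 * (2 * (Real.sqrt Real.pi : ℂ))⁻¹ := by
    generalize Gamma (w + 1 / 2) = G at *
    field_simp at d1 ⊢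
    linear_combination -d1
  have i2 : Gamma (-w * 2) * (Gamma (-w + 1 / 2))⁻¹ =
      Gamma (-w) * (X ^ 2)⁻¹ * (2 * (Real.sqrt Real.pi : ℂ))⁻¹ := by
    generalize Gamma (-w + 1 / 2) = G at *
    field_simp at d2 ⊢
    linear_combination -d2
  have hMY : (M * Y) ^ 2 = 2 := by rw [hμb, h2]
  rw [← hexp]
  generalize Gamma (b + 1 / 2) = G₁ at *
  generalize Gamma (-w + 1 / 2) = G₂ at *
  generalize Gamma (w + 1 / 2) = G₃ at *
  set S := (Real.sqrt Real.pi : ℂ)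
  set q := solQ b (w / 2) ξ
  set r := solQ b (-(w / 2)) ξ
  set E := cexp (ξ / 4)
  have j1 : Gamma (-w * 2) * Gamma (-w) * Gamma (b + w) * (Gamma (b - w))⁻¹ * G₂⁻¹ =
      Gamma (-w) * (X ^ 2)⁻¹ * (2 * S)⁻¹ * Gamma (-w) * Gamma (b + w) * (Gamma (b - w))⁻¹ := by
    linear_combination (Gamma (-w) * Gamma (b + w) * (Gamma (b - w))⁻¹) * i2
  have j2 : Gamma (w * 2) * Gamma w * Gamma (b - w) * (Gamma (b + w))⁻¹ * G₃⁻¹ =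
      Gamma w * X ^ 2 * (2 * S)⁻¹ * Gamma w * Gamma (b - w) * (Gamma (b + w))⁻¹ := by
    linear_combination (Gamma w * Gamma (b - w) * (Gamma (b + w))⁻¹) * i1
  rw [j1, j2]
  -- The powers of 2 collect into (2^μ 2^b)² = 2, because μ + b = 1/2.
  have j3 : (M / G₁ * E * (G₁ * Y * (2 * S)⁻¹ * (Gamma (-w) * X⁻¹ * (Gamma (b - w))⁻¹ * q +
      Gamma w * X * (Gamma (b + w))⁻¹ * r))) ^ 2 =
      E ^ 2 * 2 * ((2 * S)⁻¹) ^ 2 * (Gamma (-w) * X⁻¹ * (Gamma (b - w))⁻¹ * q +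
        Gamma w * X * (Gamma (b + w))⁻¹ * r) ^ 2 := by
    rw [← hMY]
    field_simp
  rw [j3]
  field_simp
  ring

/-- The Mellin–Barnes representation of the product of the functions of the first and second
kind. -/
lemma cosh_mul_barnesPQ {μ : ℂ} (hτ : τ ≠ 0) {σ : ℝ}
    (h0 : 0 < σ) (h1 : σ < 1 / 2 - μ.re) (h2 : σ < 1 / 2) (ξ : ℝ) :
    Real.cosh (Real.pi * τ) * barnes σ (barnesPQ (1 / 2 - μ) τ) ξ =
      2 * Real.pi * ((Real.sqrt Real.pi : ℂ) * cexp (I * μ * Real.pi) * cexp (-(ξ / 2)) *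
        kernelPQ μ τ (Real.exp ξ)) := by
  have hb : 0 < (1 / 2 - μ).re := by simp; linarith
  have h1' : σ < (1 / 2 - μ).re := by simpa using h1
  have l1 := legendreQ_arg_exp μ (I * τ / 2) ξ
  have l2 := legendreQ_arg_exp μ (-(I * τ / 2)) ξ
  rw [show -1 / 2 + 2 * (I * (τ : ℂ) / 2) = -1 / 2 + I * τ by ring] at l1
  rw [show -1 / 2 + 2 * (-(I * (τ : ℂ) / 2)) = -1 / 2 - I * τ by ring] at l2
  rw [← barnesD_zero, barnesPQ_eq_solQ hτ h0 h1' h2, kernelPQ, legendreP_arg_exp, l1, l2,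
    solP_eq_solQ hb hτ, show 1 - μ = 1 / 2 - μ + 1 / 2 by ring]
  have hμb : (2 : ℂ) ^ μ * (2 : ℂ) ^ (1 / 2 - μ) = (2 : ℂ) ^ (1 / 2 : ℂ) := by
    rw [← cpow_add _ _ two_ne_zero]; congr 1; ring
  have hexp : cexp (-(ξ / 2)) * (cexp (ξ / 4) * cexp (ξ / 4)) = 1 := by
    rw [← Complex.exp_add, ← Complex.exp_add, ← Complex.exp_zero]; congr 1; ring
  have hexp' : cexp (I * μ * Real.pi) * cexp (-(I * μ * Real.pi)) = 1 := by
    rw [← Complex.exp_add]; simp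
  set b : ℂ := 1 / 2 - μ
  rw [show 2 * (I * (τ : ℂ) / 2) = I * τ by ring, show 2 * (-(I * (τ : ℂ) / 2)) = -(I * τ) by ring]
  set w : ℂ := I * τ with hw
  have hwre : w.re = 0 := by simp [hw]
  have hw0 : w ≠ 0 := I_mul_ofReal_ne_zero hτ
  have n5 : Gamma (b + 1 / 2) ≠ 0 := Gamma_ne_zero_of_re_pos (by rw [add_re]; norm_num; linarith)
  have n6 : Gamma (b + w) ≠ 0 := Gamma_ne_zero_of_re_pos (by rw [add_re, hwre]; linarith)
  have n7 : Gamma (b - w) ≠ 0 := Gamma_ne_zero_of_re_pos (by rw [sub_re, hwre]; linarith)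
  have n8 : Gamma (w + 1 / 2) ≠ 0 := Gamma_ne_zero_of_re_pos (by simp [hwre])
  have n9 : Gamma (-w + 1 / 2) ≠ 0 := Gamma_ne_zero_of_re_pos (by simp [hwre])
  have n10 : Gamma w ≠ 0 := Gamma_ne_zero_of_re_zero hw0 hwre
  have n11 : Gamma (-w) ≠ 0 := Gamma_ne_zero_of_re_zero (neg_ne_zero.2 hw0) (by simp [hwre])
  have d1 := Gamma_mul_Gamma_add_half w
  have d2 := Gamma_mul_Gamma_add_half (-w)
  rw [cpow_sub _ _ two_ne_zero, show 2 * w = w + w by ring, cpow_add _ _ two_ne_zero, cpow_one,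
    show w + w = w * 2 by ring] at d1
  rw [show 1 - 2 * -w = 1 + (w + w) by ring, cpow_add _ _ two_ne_zero, cpow_add _ _ two_ne_zero,
    cpow_one, show 2 * -w = -w * 2 by ring] at d2
  -- Reflection at 1/2 + iτ is the source of the factor cosh πτ.
  have hrefl : Gamma (w + 1 / 2) * Gamma (-w + 1 / 2) * Real.cosh (Real.pi * τ) = Real.pi := by
    have h3 := Gamma_mul_Gamma_one_sub (w + 1 / 2)
    have h4 : Complex.sin (Real.pi * (w + 1 / 2)) = (Real.cosh (Real.pi * τ) : ℂ) := by
      rw [show (Real.pi : ℂ) * (w + 1 / 2) = Real.pi * w + Real.pi / 2 by ring, Complex.sin_add_pi_div_two,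
        hw, ofReal_cosh, ← Complex.cos_mul_I]
      push_cast
      congr 1
      ring
    have h5 : (Real.cosh (Real.pi * τ) : ℂ) ≠ 0 := ofReal_ne_zero.2 (Real.cosh_pos _).ne'
    rw [h4, show 1 - (w + 1 / 2) = -w + 1 / 2 by ring] at h3
    rw [h3]
    field_simp
  rw [Gamma_one_add hw0, Gamma_one_sub hw0, ← sub_eq_add_neg b w, ← sub_eq_add_neg (1 : ℂ) w,
    Gamma_one_sub hw0, cpow_add _ _ two_ne_zero, cpow_add _ _ two_ne_zero, cpow_neg]
  have hX := two_cpow_ne_zero w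
  have hH := two_cpow_ne_zero (1 / 2)
  have hs := sqrt_pi_ne_zero
  have hs2 : (Real.sqrt Real.pi : ℂ) ^ 2 = Real.pi := by
    rw [← ofReal_pow, Real.sq_sqrt Real.pi_pos.le]
  set X := (2 : ℂ) ^ w
  set Y := (2 : ℂ) ^ b
  set M := (2 : ℂ) ^ μ
  set H := (2 : ℂ) ^ (1 / 2 : ℂ)
  have i1 : Gamma (w * 2) * Real.cosh (Real.pi * τ) * Gamma (-w + 1 / 2) =
      Gamma w * X ^ 2 * Real.sqrt Real.pi * (1 / 2) := by
    have : Gamma w * Real.pi * X ^ 2 = Gamma (w * 2) * 2 * (Real.sqrt Real.pi : ℂ) *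
        (Gamma (-w + 1 / 2) * Real.cosh (Real.pi * τ)) := by
      rw [← hrefl]
      generalize Gamma (w + 1 / 2) = G at *
      field_simp at d1
      linear_combination (Gamma (-w + 1 / 2) * Real.cosh (Real.pi * τ)) * d1
    refine mul_right_cancel₀ hs ?_
    linear_combination -(1 / 2) * this - Gamma w * X ^ 2 * (1 / 2) * hs2
  have i2 : Gamma (-w * 2) * Real.cosh (Real.pi * τ) * Gamma (w + 1 / 2) =
      Gamma (-w) * (X ^ 2)⁻¹ * Real.sqrt Real.pi * (1 / 2) := by
    have : Gamma (-w) * Real.pi = Gamma (-w * 2) * 2 * X ^ 2 * (Real.sqrt Real.pi : ℂ) *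
        (Gamma (w + 1 / 2) * Real.cosh (Real.pi * τ)) := by
      rw [← hrefl]
      linear_combination (Gamma (w + 1 / 2) * Real.cosh (Real.pi * τ)) * d2
    refine mul_right_cancel₀ hs ?_
    rw [← hs2] at this
    have hXi : X ^ 2 * (X ^ 2)⁻¹ = 1 := mul_inv_cancel₀ (pow_ne_zero 2 hX)
    linear_combination -(1 / 2) * (X ^ 2)⁻¹ * this - (Gamma (-w * 2) * Real.cosh (Real.pi * τ) *
      Gamma (w + 1 / 2) * (Real.sqrt Real.pi : ℂ)) * hXi
  set S := (Real.sqrt Real.pi : ℂ)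
  set q := solQ b (w / 2) ξ
  set r := solQ b (-(w / 2)) ξ
  set E := cexp (ξ / 4)
  set C := (Real.cosh (Real.pi * τ) : ℂ)
  set F := cexp (-(ξ / 2))
  set A := cexp (I * μ * Real.pi)
  set A' := cexp (-(I * μ * Real.pi))
  generalize Gamma (b + 1 / 2) = G₁ at *
  generalize Gamma (-w + 1 / 2) = G₂ at *
  generalize Gamma (w + 1 / 2) = G₃ at *
  have j1 : S * A * F * (M / G₁ * E * (G₁ * Y * (2 * S)⁻¹ *
        (Gamma (-w) * X⁻¹ * (Gamma (b - w))⁻¹ * q + Gamma w * X * (Gamma (b + w))⁻¹ * r)) *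
      (A' * S * Gamma (b + w) / (H * X * (w * Gamma w)) * E * q +
        A' * S * Gamma (b - w) / (H * X⁻¹ * (-w * Gamma (-w))) * E * r)) =
      (A * A') * (F * (E * E)) * (M * Y) * H⁻¹ * S * 2⁻¹ *
        (Gamma (-w) * X⁻¹ * (Gamma (b - w))⁻¹ * q + Gamma w * X * (Gamma (b + w))⁻¹ * r) *
        (Gamma (b + w) * X⁻¹ * (w * Gamma w)⁻¹ * q +
          Gamma (b - w) * X * (-w * Gamma (-w))⁻¹ * r) := by
    field_simp
  rw [j1, hexp', hexp, hμb]
  have j2 : C * (2 * Real.pi * (Gamma (-w * 2) * G₃ * Gamma (b + w) * (Gamma (b - w))⁻¹ *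
      (w * Gamma w)⁻¹ * q ^ 2 + Gamma (w * 2) * G₂ * Gamma (b - w) * (Gamma (b + w))⁻¹ *
      (-w * Gamma (-w))⁻¹ * r ^ 2)) =
      2 * Real.pi * (Gamma (-w) * (X ^ 2)⁻¹ * S * (1 / 2) * Gamma (b + w) * (Gamma (b - w))⁻¹ *
      (w * Gamma w)⁻¹ * q ^ 2 + Gamma w * X ^ 2 * S * (1 / 2) * Gamma (b - w) * (Gamma (b + w))⁻¹ *
      (-w * Gamma (-w))⁻¹ * r ^ 2) := by
    rw [← i1, ← i2]
    ring
  -- On the right the coefficients of the mixed product q r are 1/w and -1/w; they cancel, in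
  -- agreement with the left side.
  rw [j2]
  field_simp
  ring

end

/-! ### The variable (2 cosh v)² and the beta integral -/

/-- `log ((2 cosh v)²)`. -/
def logCosh (v : ℝ) : ℝ := 2 * Real.log (2 * Real.cosh v)

lemma exp_logCosh (v : ℝ) : Real.exp (logCosh v) = 4 * Real.cosh v ^ 2 := by
  have := Real.cosh_pos v
  rw [logCosh, two_mul, Real.exp_add, Real.exp_log (by positivity)]
  ring

lemma hasDerivAt_logCosh (v : ℝ) : HasDerivAt logCosh (2 * (Real.sinh v / Real.cosh v)) v := by
  have h := Real.cosh_pos v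
  refine ((((Real.hasDerivAt_cosh v).const_mul 2).log (by positivity)).const_mul 2).congr_deriv ?_
  field_simp

lemma two_mul_abs_le_logCosh (v : ℝ) : 2 * |v| ≤ logCosh v := by
  have h1 : Real.exp |v| ≤ 2 * Real.cosh v := by
    rw [← Real.cosh_abs, Real.cosh_eq]
    linarith [Real.exp_pos (-|v|)]
  have := (Real.le_log_iff_exp_le (by linarith [Real.exp_pos |v|])).2 h1
  rw [logCosh]
  linarith

lemma logCosh_sub_le {v : ℝ} (hv : 0 ≤ v) : |logCosh v - 2 * v| ≤ 2 * Real.exp (-(2 * v)) := by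
  have h1 := two_mul_abs_le_logCosh v
  rw [abs_of_nonneg hv] at h1
  rw [abs_of_nonneg (by linarith)]
  have h2 : 2 * Real.cosh v = Real.exp v * (1 + Real.exp (-(2 * v))) := by
    rw [Real.cosh_eq, mul_add, ← Real.exp_add]
    ring_nf
  have h3 := Real.log_le_sub_one_of_pos (by positivity : 0 < 1 + Real.exp (-(2 * v)))
  rw [logCosh, h2, Real.log_mul (by positivity) (by positivity), Real.log_exp]
  linarith

lemma tendsto_logCosh : Tendsto logCosh atTop atTop := by
  refine tendsto_atTop_mono (fun v => ?_) tendsto_id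
  have := two_mul_abs_le_logCosh v
  simp only [id]
  linarith [le_abs_self v, abs_nonneg v]

lemma mOf_two_mul (v : ℝ) : mOf (2 * v) = Real.exp (v - logCosh v / 2) ∧
    1 - mOf (2 * v) = Real.exp (-v - logCosh v / 2) := by
  have h0 := Real.cosh_pos v
  have h1 : Real.exp (logCosh v / 2) = 2 * Real.cosh v := by
    rw [logCosh, mul_div_cancel_left₀ _ two_ne_zero, Real.exp_log (by positivity)]
  have h2 : 1 + Real.exp (2 * v) = Real.exp v * (2 * Real.cosh v) := by
    rw [Real.cosh_eq, two_mul v, Real.exp_add, Real.exp_neg]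
    field_simp
    ring
  constructor
  · rw [mOf, h2, Real.exp_sub, h1, two_mul v, Real.exp_add]
    field_simp
  · rw [one_sub_mOf, h2, Real.exp_sub, h1, Real.exp_neg]
    field_simp

/-- A form of the beta integral. -/
lemma integral_exp_mul_exp_logCosh {s : ℂ} (hs : 0 < s.re) (τ : ℝ) :
    ∫ v : ℝ, cexp (2 * I * τ * v) * cexp (-s * logCosh v) =
      1 / 2 * (Gamma (s + I * τ) * Gamma (s + -(I * τ)) * (Gamma (2 * s))⁻¹) := by
  have hu : 0 < (s + I * τ).re := by simpa
  have hv : 0 < (s + -(I * τ)).re := by simpa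
  have hB := Gamma_mul_Gamma_eq_betaIntegral hu hv
  rw [show s + I * τ + (s + -(I * τ)) = 2 * s by ring] at hB
  have hG : Gamma (2 * s) ≠ 0 := Gamma_ne_zero_of_re_pos (by simpa)
  have hd : ∀ v : ℝ, HasDerivAt (fun v => mOf (2 * v)) (2 * (mOf (2 * v) * (1 - mOf (2 * v)))) v := by
    intro v
    have := (hasDerivAt_mOf (2 * v)).comp v ((hasDerivAt_id v).const_mul 2)
    exact this.congr_deriv (by ring)
  have hinj : InjOn (fun v => mOf (2 * v)) univ := by
    have hmono : StrictMono (fun v => mOf (2 * v)) := strictMono_of_hasDerivAt_pos hd fun v =>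
      mul_pos two_pos (mul_pos (mOf_pos _) (by linarith [mOf_lt_one (2 * v)]))
    exact hmono.injective.injOn
  have himg : (fun v => mOf (2 * v)) '' univ = Ioo 0 1 := by
    ext x
    constructor
    · rintro ⟨v, -, rfl⟩
      exact ⟨mOf_pos _, mOf_lt_one _⟩
    · rintro ⟨h0, h1⟩
      refine ⟨Real.log (x / (1 - x)) / 2, mem_univ _, ?_⟩
      have h2 : 0 < 1 - x := by linarith
      simp only [mOf]
      rw [mul_div_cancel₀ _ two_ne_zero, Real.exp_log (div_pos h0 h2)]
      field_simp
      ring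
  have hbeta : betaIntegral (s + I * τ) (s + -(I * τ)) =
      2 * ∫ v : ℝ, cexp (2 * I * τ * v) * cexp (-s * logCosh v) := by
    -- Substitute u = e^{2v}/(1+e^{2v}). Then u = e^v/(2 cosh v), 1 - u = e^{-v}/(2 cosh v) and du =
    -- 2u(1-u) dv, so u^{iτ}(1-u)^{-iτ} = e^{2iτv}.
    rw [betaIntegral, intervalIntegral.integral_of_le zero_le_one, integral_Ioc_eq_integral_Ioo,
      ← himg, integral_image_eq_integral_abs_deriv_smul MeasurableSet.univ
        (fun v _ => (hd v).hasDerivWithinAt) hinj, setIntegral_univ, ← integral_const_mul]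
    refine integral_congr_ae (Eventually.of_forall fun v => ?_)
    obtain ⟨e1, e2⟩ := mOf_two_mul v
    have p1 := mOf_pos (2 * v)
    have p2 : 0 < 1 - mOf (2 * v) := by linarith [mOf_lt_one (2 * v)]
    simp only [real_smul]
    rw [abs_of_pos (by positivity), show (1 : ℂ) - (mOf (2 * v) : ℂ) = ((1 - mOf (2 * v) : ℝ) : ℂ) by
      push_cast; ring, ofReal_cpow_eq_exp p1, ofReal_cpow_eq_exp p2, e2, e1, Real.log_exp, Real.log_exp]
    push_cast
    rw [mul_assoc, ← Complex.exp_add, ← Complex.exp_add, ← Complex.exp_add, ← Complex.exp_add]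
    congr 2
    ring
  rw [hB, hbeta]
  field_simp

/-! ### A Mellin–Barnes integral in closed form -/

/-- The integrand of `barnesJ_eq`. -/
def barnesJ (τ : ℝ) (s : ℂ) : ℂ := Gamma (2 * s + 1) * Gamma (I * τ - s) * Gamma (-(I * τ) - s)

lemma stripGrowth_Gamma_two_mul_add_one {α β : ℝ} (hα : -(1 / 2) < α) :
    StripGrowth (-Real.pi) (fun s => Gamma (2 * s + 1)) α β := by
  have h := StripGrowth.comp_mul 2 (by norm_num) (stripGrowth_Gamma_add 1 (a := 2 * α) (b := 2 * β)
    (by simp; linarith))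
  have e : (2 : ℝ) * -(Real.pi / 2) = -Real.pi := by ring
  rw [e] at h
  simpa using h

lemma differentiableAt_Gamma_two_mul_add_one {s : ℂ} (hs : -(1 / 2) < s.re) :
    DifferentiableAt ℂ (fun s => Gamma (2 * s + 1)) s :=
  DifferentiableAt.comp (g := Gamma) s (differentiableAt_Gamma_of_re_pos (by simp; linarith))
    (by fun_prop)

lemma stripExp_barnesJ_aux {c₁ c₂ : ℂ} {α β : ℝ} (hα : -(1 / 2) < α) (h1 : β < c₁.re)
    (h2 : β < c₂.re) :
    StripExp (fun s => Gamma (2 * s + 1) * Gamma (c₁ - s) * Gamma (c₂ - s)) α β := by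
  refine ⟨⟨-Real.pi + -(Real.pi / 2) + -(Real.pi / 2), by linarith [Real.pi_pos], ?_⟩,
    fun s hs hs' => ?_⟩
  · exact ((stripGrowth_Gamma_two_mul_add_one hα).mul (stripGrowth_Gamma_sub _ h1)).mul
      (stripGrowth_Gamma_sub _ h2)
  · exact ((differentiableAt_Gamma_two_mul_add_one (by linarith)).mul
      (differentiableAt_Gamma_sub (by linarith))).mul (differentiableAt_Gamma_sub (by linarith))

lemma stripExp_barnesJ {τ α β : ℝ} (hα : -(1 / 2) < α) (hβ : β < 0) : StripExp (barnesJ τ) α β :=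
  stripExp_barnesJ_aux hα (by simpa) (by simpa)

/-- The left side is Γ(2s+3) = (2s+2)(2s+1)Γ(2s+1); the right side comes from raising both Γ(±iτ-s)
by one, with (iτ-s)(-iτ-s) = s² + τ². -/
lemma barnesJ_ode {σ : ℝ} (h0 : -(1 / 2) < σ) (h1 : σ < 0) (τ ξ : ℝ) :
    2 * barnesD σ (barnesJ τ) 0 ξ - 6 * barnesD σ (barnesJ τ) 1 ξ + 4 * barnesD σ (barnesJ τ) 2 ξ =
      Real.exp ξ * (τ ^ 2 * barnesD σ (barnesJ τ) 0 ξ + barnesD σ (barnesJ τ) 2 ξ) := by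
  have hE : StripExp (barnesJ τ) σ σ := stripExp_barnesJ h0 h1
  have hrec := barnes_recurrence (σ := σ) (Φ := barnesJ τ)
    (L := fun s => 2 + 6 * s + 4 * s ^ 2 + 0 * s ^ 3)
    (R := fun s => τ ^ 2 + 0 * s + 1 * s ^ 2 + 0 * s ^ 3)
    (Ψ := fun s => Gamma (2 * s + 1) * Gamma (1 + I * τ - s) * Gamma (1 + -(I * τ) - s))
    (stripExp_barnesJ_aux h0 (by simp; linarith) (by simp; linarith)) ?_ ?_ ξ
  · rw [hE.barnes_cubic, hE.barnes_cubic] at hrec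
    linear_combination hrec
  · intro s hs
    have e1 : 2 * s + 1 ≠ 0 := ne_zero_of_re_ne (by simp [hs]; linarith)
    have e2 : 2 * s + 1 + 1 ≠ 0 := ne_zero_of_re_ne (by simp [hs]; linarith)
    simp only [barnesJ]
    rw [show 2 * (s + 1) + 1 = 2 * s + 1 + 1 + 1 by ring, Gamma_add_one _ e2, Gamma_add_one _ e1,
      show 1 + I * (τ : ℂ) - (s + 1) = I * τ - s by ring,
      show 1 + -(I * (τ : ℂ)) - (s + 1) = -(I * τ) - s by ring]
    ring
  · intro s hs
    have e1 : I * τ - s ≠ 0 := ne_zero_of_re_ne (by simp [hs]; linarith)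
    have e2 : -(I * τ) - s ≠ 0 := ne_zero_of_re_ne (by simp [hs]; linarith)
    simp only [barnesJ]
    rw [show 1 + I * (τ : ℂ) - s = I * τ - s + 1 by ring, Gamma_add_one _ e1,
      show 1 + -(I * (τ : ℂ)) - s = -(I * τ) - s + 1 by ring, Gamma_add_one _ e2]
    linear_combination (Gamma (2 * s + 1) * Gamma (I * τ - s) * Gamma (-(I * τ) - s) * τ ^ 2) * I_sq

lemma Gamma_one_add_mul_Gamma_one_sub {τ : ℝ} (hτ : τ ≠ 0) :
    Gamma (1 + I * (2 * τ)) * Gamma (1 - I * (2 * τ)) =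
      2 * Real.pi * τ / Real.sinh (2 * Real.pi * τ) := by
  have hw : I * (2 * (τ : ℂ)) ≠ 0 := mul_ne_zero I_ne_zero (mul_ne_zero two_ne_zero (ofReal_ne_zero.2 hτ))
  have h := Gamma_mul_Gamma_one_sub (I * (2 * τ))
  have hs : Complex.sin (Real.pi * (I * (2 * τ))) = I * (Real.sinh (2 * Real.pi * τ) : ℂ) := by
    rw [show (Real.pi : ℂ) * (I * (2 * τ)) = (2 * Real.pi * τ) * I by ring, Complex.sin_mul_I]
    push_cast
    ring
  have hs0 : (Real.sinh (2 * Real.pi * τ) : ℂ) ≠ 0 := by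
    rw [ofReal_ne_zero, Ne, Real.sinh_eq_zero]
    exact mul_ne_zero (by positivity) hτ
  rw [Gamma_one_add hw, mul_assoc, h, hs]
  have := I_ne_zero
  field_simp

/-- Expansion of the integral as `ξ → ∞`. -/
lemma barnesJ_expansion {τ σ : ℝ} (hτ : τ ≠ 0) (h0 : -(1 / 2) < σ) (h1 : σ < 0) (k : ℕ) (ξ : ℝ) :
    barnesD σ (barnesJ τ) k ξ = barnesD (1 / 2) (barnesJ τ) k ξ +
      2 * Real.pi ^ 2 * I / Real.sinh (2 * Real.pi * τ) *
        ((-(I * τ)) ^ k * cexp (-(I * τ) * ξ) - (I * τ) ^ k * cexp (I * τ * ξ)) := by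
  set w : ℂ := I * τ with hw
  have hw0 : w ≠ 0 := I_mul_ofReal_ne_zero hτ
  have hwre : w.re = 0 := by simp [hw]
  set g : ℂ → ℂ := fun s => Gamma (2 * s + 1) * Gamma (1 + w - s) * Gamma (1 + -w - s) with hg
  have hval := Gamma_one_add_mul_Gamma_one_sub hτ
  rw [show I * (2 * (τ : ℂ)) = 2 * w by rw [hw]; ring] at hval
  -- The poles ±iτ lie between σ < 0 and 1/2, and the next ones are on Re s = 1.
  have := barnesD_sub_barnesD_of_poles (ι := Fin 2) (Φ := barnesJ τ) (g := g) (a := σ)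
    (c := 1 / 2) (p := ![-w, w]) (w := ![-(2 * w)⁻¹, (2 * w)⁻¹]) (fun j => by
      fin_cases j <;> simp [hwre] <;> linarith)
    (stripExp_barnesJ_aux h0 (by simp [hwre]; norm_num) (by simp [hwre]; norm_num)) ?_ k ξ
  · simp only [Fin.sum_univ_two, Matrix.cons_val_zero, Matrix.cons_val_one, neg_neg] at this
    have g1 : g (-w) = 2 * Real.pi * τ / Real.sinh (2 * Real.pi * τ) := by
      simp only [hg]
      rw [← hval, show 1 + -w - -w = 1 by ring, Gamma_one,
        show 2 * -w + 1 = 1 - 2 * w by ring, show 1 + w - -w = 1 + 2 * w by ring]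
      ring
    have g2 : g w = 2 * Real.pi * τ / Real.sinh (2 * Real.pi * τ) := by
      simp only [hg]
      rw [← hval, show 1 + w - w = 1 by ring, Gamma_one,
        show 2 * w + 1 = 1 + 2 * w by ring, show 1 + -w - w = 1 - 2 * w by ring]
      ring
    rw [g1, g2] at this
    have e : (2 * w)⁻¹ * (2 * Real.pi * τ) = -(Real.pi * I) := by
      rw [hw]
      have h2 : (τ : ℂ) ≠ 0 := ofReal_ne_zero.2 hτ
      have h3 := I_ne_zero
      field_simp
      rw [I_sq]
      ring
    have e' : (2 * w)⁻¹ * (2 * Real.pi * τ / Real.sinh (2 * Real.pi * τ)) =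
        -(Real.pi * I) / Real.sinh (2 * Real.pi * τ) := by rw [← e]; ring
    linear_combination -this + 2 * Real.pi * (w ^ k * cexp (w * ξ) - (-w) ^ k * cexp (-w * ξ)) * e'
  · intro s hs
    have hsre : s.re ≠ 0 := by
      rcases hs with hs | hs
      · rw [hs]; exact h1.ne
      · rw [hs]; norm_num
    have e1 : w - s ≠ 0 := ne_zero_of_re_ne (by simpa [hwre])
    have e2 : -w - s ≠ 0 := ne_zero_of_re_ne (by simpa [hwre])
    have e3 : s - w ≠ 0 := ne_zero_of_re_ne (by simpa [hwre])
    have e4 : s + w ≠ 0 := ne_zero_of_re_ne (by simpa [hwre])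
    simp only [Fin.sum_univ_two, Matrix.cons_val_zero, Matrix.cons_val_one, barnesJ, hg]
    rw [← hw, show 1 + w - s = w - s + 1 by ring, Gamma_add_one _ e1,
      show 1 + -w - s = -w - s + 1 by ring, Gamma_add_one _ e2, sub_neg_eq_add]
    field_simp
    ring

/-- Solutions of `E'' = -ω² E` that vanish at `+∞` are zero. -/
lemma eq_zero_of_harmonic {ω : ℝ} (hω : ω ≠ 0) {E E₁ : ℝ → ℂ} (h0 : ∀ v, HasDerivAt E (E₁ v) v)
    (h1 : ∀ v, HasDerivAt E₁ (-(ω : ℂ) ^ 2 * E v) v) (l0 : Tendsto E atTop (𝓝 0))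
    (l1 : Tendsto E₁ atTop (𝓝 0)) (v : ℝ) : E v = 0 := by
  have key : ∀ c : ℂ, c ^ 2 = -(ω : ℂ) ^ 2 → c.re = 0 → E₁ v - c * E v = 0 := by
    intro c hc hre
    have hd : ∀ v : ℝ, HasDerivAt (fun v : ℝ => (E₁ v - c * E v) * cexp (c * v)) 0 v := by
      intro v
      have he : HasDerivAt (fun v : ℝ => cexp (c * v)) (cexp (c * v) * c) v := by
        simpa using ((hasDerivAt_id v).ofReal_comp.const_mul c).cexp
      refine (((h1 v).fun_sub ((h0 v).const_mul c)).fun_mul he).congr_deriv ?_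
      linear_combination (-(E v * cexp (c * v))) * hc
    have hconst := fun v' => is_const_of_deriv_eq_zero (fun x => (hd x).differentiableAt)
      (fun x => (hd x).deriv) v v'
    have hlim : Tendsto (fun v : ℝ => (E₁ v - c * E v) * cexp (c * v)) atTop (𝓝 0) := by
      have h2 := (isLittleO_one_iff ℝ).2 (show Tendsto (fun v => E₁ v - c * E v) atTop (𝓝 0) by
        simpa using l1.sub (l0.const_mul c))
      exact (isLittleO_one_iff ℝ).1 (isLittleO_mul_one h2 (isBigO_cexp_mul hre atTop))
    have : (E₁ v - c * E v) * cexp (c * v) = 0 :=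
      tendsto_nhds_unique (tendsto_const_nhds.congr hconst) hlim
    exact (mul_eq_zero.1 this).resolve_right (Complex.exp_ne_zero _)
  have e1 := key (I * ω) (by linear_combination (ω : ℂ) ^ 2 * I_sq) (by simp)
  have e2 := key (-(I * ω)) (by linear_combination (ω : ℂ) ^ 2 * I_sq) (by simp)
  have : (2 * (I * ω)) * E v = 0 := by linear_combination e2 - e1
  exact (mul_eq_zero.1 this).resolve_left (mul_ne_zero two_ne_zero (I_mul_ofReal_ne_zero hω))

lemma tendsto_sinh_div_cosh : Tendsto (fun v => Real.sinh v / Real.cosh v) atTop (𝓝 1) := by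
  have h1 : Tendsto (fun v => Real.exp (-(2 * v))) atTop (𝓝 0) :=
    Real.tendsto_exp_neg_atTop_nhds_zero.comp (tendsto_id.const_mul_atTop two_pos)
  have h2 : Tendsto (fun v => (1 - Real.exp (-(2 * v))) / (1 + Real.exp (-(2 * v)))) atTop
      (𝓝 ((1 - 0) / (1 + 0))) := (h1.const_sub 1).div (h1.const_add 1) (by norm_num)
  rw [sub_zero, add_zero, div_one] at h2
  refine h2.congr fun v => ?_
  rw [Real.sinh_eq, Real.cosh_eq, show -(2 * v) = -v - v by ring, Real.exp_sub]
  have := Real.exp_pos v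
  have := Real.exp_pos (-v)
  field_simp

lemma tendsto_inv_cosh_sq : Tendsto (fun v => (Real.cosh v ^ 2)⁻¹) atTop (𝓝 0) := by
  have h := (tendsto_sinh_div_cosh.pow 2).const_sub 1
  rw [one_pow, sub_self] at h
  refine h.congr fun v => ?_
  have h1 := Real.cosh_pos v
  have h2 := Real.cosh_sq v
  field_simp
  linarith

lemma tendsto_logCosh_sub : Tendsto (fun v => logCosh v - 2 * v) atTop (𝓝 0) := by
  have h1 : Tendsto (fun v => 2 * Real.exp (-(2 * v))) atTop (𝓝 0) := by
    simpa using (Real.tendsto_exp_neg_atTop_nhds_zero.comp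
      (tendsto_id.const_mul_atTop two_pos)).const_mul 2
  refine squeeze_zero_norm' ?_ h1
  filter_upwards [eventually_ge_atTop 0] with v hv using logCosh_sub_le hv

lemma tendsto_barnesD_logCosh {σ : ℝ} (hσ : 0 < σ) (Φ : ℂ → ℂ) (k : ℕ) :
    Tendsto (fun v => barnesD σ Φ k (logCosh v)) atTop (𝓝 0) := by
  have h : Tendsto (fun ξ => Real.exp (-σ * ξ)) atTop (𝓝 0) :=
    Real.tendsto_exp_atBot.comp (tendsto_id.const_mul_atTop_of_neg (by linarith))
  exact ((isBigO_barnesD σ Φ k atTop).trans_tendsto h).comp tendsto_logCosh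

lemma tendsto_exp_logCosh_sub {c : ℂ} (hc : c.re = 0) :
    Tendsto (fun v : ℝ => cexp (c * logCosh v) - cexp (2 * c * v)) atTop (𝓝 0) := by
  have h1 : Tendsto (fun v : ℝ => cexp (c * ((logCosh v - 2 * v : ℝ) : ℂ)) - 1) atTop (𝓝 0) := by
    have h2 := ((continuous_ofReal.tendsto _).comp tendsto_logCosh_sub).const_mul c
    have h3 := ((Complex.continuous_exp.tendsto _).comp h2).sub_const 1
    simpa [Function.comp_def] using h3
  have h4 := isLittleO_mul_one ((isLittleO_one_iff ℝ).2 h1)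
    (isBigO_cexp_mul (ρ := 2 * c) (by simp [hc]) atTop)
  refine ((isLittleO_one_iff ℝ).1 h4).congr fun v => ?_
  rw [sub_mul, one_mul, ← Complex.exp_add]
  congr 2
  push_cast
  ring

/-- A Mellin–Barnes integral in closed form. -/
lemma tanh_mul_barnesJ {τ σ : ℝ} (hτ : τ ≠ 0) (hσ0 : -(1 / 2) < σ) (hσ1 : σ < 0) (v : ℝ) :
    (Real.sinh v / Real.cosh v : ℝ) * barnes σ (barnesJ τ) (logCosh v) =
      4 * Real.pi ^ 2 * Real.sin (2 * τ * v) / Real.sinh (2 * Real.pi * τ) := by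
  have hE : StripExp (barnesJ τ) σ σ := stripExp_barnesJ hσ0 hσ1
  set w : ℂ := I * τ with hw
  have hwre : w.re = 0 := by simp [hw]
  have hw2 : w ^ 2 = -(τ : ℂ) ^ 2 := by rw [hw]; linear_combination (τ : ℂ) ^ 2 * I_sq
  set C : ℂ := 2 * Real.pi ^ 2 * I / Real.sinh (2 * Real.pi * τ) with hC
  set T : ℝ → ℂ := fun v => ((Real.sinh v / Real.cosh v : ℝ) : ℂ) with hT
  set Q : ℝ → ℂ := fun v => (((Real.cosh v ^ 2)⁻¹ : ℝ) : ℂ) with hQ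
  have hTQ : ∀ v, T v ^ 2 = 1 - Q v := by
    intro v
    simp only [hT, hQ]
    rw [← ofReal_pow, ← ofReal_one, ← ofReal_sub, ofReal_inj]
    have h1 := Real.cosh_pos v
    have h2 := Real.cosh_sq v
    field_simp
    linarith
  have hdT : ∀ v, HasDerivAt T (Q v) v := by
    intro v
    have h1 := Real.cosh_pos v
    have h := (Real.hasDerivAt_sinh v).fun_div (Real.hasDerivAt_cosh v) h1.ne'
    have h3 := (h.congr_deriv (g' := (Real.cosh v ^ 2)⁻¹) (by
      have h2 := Real.cosh_sq v
      field_simp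
      linarith)).ofReal_comp
    exact h3
  have hdQ : ∀ v, HasDerivAt Q (-2 * T v * Q v) v := by
    intro v
    have h1 : HasDerivAt (fun v => 1 - T v ^ 2) (-(2 * T v * Q v)) v := by
      have := ((hdT v).fun_pow 2).const_sub 1
      exact this.congr_deriv (by push_cast; ring)
    refine (h1.congr_of_eventuallyEq (Eventually.of_forall fun v => ?_)).congr_deriv (by ring)
    simp only [hTQ v]
    ring
  have hdJ : ∀ k v, HasDerivAt (fun v => barnesD σ (barnesJ τ) k (logCosh v))
      (2 * T v * barnesD σ (barnesJ τ) (k + 1) (logCosh v)) v := by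
    intro k v
    have := (hE.hasDerivAt_barnesD k (logCosh v)).scomp v (hasDerivAt_logCosh v)
    refine this.congr_deriv ?_
    simp only [hT, real_smul]
    push_cast
    ring
  have hde : ∀ (c : ℂ) (v : ℝ), HasDerivAt (fun v : ℝ => cexp (c * v)) (cexp (c * v) * c) v :=
    fun c v => by simpa using ((hasDerivAt_id v).ofReal_comp.const_mul c).cexp
  have hexp := fun k ξ => barnesJ_expansion hτ hσ0 hσ1 k ξ
  have hTlim : Tendsto T atTop (𝓝 1) := by
    simpa [Function.comp_def, hT] using (continuous_ofReal.tendsto _).comp tendsto_sinh_div_cosh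
  have hQlim : Tendsto Q atTop (𝓝 0) := by
    simpa [Function.comp_def, hQ] using (continuous_ofReal.tendsto _).comp tendsto_inv_cosh_sq
  have a1 := tendsto_exp_logCosh_sub hwre
  have a2 := tendsto_exp_logCosh_sub (c := -w) (by simp [hwre])
  have E1 : Tendsto (fun v => barnesD σ (barnesJ τ) 0 (logCosh v) -
      C * (cexp (2 * (-w) * v) - cexp (2 * w * v))) atTop (𝓝 0) := by
    have := ((tendsto_barnesD_logCosh (σ := 1 / 2) (by norm_num) (barnesJ τ) 0).add
      ((a2.sub a1).const_mul C))
    simp only [sub_zero, mul_zero, add_zero] at this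
    refine this.congr fun v => ?_
    rw [hexp 0]
    ring
  have E2 : Tendsto (fun v => barnesD σ (barnesJ τ) 1 (logCosh v) -
      C * (-w * cexp (2 * (-w) * v) - w * cexp (2 * w * v))) atTop (𝓝 0) := by
    have := ((tendsto_barnesD_logCosh (σ := 1 / 2) (by norm_num) (barnesJ τ) 1).add
      (((a2.const_mul (-w)).sub (a1.const_mul w)).const_mul C))
    simp only [sub_zero, mul_zero, add_zero] at this
    refine this.congr fun v => ?_
    rw [hexp 1]
    ring
  have O1 := isBigO_cexp_mul (ρ := 2 * w) (by simp [hwre]) atTop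
  have O2 := isBigO_cexp_mul (ρ := 2 * (-w)) (by simp [hwre]) atTop
  have T0 : (fun v => T v - 1) =o[atTop] fun _ => (1 : ℝ) :=
    (isLittleO_one_iff ℝ).2 (sub_self (1 : ℂ) ▸ hTlim.sub_const 1)
  have T20 : (fun v => T v ^ 2 - 1) =o[atTop] fun _ => (1 : ℝ) := by
    refine (isLittleO_one_iff ℝ).2 ?_
    have := (hTlim.pow 2).sub_const 1
    rwa [one_pow, sub_self] at this
  have hOT : (fun _ : ℝ => (1 : ℂ)) =O[atTop] fun _ => (1 : ℝ) := isBigO_const_const _ one_ne_zero _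
  -- E is tanh v times the integral, minus its leading oscillation at +∞. The substitution exp ξ = 4
  -- cosh² v turns the equation of the integral into E'' = -(2τ)² E, while E and E' tend to 0.
  have key := eq_zero_of_harmonic (ω := 2 * τ) (mul_ne_zero two_ne_zero hτ)
    (E := fun v => T v * barnesD σ (barnesJ τ) 0 (logCosh v) -
      C * (cexp (2 * (-w) * v) - cexp (2 * w * v)))
    (E₁ := fun v => (Q v * barnesD σ (barnesJ τ) 0 (logCosh v) +
      2 * (T v ^ 2 * barnesD σ (barnesJ τ) 1 (logCosh v))) -
      C * (cexp (2 * (-w) * v) * (2 * (-w)) - cexp (2 * w * v) * (2 * w))) ?_ ?_ ?_ ?_ v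
  · have hsin : cexp (2 * (-w) * v) - cexp (2 * w * v) = -(2 * I) * Real.sin (2 * τ * v) := by
      rw [ofReal_sin, Complex.sin, hw]
      push_cast
      rw [show -(2 * (τ : ℂ) * v) * I = 2 * -(I * τ) * v by ring,
        show 2 * (τ : ℂ) * v * I = 2 * (I * τ) * v by ring]
      linear_combination (cexp (2 * -(I * τ) * v) - cexp (2 * (I * τ) * v)) * I_sq
    rw [← barnesD_zero]
    rw [hsin] at key
    have e : C * (-(2 * I) * Real.sin (2 * τ * v)) =
        4 * Real.pi ^ 2 * Real.sin (2 * τ * v) / Real.sinh (2 * Real.pi * τ) := by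
      rw [hC]
      linear_combination (-(4 * Real.pi ^ 2 * Real.sin (2 * τ * v) / Real.sinh (2 * Real.pi * τ) : ℂ)) *
        I_sq
    linear_combination key + e
  · intro v
    refine (((hdT v).fun_mul (hdJ 0 v)).fun_sub
      (((hde _ v).fun_sub (hde _ v)).const_mul C)).congr_deriv ?_
    simp only [zero_add]
    ring
  · intro v
    have h := ((((hdQ v).fun_mul (hdJ 0 v)).fun_add
      (((((hdT v).fun_pow 2).fun_mul (hdJ 1 v))).const_mul 2)).fun_sub
      ((((hde (2 * (-w)) v).mul_const (2 * (-w))).fun_sub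
        ((hde (2 * w) v).mul_const (2 * w))).const_mul C))
    refine h.congr_deriv ?_
    have ode := barnesJ_ode hσ0 hσ1 τ (logCosh v)
    have hcosh : Real.cosh v ≠ 0 := (Real.cosh_pos v).ne'
    rw [exp_logCosh] at ode
    -- The equation at exp ξ = 4 cosh² v, multiplied by Q = cosh⁻² v = 1 - tanh² v.
    have ode2 : Q v * (2 * barnesD σ (barnesJ τ) 0 (logCosh v) -
        6 * barnesD σ (barnesJ τ) 1 (logCosh v)) + 4 * Q v * barnesD σ (barnesJ τ) 2 (logCosh v) =
        4 * (τ ^ 2 * barnesD σ (barnesJ τ) 0 (logCosh v) + barnesD σ (barnesJ τ) 2 (logCosh v)) := by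
      have hQc : Q v * ((4 * Real.cosh v ^ 2 : ℝ) : ℂ) = 4 := by
        simp only [hQ]
        rw [← ofReal_mul, ← ofReal_ofNat, ofReal_inj]
        field_simp
      linear_combination Q v * ode + (τ ^ 2 * barnesD σ (barnesJ τ) 0 (logCosh v) +
        barnesD σ (barnesJ τ) 2 (logCosh v)) * hQc
    have hTQv := hTQ v
    push_cast
    simp only [pow_one]
    have hw2' : (2 * w) ^ 2 = -(2 * (τ : ℂ)) ^ 2 := by linear_combination 4 * hw2
    linear_combination (4 * T v * barnesD σ (barnesJ τ) 2 (logCosh v)) * hTQv - T v * ode2 -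
      C * (cexp (2 * (-w) * v) - cexp (2 * w * v)) * hw2'
  · have h1 := isLittleO_mul_sub_mul (G := fun v : ℝ => C * (cexp (2 * (-w) * v) - cexp (2 * w * v)))
      T0 ((isLittleO_one_iff ℝ).2 E1) hOT ((O2.sub O1).const_mul_left C)
    exact ((isLittleO_one_iff ℝ).1 h1).congr fun v => by ring
  · have hG : (fun v : ℝ => C * (-w * cexp (2 * (-w) * v) - w * cexp (2 * w * v))) =O[atTop]
        fun _ => (1 : ℝ) := ((O2.const_mul_left (-w)).sub (O1.const_mul_left w)).const_mul_left C
    have h1 := isLittleO_mul_sub_mul T20 ((isLittleO_one_iff ℝ).2 E2) hOT hG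
    have hJ0 : (fun v => barnesD σ (barnesJ τ) 0 (logCosh v)) =O[atTop] fun _ => (1 : ℝ) := by
      simpa using ((isLittleO_one_iff ℝ).2 E1).isBigO.add ((O2.sub O1).const_mul_left C)
    have h2 := isLittleO_mul_one ((isLittleO_one_iff ℝ).2 hQlim) hJ0
    exact ((isLittleO_one_iff ℝ).1 (h2.add (h1.const_mul_left 2))).congr fun v => by ring

lemma integrable_exp_mul_abs {r : ℝ} (hr : r < 0) : Integrable fun t : ℝ => Real.exp (r * |t|) := by
  obtain ⟨C, hC, h⟩ := pow_mul_exp_neg_bounded 2 hr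
  refine (integrable_inv_one_add_sq.const_mul C).mono'
    (by fun_prop : Continuous fun t : ℝ => Real.exp (r * |t|)).aestronglyMeasurable
    (Eventually.of_forall fun t => ?_)
  have h1 := h |t| (abs_nonneg t)
  rw [Real.norm_of_nonneg (Real.exp_pos _).le, ← div_eq_mul_inv, le_div_iff₀ (by positivity)]
  refine le_trans ?_ h1
  rw [mul_comm]
  gcongr
  nlinarith [abs_nonneg t, sq_abs t]

lemma continuous_logCosh : Continuous logCosh :=
  continuous_iff_continuousAt.2 fun v => (hasDerivAt_logCosh v).continuousAt

/-! ### Fourier inversion behind the index transform -/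

section Abstract

variable {h : ℂ → ℂ} {σ c : ℝ} {F : ℝ → ℂ}

lemma stripExp_two_mul_Gamma_two_mul (hσ : 0 < σ) (hg : StripGrowth 0 h σ σ)
    (hd : ∀ s : ℂ, s.re = σ → DifferentiableAt ℂ h s) :
    StripExp (fun s => 2 * Gamma (2 * s) * h s) σ σ := by
  have h1 := StripGrowth.comp_mul 2 (by norm_num) (stripGrowth_Gamma (a := 2 * σ) (b := 2 * σ)
    (by linarith))
  have e : (2 : ℝ) * -(Real.pi / 2) = -Real.pi := by ring
  rw [e] at h1
  simp only [ofReal_ofNat] at h1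
  refine ⟨⟨-Real.pi, by linarith [Real.pi_pos],
    ((StripGrowth.const 2).mul_zero_left h1).mul_zero_right hg⟩, fun s hs hs' => ?_⟩
  have h2 : DifferentiableAt ℂ (fun s : ℂ => Gamma (2 * s)) s :=
    DifferentiableAt.comp (g := Gamma) s (differentiableAt_Gamma_of_re_pos (by simp; linarith))
      (by fun_prop)
  exact (h2.const_mul 2).mul (hd s (le_antisymm hs' hs))

lemma stripExp_two_mul_Gamma_two_mul_add_one (hc1 : c < 1 / 2)
    (hg : StripGrowth 0 h (-c) σ)
    (hd : ∀ s : ℂ, -c ≤ s.re → s.re ≤ σ → DifferentiableAt ℂ h s) :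
    StripExp (fun s => 2 * Gamma (2 * s + 1) * h s) (-c) σ := by
  refine ⟨⟨-Real.pi, by linarith [Real.pi_pos],
    ((StripGrowth.const 2).mul_zero_left (stripGrowth_Gamma_two_mul_add_one (by linarith))).mul_zero_right
      hg⟩, fun s hs hs' => ?_⟩
  exact ((differentiableAt_Gamma_two_mul_add_one (by linarith)).const_mul 2).mul (hd s hs hs')

/-- The Fourier preimage of the function `(2π)⁻¹ ∫ Γ(s+iτ) Γ(s-iτ) h(s)` of `τ`. -/
def fourierPre (σ : ℝ) (h : ℂ → ℂ) (v : ℝ) : ℂ :=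
  (2 * Real.pi : ℂ)⁻¹ * barnes σ (fun s => 2 * Gamma (2 * s) * h s) (logCosh v)

/-- Differentiation in v brings down a factor s, and 2sΓ(2s) = Γ(2s+1) no longer has a pole at 0.
The contour can therefore pass to Re s = -c, short of the next pole at -1/2. -/
lemma hasDerivAt_fourierPre (hσ : 0 < σ) (hc0 : 0 < c) (hc1 : c < 1 / 2)
    (hg : StripGrowth 0 h (-c) σ)
    (hd : ∀ s : ℂ, -c ≤ s.re → s.re ≤ σ → DifferentiableAt ℂ h s) (v : ℝ) :
    HasDerivAt (fourierPre σ h) (-(2 * Real.pi : ℂ)⁻¹ * (Real.sinh v / Real.cosh v : ℝ) *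
      barnes (-c) (fun s => 2 * Gamma (2 * s + 1) * h s) (logCosh v)) v := by
  have h1 := stripExp_two_mul_Gamma_two_mul hσ (hg.mono (by linarith) le_rfl)
    (fun s hs => hd s (by linarith) hs.le)
  have h2 := stripExp_two_mul_Gamma_two_mul_add_one hc1 hg hd
  have h3 := ((h1.hasDerivAt_barnes (logCosh v)).scomp v (hasDerivAt_logCosh v)).const_mul
    (2 * Real.pi : ℂ)⁻¹
  refine h3.congr_deriv ?_
  have h4 : barnes (-c) (fun s => 2 * Gamma (2 * s + 1) * h s) (logCosh v) =
      barnes σ (fun s => 2 * Gamma (2 * s + 1) * h s) (logCosh v) :=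
    vint_shift (by linarith) (h2.mul_exp _).stripDecay
  have h5 : barnes σ (fun s => 2 * Gamma (2 * s + 1) * h s) (logCosh v) =
      -2 * barnes σ (fun s => -s * (2 * Gamma (2 * s) * h s)) (logCosh v) := by
    rw [barnes, barnes, vint, vint, ← integral_const_mul]
    refine integral_congr_ae (Eventually.of_forall fun t => ?_)
    simp only
    rw [Gamma_add_one _ (mul_ne_zero two_ne_zero (ne_zero_of_re_ne (by simpa using hσ.ne')))]
    ring
  rw [h4, h5, real_smul]
  push_cast
  ring

lemma integrable_exp_logCosh (hσ : 0 < σ) : Integrable fun v => Real.exp (-σ * logCosh v) := by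
  refine (integrable_exp_mul_abs (r := -(2 * σ)) (by linarith)).mono'
    (by have := continuous_logCosh; fun_prop : Continuous _).aestronglyMeasurable
    (Eventually.of_forall fun v => ?_)
  rw [Real.norm_of_nonneg (Real.exp_pos _).le]
  refine Real.exp_le_exp.2 ?_
  have := two_mul_abs_le_logCosh v
  nlinarith

lemma integrable_fourierPre (hσ : 0 < σ) (hcont : Continuous (fourierPre σ h)) :
    Integrable (fourierPre σ h) := by
  obtain ⟨C, hC, hb⟩ := exists_norm_barnes_le σ (fun s => 2 * Gamma (2 * s) * h s)
  refine ((integrable_exp_logCosh hσ).const_mul (‖(2 * Real.pi : ℂ)⁻¹‖ * C)).mono'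
    hcont.aestronglyMeasurable (Eventually.of_forall fun v => ?_)
  rw [fourierPre, norm_mul, mul_assoc]
  exact mul_le_mul_of_nonneg_left (hb _) (norm_nonneg _)

/-- By Fubini the inner integral is the beta integral, whose 1/Γ(2s) cancels the factor inserted in
`fourierPre`. -/
lemma integral_exp_mul_fourierPre (hσ : 0 < σ) (hg : StripGrowth 0 h σ σ)
    (hd : ∀ s : ℂ, s.re = σ → DifferentiableAt ℂ h s) (τ : ℝ) :
    ∫ v : ℝ, cexp (2 * I * τ * v) * fourierPre σ h v =
      (2 * Real.pi : ℂ)⁻¹ * vint σ fun s => Gamma (s + I * τ) * Gamma (s + -(I * τ)) * h s := by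
  set Λ : ℂ → ℂ := fun s => 2 * Gamma (2 * s) * h s with hΛ
  have h1 : StripExp Λ σ σ := stripExp_two_mul_Gamma_two_mul hσ hg hd
  have hcont : Continuous fun t : ℝ => Λ (σ + t * I) :=
    continuous_vline fun s hs => h1.2 s hs.ge hs.le
  have hint : Integrable fun t : ℝ => Λ (σ + t * I) := h1.stripDecay.integrable le_rfl le_rfl
  have hL := continuous_logCosh
  have hprod : Integrable (Function.uncurry fun (v t : ℝ) =>
      cexp (2 * I * τ * v) * (Λ (σ + t * I) * cexp (-(σ + t * I) * logCosh v)))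
      (volume.prod volume) := by
    refine ((integrable_exp_logCosh hσ).mul_prod hint.norm).mono' ?_ (Eventually.of_forall ?_)
    · refine Continuous.aestronglyMeasurable ?_
      have : Continuous fun z : ℝ × ℝ => Λ (σ + z.2 * I) := hcont.comp continuous_snd
      exact (by fun_prop : Continuous fun z : ℝ × ℝ => cexp (2 * I * τ * z.1)).mul
        (this.mul (by fun_prop))
    · rintro ⟨v, t⟩
      simp only [Function.uncurry]
      have e : ‖cexp (2 * I * τ * v)‖ = 1 := by
        rw [show 2 * I * (τ : ℂ) * v = ((2 * τ * v : ℝ) : ℂ) * I by push_cast; ring]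
        exact norm_exp_ofReal_mul_I _
      rw [norm_mul, norm_mul, norm_cexp_vline, e, one_mul, mul_comm]
  have e1 : ∀ v : ℝ, cexp (2 * I * τ * v) * fourierPre σ h v = (2 * Real.pi : ℂ)⁻¹ *
      ∫ t : ℝ, cexp (2 * I * τ * v) * (Λ (σ + t * I) * cexp (-(σ + t * I) * logCosh v)) := by
    intro v
    rw [fourierPre, barnes, vint, integral_const_mul]
    ring
  simp_rw [e1]
  rw [integral_const_mul, integral_integral_swap hprod, vint]
  congr 1
  refine integral_congr_ae (Eventually.of_forall fun t => ?_)
  simp only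
  have hs : 0 < ((σ : ℂ) + t * I).re := by simpa using hσ
  have e2 : ∀ v : ℝ, cexp (2 * I * τ * v) * (Λ (σ + t * I) * cexp (-(σ + t * I) * logCosh v)) =
      Λ (σ + t * I) * (cexp (2 * I * τ * v) * cexp (-(σ + t * I) * logCosh v)) := fun v => by ring
  simp_rw [e2]
  rw [integral_const_mul, integral_exp_mul_exp_logCosh hs]
  have hne : Gamma (2 * (σ + t * I)) ≠ 0 := Gamma_ne_zero_of_re_pos (by simpa using hσ)
  simp only [hΛ]
  field_simp

/-- Inversion of the Fourier transform. -/
lemma fourierPre_eq (hcont : Continuous (fourierPre σ h)) (hint : Integrable (fourierPre σ h))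
    (hF : ∀ τ ≠ 0, F τ = ∫ v : ℝ, cexp (2 * I * τ * v) * fourierPre σ h v) (hFi : Integrable F)
    (v : ℝ) :
    fourierPre σ h v = (Real.pi : ℂ)⁻¹ * ∫ τ : ℝ, cexp (-(2 * I * τ * v)) * F τ := by
  have hpi := Real.pi_pos
  -- The normalised Fourier kernel e^{-2πivw} matches e^{2iτv} for τ = -πw. The point w = 0, where
  -- nothing is known about F, is a null set.
  have e1 : 𝓕 (fourierPre σ h) =ᵐ[volume] fun w => F (-Real.pi * w) := by
    have : ∀ᵐ w : ℝ ∂volume, w ≠ 0 := by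
      simp [ae_iff]
    filter_upwards [this] with w hw
    rw [Real.fourier_real_eq_integral_exp_smul, hF _ (mul_ne_zero (by simp [hpi.ne']) hw)]
    refine integral_congr_ae (Eventually.of_forall fun v => ?_)
    simp only [smul_eq_mul]
    congr 2
    push_cast
    ring
  have e2 : Integrable (𝓕 (fourierPre σ h)) :=
    (hFi.comp_mul_left' (by simp [hpi.ne'] : -Real.pi ≠ 0)).congr e1.symm
  have e3 := congrFun (hcont.fourierInv_fourier_eq hint e2) v
  rw [← e3, Real.fourierInv_eq']
  have e4 : ∫ w : ℝ, cexp (↑(2 * Real.pi * inner ℝ w v) * I) • 𝓕 (fourierPre σ h) w =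
      ∫ w : ℝ, (fun τ : ℝ => cexp (-(2 * I * τ * v)) * F τ) (-Real.pi * w) := by
    refine integral_congr_ae ?_
    filter_upwards [e1] with w hw
    rw [hw, smul_eq_mul]
    congr 2
    simp
    ring
  rw [e4, Measure.integral_comp_mul_left (fun τ : ℝ => cexp (-(2 * I * τ * v)) * F τ) (-Real.pi),
    real_smul]
  congr 1
  rw [abs_inv, abs_neg, abs_of_pos hpi, ofReal_inv]

lemma hasDerivAt_integral_exp_mul (hFi : Integrable F) (hF1 : Integrable fun τ : ℝ => (τ : ℂ) * F τ)
    (v : ℝ) : HasDerivAt (fun v : ℝ => ∫ τ : ℝ, cexp (-(2 * I * τ * v)) * F τ)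
      (∫ τ : ℝ, -(2 * I) * (cexp (-(2 * I * τ * v)) * ((τ : ℂ) * F τ))) v := by
  have hn : ∀ τ v : ℝ, ‖cexp (-(2 * I * τ * v))‖ = 1 := by
    intro τ v
    rw [show -(2 * I * (τ : ℂ) * v) = ((-(2 * τ * v) : ℝ) : ℂ) * I by push_cast; ring]
    exact norm_exp_ofReal_mul_I _
  have hm : ∀ (G : ℝ → ℂ), Integrable G → ∀ v : ℝ,
      Integrable (fun τ : ℝ => cexp (-(2 * I * τ * v)) * G τ) := fun G hG v =>
    hG.bdd_mul (c := 1) (by fun_prop : Continuous _).aestronglyMeasurable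
      (Eventually.of_forall fun τ => (hn τ v).le)
  refine (hasDerivAt_integral_of_dominated_loc_of_deriv_le
    (F := fun (v : ℝ) (τ : ℝ) => cexp (-(2 * I * τ * v)) * F τ)
    (F' := fun (v : ℝ) (τ : ℝ) => -(2 * I) * (cexp (-(2 * I * τ * v)) * (τ * F τ)))
    (bound := fun τ : ℝ => 2 * ‖(τ : ℂ) * F τ‖)
    (Metric.ball_mem_nhds v one_pos) ?_ (hm F hFi v)
    ((hm _ hF1 v).const_mul _).aestronglyMeasurable ?_ (hF1.norm.const_mul 2) ?_).2
  · exact Eventually.of_forall fun v' => (hm F hFi v').aestronglyMeasurable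
  · refine Eventually.of_forall fun τ v' _ => ?_
    rw [norm_mul, norm_mul (cexp _), hn, one_mul]
    simp
  · refine Eventually.of_forall fun τ v' _ => ?_
    have h1 : HasDerivAt (fun v : ℝ => cexp (-(2 * I * τ * v)))
        (cexp (-(2 * I * τ * v')) * (-(2 * I * τ))) v' := by
      have := ((hasDerivAt_id v').ofReal_comp.const_mul (-(2 * I * τ))).cexp
      simpa using this
    exact (h1.mul_const (F τ)).congr_deriv (by ring)

/-- F is even away from 0, so τF(τ) is odd and only the sine part of the exponential survives. -/
lemma integral_odd_exp (hFe : ∀ τ ≠ 0, F (-τ) = F τ) (hF1 : Integrable fun τ : ℝ => (τ : ℂ) * F τ)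
    (v : ℝ) : ∫ τ : ℝ, cexp (-(2 * I * τ * v)) * (τ * F τ) =
      -(2 * I) * ∫ τ in Ioi (0 : ℝ), (Real.sin (2 * τ * v) : ℂ) * (τ * F τ) := by
  have hn : ∀ τ v : ℝ, ‖cexp (-(2 * I * τ * v))‖ = 1 := by
    intro τ v
    rw [show -(2 * I * (τ : ℂ) * v) = ((-(2 * τ * v) : ℝ) : ℂ) * I by push_cast; ring]
    exact norm_exp_ofReal_mul_I _
  have hm : ∀ v : ℝ, Integrable (fun τ : ℝ => cexp (-(2 * I * τ * v)) * (τ * F τ)) := fun v =>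
    hF1.bdd_mul (c := 1) (by fun_prop : Continuous _).aestronglyMeasurable
      (Eventually.of_forall fun τ => (hn τ v).le)
  rw [← intervalIntegral.integral_Iic_add_Ioi (b := 0) (hm v).integrableOn (hm v).integrableOn]
  have e1 := integral_comp_neg_Ioi (0 : ℝ) (fun τ : ℝ => cexp (-(2 * I * τ * v)) * (τ * F τ))
  rw [neg_zero] at e1
  rw [← e1, ← integral_add, ← integral_const_mul]
  · refine setIntegral_congr_fun measurableSet_Ioi fun τ hτ => ?_
    rw [hFe τ (ne_of_gt hτ), ofReal_sin, Complex.sin]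
    push_cast
    rw [show -(2 * I * -(τ : ℂ) * v) = 2 * τ * v * I by ring,
      show -(2 * I * (τ : ℂ) * v) = -(2 * τ * v) * I by ring]
    linear_combination ((cexp (-(2 * τ * v) * I) - cexp (2 * τ * v * I)) * τ * F τ) * I_sq
  · have := (hm v).comp_neg
    exact this.integrableOn
  · exact (hm v).integrableOn

end Abstract

/-! ### Uniqueness for Fourier transforms of exponentially decaying functions -/

lemma integrable_mul_exp_neg {d : ℝ → ℂ} {C : ℝ} (hd : Continuous d)
    (hb : ∀ t, ‖d t‖ ≤ C * Real.exp (-2 * |t|)) {z : ℂ} (hz : |z.im| < 1) :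
    Integrable fun t : ℝ => d t * cexp (-(I * t * z)) := by
  have hC : 0 ≤ C := by simpa using (norm_nonneg _).trans (hb 0)
  refine ((integrable_exp_mul_abs (r := -1) (by norm_num)).const_mul C).mono'
    (by fun_prop : Continuous _).aestronglyMeasurable (Eventually.of_forall fun t => ?_)
  rw [norm_mul, Complex.norm_exp]
  have e : (-(I * (t : ℂ) * z)).re = t * z.im := by simp
  have h1 : t * z.im ≤ |t| := by
    refine (le_abs_self _).trans ?_
    rw [abs_mul]
    nlinarith [abs_nonneg t]
  calc ‖d t‖ * Real.exp (-(I * (t : ℂ) * z)).re ≤ C * Real.exp (-2 * |t|) * Real.exp |t| := by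
        rw [e]
        gcongr
        exact hb t
    _ = C * Real.exp (-1 * |t|) := by
        rw [mul_assoc, ← Real.exp_add]
        congr 2
        ring

/-- In the strip |Im z| < 1 the exponential costs at most e^{|t|}, and the factor t from the
derivative at most 2e^{|t|/2}. The rate 2 of the decay leaves e^{-|t|/2}. -/
lemma differentiableOn_integral_mul_exp {d : ℝ → ℂ} {C : ℝ} (hd : Continuous d)
    (hb : ∀ t, ‖d t‖ ≤ C * Real.exp (-2 * |t|)) :
    DifferentiableOn ℂ (fun z : ℂ => ∫ t : ℝ, d t * cexp (-(I * t * z))) {z : ℂ | |z.im| < 1} := by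
  have hC : 0 ≤ C := by simpa using (norm_nonneg _).trans (hb 0)
  have hU : IsOpen {z : ℂ | |z.im| < 1} := isOpen_lt (by fun_prop) continuous_const
  intro z hz
  refine DifferentiableAt.differentiableWithinAt ?_
  refine (hasDerivAt_integral_of_dominated_loc_of_deriv_le
    (F := fun (z : ℂ) (t : ℝ) => d t * cexp (-(I * t * z)))
    (F' := fun (z : ℂ) (t : ℝ) => d t * (cexp (-(I * t * z)) * (-(I * t))))
    (bound := fun t : ℝ => 2 * C * Real.exp (-(1 / 2) * |t|))
    (hU.mem_nhds hz) ?_ (integrable_mul_exp_neg hd hb hz)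
    (by fun_prop : Continuous _).aestronglyMeasurable ?_
    ((integrable_exp_mul_abs (by norm_num)).const_mul _) ?_).2.differentiableAt
  · exact Eventually.of_forall fun z' => (by fun_prop : Continuous _).aestronglyMeasurable
  · refine Eventually.of_forall fun t w hw => ?_
    rw [norm_mul, norm_mul, Complex.norm_exp]
    have e : (-(I * (t : ℂ) * w)).re = t * w.im := by simp
    have h1 : t * w.im ≤ |t| := by
      refine (le_abs_self _).trans ?_
      rw [abs_mul]
      nlinarith [abs_nonneg t, (show |w.im| < 1 from hw)]
    have h2 : ‖-(I * (t : ℂ))‖ ≤ 2 * Real.exp (1 / 2 * |t|) := by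
      have := Real.add_one_le_exp (1 / 2 * |t|)
      simp
      linarith
    calc ‖d t‖ * (Real.exp (-(I * (t : ℂ) * w)).re * ‖-(I * (t : ℂ))‖) ≤
          C * Real.exp (-2 * |t|) * (Real.exp |t| * (2 * Real.exp (1 / 2 * |t|))) := by
          rw [e]
          gcongr
          exact hb t
      _ = 2 * C * (Real.exp (-2 * |t|) * Real.exp |t| * Real.exp (1 / 2 * |t|)) := by ring
      _ = 2 * C * Real.exp (-(1 / 2) * |t|) := by
          rw [← Real.exp_add, ← Real.exp_add]
          congr 2
          ring
  · refine Eventually.of_forall fun t w _ => ?_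
    have h1 : HasDerivAt (fun z : ℂ => cexp (-(I * t * z))) (cexp (-(I * t * w)) * (-(I * t))) w := by
      have := ((hasDerivAt_id w).const_mul (-(I * t))).cexp
      simpa using this
    exact h1.const_mul _

/-- An exponentially decaying function is zero if its Fourier transform has an accumulation point
of zeros. -/
lemma eq_zero_of_frequently_integral_mul_exp_eq_zero {d : ℝ → ℂ} {C : ℝ} (hd : Continuous d)
    (hb : ∀ t, ‖d t‖ ≤ C * Real.exp (-2 * |t|)) {x₀ : ℝ}
    (h0 : ∃ᶠ x : ℝ in 𝓝[≠] x₀, ∫ t : ℝ, d t * cexp (-(I * t * x)) = 0) (t : ℝ) : d t = 0 := by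
  have hU : IsOpen {z : ℂ | |z.im| < 1} := isOpen_lt (by fun_prop) continuous_const
  have hconv : Convex ℝ {z : ℂ | |z.im| < 1} := by
    have : {z : ℂ | |z.im| < 1} = Complex.imLm ⁻¹' Ioo (-1) 1 := by
      ext z; simp [abs_lt]
    rw [this]
    exact (convex_Ioo _ _).linear_preimage _
  have h1 : EqOn (fun z : ℂ => ∫ t : ℝ, d t * cexp (-(I * t * z))) 0 {z : ℂ | |z.im| < 1} := by
    refine ((differentiableOn_integral_mul_exp hd hb).analyticOnNhd
      hU).eqOn_zero_of_preconnected_of_frequently_eq_zero hconv.isPreconnected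
      (z₀ := (x₀ : ℂ)) (by simp) ?_
    have h2 : Tendsto (fun x : ℝ => (x : ℂ)) (𝓝[≠] x₀) (𝓝[≠] (x₀ : ℂ)) :=
      tendsto_nhdsWithin_of_tendsto_nhds_of_eventually_within _
        (continuous_ofReal.continuousAt.mono_left nhdsWithin_le_nhds)
        (eventually_mem_nhdsWithin.mono fun x hx => by simpa using hx)
    exact h2.frequently h0
  -- The identity theorem makes the transform vanish on the whole strip, in particular on the real
  -- line.
  have h2 : 𝓕 d = 0 := by
    ext w
    rw [Real.fourier_real_eq_integral_exp_smul]
    have h3 := h1 (show ((2 * Real.pi * w : ℝ) : ℂ) ∈ {z : ℂ | |z.im| < 1} by simp)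
    rw [Pi.zero_apply] at h3 ⊢
    rw [← h3]
    refine integral_congr_ae (Eventually.of_forall fun t => ?_)
    simp only [smul_eq_mul]
    rw [mul_comm]
    congr 2
    push_cast
    ring
  have hint : Integrable d := by
    simpa using integrable_mul_exp_neg hd hb (z := 0) (by simp)
  have h3 := congrFun (hd.fourierInv_fourier_eq hint (by rw [h2]; exact integrable_zero _ _ _)) t
  rw [← h3, h2, Real.fourierInv_eq']
  simp

/-! ### Bounds uniform in τ, and integrability against the weight -/

lemma exists_norm_Gamma_mul_Gamma_le {c : ℝ} (hc : 0 < c) : ∃ C : ℝ, 0 ≤ C ∧ ∀ t τ : ℝ,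
    ‖Gamma (c + t * I + I * τ) * Gamma (c + t * I + -(I * τ))‖ ≤ C * Real.exp (-2 * |t|) := by
  obtain ⟨C, hC, h⟩ := (stripGrowth_Gamma (b := c) hc).exp_decay (δ := 1)
    (by linarith [Real.pi_gt_three])
  refine ⟨C * C, by positivity, fun t τ => ?_⟩
  have h1 := h (c + t * I + I * τ) (by simp) (by simp)
  have h2 := h (c + t * I + -(I * τ)) (by simp) (by simp)
  rw [norm_mul]
  refine (mul_le_mul h1 h2 (norm_nonneg _) (by positivity)).trans ?_
  rw [mul_mul_mul_comm, ← Real.exp_add]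
  refine mul_le_mul_of_nonneg_left (Real.exp_le_exp.2 ?_) (by positivity)
  have e1 : (c + t * I + I * τ : ℂ).im = t + τ := by simp
  have e2 : (c + t * I + -(I * τ) : ℂ).im = t - τ := by simp [sub_eq_add_neg]
  rw [e1, e2]
  -- |t+τ| + |t-τ| ≥ 2|t| makes the bound independent of τ.
  have := abs_add_le (t + τ) (t - τ)
  rw [show t + τ + (t - τ) = 2 * t by ring, abs_mul, abs_two] at this
  linarith

lemma continuous_Gamma_mul_Gamma {c : ℝ} (hc : 0 < c) : Continuous fun z : ℝ × ℝ =>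
    Gamma (c + z.1 * I + I * z.2) * Gamma (c + z.1 * I + -(I * z.2)) := by
  have : ∀ g : ℝ × ℝ → ℂ, Continuous g → (∀ z, (g z).re = c) → Continuous fun z => Gamma (g z) :=
    fun g hg hre => continuous_iff_continuousAt.2 fun z =>
      ContinuousAt.comp (g := Gamma) (differentiableAt_Gamma_of_re_pos (by rw [hre]; exact hc)).continuousAt
        hg.continuousAt
  exact (this _ (by fun_prop) (by simp)).mul (this _ (by fun_prop) (by simp))

section Weight

variable {F : ℝ → ℂ} {M : ℝ}

lemma aestronglyMeasurable_of_weight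
    (hw : Integrable fun τ : ℝ => ((|τ| * Real.exp (2 * Real.pi * |τ|) : ℝ) : ℂ) * F τ) :
    AEStronglyMeasurable F := by
  have h1 : Measurable fun τ : ℝ => ((|τ| * Real.exp (2 * Real.pi * |τ|) : ℝ) : ℂ)⁻¹ := by fun_prop
  refine (h1.aestronglyMeasurable.mul hw.aestronglyMeasurable).congr ?_
  have : ∀ᵐ τ : ℝ ∂volume, τ ≠ 0 := by simp [ae_iff]
  filter_upwards [this] with τ hτ
  have h2 : ((|τ| * Real.exp (2 * Real.pi * |τ|) : ℝ) : ℂ) ≠ 0 :=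
    ofReal_ne_zero.2 (by have := abs_pos.2 hτ; positivity)
  simp only [Pi.mul_apply]
  rw [inv_mul_cancel_left₀ h2]

/-- The weight vanishes at τ = 0 and does not control F there. Boundedness is needed on [-1,1];
outside, the weight is at least 1. -/
lemma integrable_of_weight
    (hw : Integrable fun τ : ℝ => ((|τ| * Real.exp (2 * Real.pi * |τ|) : ℝ) : ℂ) * F τ)
    (hM : ∀ τ ≠ 0, ‖F τ‖ ≤ M) : Integrable F := by
  have h1 : Integrable (indicator (Icc (-1 : ℝ) 1) fun _ => M) :=
    (integrable_indicator_iff measurableSet_Icc).2 (by simp)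
  refine (h1.add hw.norm).mono' (aestronglyMeasurable_of_weight hw) ?_
  have : ∀ᵐ τ : ℝ ∂volume, τ ≠ 0 := by simp [ae_iff]
  filter_upwards [this] with τ hτ
  rw [Pi.add_apply]
  by_cases hτ1 : τ ∈ Icc (-1 : ℝ) 1
  · rw [indicator_of_mem hτ1]
    have := hM τ hτ
    linarith [norm_nonneg (((|τ| * Real.exp (2 * Real.pi * |τ|) : ℝ) : ℂ) * F τ)]
  · rw [indicator_of_notMem hτ1, zero_add, norm_mul, norm_real, Real.norm_of_nonneg (by positivity)]
    have h2 : 1 ≤ |τ| := by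
      rw [mem_Icc, ← abs_le] at hτ1
      exact (not_le.1 hτ1).le
    have h3 : 1 ≤ Real.exp (2 * Real.pi * |τ|) := Real.one_le_exp (by positivity)
    exact le_mul_of_one_le_left (norm_nonneg _) (by nlinarith)

lemma integrable_mul_of_weight
    (hw : Integrable fun τ : ℝ => ((|τ| * Real.exp (2 * Real.pi * |τ|) : ℝ) : ℂ) * F τ)
    {k : ℝ → ℝ} (hk : Continuous k) (hb : ∀ τ, |k τ| ≤ |τ| * Real.exp (2 * Real.pi * |τ|)) :
    Integrable fun τ : ℝ => (k τ : ℂ) * F τ := by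
  refine hw.norm.mono' ((by fun_prop : Continuous fun τ : ℝ => (k τ : ℂ)).aestronglyMeasurable.mul
    (aestronglyMeasurable_of_weight hw)) (Eventually.of_forall fun τ => ?_)
  rw [norm_mul, norm_mul, norm_real, norm_real, Real.norm_of_nonneg (by positivity : 0 ≤ |τ| * _)]
  exact mul_le_mul_of_nonneg_right (hb τ) (norm_nonneg _)

lemma abs_sinh_le_exp (x : ℝ) : |Real.sinh x| ≤ Real.exp |x| := by
  rw [Real.abs_sinh]
  rw [Real.sinh_eq]
  have := Real.exp_pos (-|x|)
  have := Real.exp_pos |x|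
  linarith

lemma abs_mul_sinh_le (τ : ℝ) :
    |τ * Real.sinh (2 * Real.pi * τ)| ≤ |τ| * Real.exp (2 * Real.pi * |τ|) := by
  rw [abs_mul]
  refine mul_le_mul_of_nonneg_left ?_ (abs_nonneg _)
  refine (abs_sinh_le_exp _).trans (le_of_eq ?_)
  rw [abs_mul, abs_of_pos (by positivity : (0 : ℝ) < 2 * Real.pi)]

lemma integrable_mul_sinh_of_weight
    (hw : Integrable fun τ : ℝ => ((|τ| * Real.exp (2 * Real.pi * |τ|) : ℝ) : ℂ) * F τ) :
    Integrable fun τ : ℝ => ((τ * Real.sinh (2 * Real.pi * τ) : ℝ) : ℂ) * F τ :=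
  integrable_mul_of_weight (k := fun τ => τ * Real.sinh (2 * Real.pi * τ)) hw (by fun_prop) abs_mul_sinh_le

lemma integrable_ofReal_mul_of_weight
    (hw : Integrable fun τ : ℝ => ((|τ| * Real.exp (2 * Real.pi * |τ|) : ℝ) : ℂ) * F τ) :
    Integrable fun τ : ℝ => (τ : ℂ) * F τ :=
  integrable_mul_of_weight (k := fun τ => τ) hw (by fun_prop) fun τ =>
    le_mul_of_one_le_right (abs_nonneg _) (Real.one_le_exp (by positivity))

end Weight

/-! ### Inversion of the transform with kernel Γ(s+iτ)Γ(s-iτ) -/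

section Inversion

variable {h : ℂ → ℂ} {σ c : ℝ} {F : ℝ → ℂ}

/-- Two derivatives of `fourierPre` are compared: the contour integral at Re s = -c, and Fourier
inversion differentiated under the integral sign and folded to τ > 0. -/
lemma tanh_mul_barnes_eq (hσ : 0 < σ) (hc0 : 0 < c) (hc1 : c < 1 / 2)
    (hg : StripGrowth 0 h (-c) σ)
    (hd : ∀ s : ℂ, -c ≤ s.re → s.re ≤ σ → DifferentiableAt ℂ h s)
    (hF : ∀ τ : ℝ, τ ≠ 0 → F τ = (2 * Real.pi : ℂ)⁻¹ *
      vint σ fun s => Gamma (s + I * τ) * Gamma (s + -(I * τ)) * h s)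
    (hw : Integrable fun τ : ℝ => ((|τ| * Real.exp (2 * Real.pi * |τ|) : ℝ) : ℂ) * F τ) (v : ℝ) :
    (Real.sinh v / Real.cosh v : ℝ) *
        barnes (-c) (fun s => 2 * Gamma (2 * s + 1) * h s) (logCosh v) =
      8 * ∫ τ in Ioi (0 : ℝ), (Real.sin (2 * τ * v) : ℂ) * (τ * F τ) := by
  have hA := hasDerivAt_fourierPre hσ hc0 hc1 hg hd
  have hcont : Continuous (fourierPre σ h) :=
    continuous_iff_continuousAt.2 fun v => (hA v).continuousAt
  have hint := integrable_fourierPre hσ hcont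
  have hF' : ∀ τ : ℝ, τ ≠ 0 → F τ = ∫ v : ℝ, cexp (2 * I * τ * v) * fourierPre σ h v := by
    intro τ hτ
    rw [hF τ hτ, integral_exp_mul_fourierPre hσ (hg.mono (by linarith) le_rfl)
      (fun s hs => hd s (by linarith) hs.le)]
  have hM : ∀ τ : ℝ, τ ≠ 0 → ‖F τ‖ ≤ ∫ v, ‖fourierPre σ h v‖ := by
    intro τ hτ
    rw [hF' τ hτ]
    refine (norm_integral_le_integral_norm _).trans (le_of_eq ?_)
    refine integral_congr_ae (Eventually.of_forall fun v => ?_)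
    simp only
    rw [norm_mul, show 2 * I * (τ : ℂ) * v = ((2 * τ * v : ℝ) : ℂ) * I by push_cast; ring,
      norm_exp_ofReal_mul_I, one_mul]
  have hFi := integrable_of_weight hw hM
  have hF1 := integrable_ofReal_mul_of_weight hw
  have hFe : ∀ τ : ℝ, τ ≠ 0 → F (-τ) = F τ := by
    intro τ hτ
    rw [hF τ hτ, hF (-τ) (neg_ne_zero.2 hτ)]
    congr 2
    ext s
    rw [ofReal_neg, mul_neg, neg_neg]
    ring
  have e1 : fourierPre σ h = fun v : ℝ =>
      (Real.pi : ℂ)⁻¹ * ∫ τ : ℝ, cexp (-(2 * I * τ * v)) * F τ :=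
    funext fun v => fourierPre_eq hcont hint hF' hFi v
  have h1 := (hasDerivAt_integral_exp_mul hFi hF1 v).const_mul (Real.pi : ℂ)⁻¹
  have h2 := hA v
  rw [e1] at h2
  have h3 := h2.unique h1
  rw [integral_const_mul, integral_odd_exp hFe hF1] at h3
  have hpi : (Real.pi : ℂ) ≠ 0 := ofReal_ne_zero.2 Real.pi_ne_zero
  generalize (∫ τ in Ioi (0 : ℝ), (Real.sin (2 * τ * v) : ℂ) * (τ * F τ)) = S at *
  generalize barnes (-c) (fun s => 2 * Gamma (2 * s + 1) * h s) (logCosh v) = B at *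
  have h4 : -(2 * (Real.pi : ℂ)) * (-(2 * Real.pi : ℂ)⁻¹ * (Real.sinh v / Real.cosh v : ℝ) * B) =
      -(2 * (Real.pi : ℂ)) * ((Real.pi : ℂ)⁻¹ * (-(2 * I) * (-(2 * I) * S))) := by rw [h3]
  have h5 : (2 * Real.pi : ℂ) * (2 * Real.pi : ℂ)⁻¹ = 1 :=
    mul_inv_cancel₀ (mul_ne_zero two_ne_zero hpi)
  have h6 : (Real.pi : ℂ) * (Real.pi : ℂ)⁻¹ = 1 := mul_inv_cancel₀ hpi
  linear_combination h4 - (Real.sinh v / Real.cosh v : ℝ) * B * h5 - 8 * S * I ^ 2 * h6 -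
    8 * S * I_sq

/-- The integral `∫ τ sinh(2πτ) Γ(s+iτ) Γ(s-iτ) F(τ)` over `τ > 0`. -/
def gammaTransform (F : ℝ → ℂ) (s : ℂ) : ℂ :=
  ∫ τ in Ioi (0 : ℝ), ((τ * Real.sinh (2 * Real.pi * τ) : ℝ) : ℂ) * F τ *
    (Gamma (s + I * τ) * Gamma (s + -(I * τ)))

/-- The bound e^{-2|t|} for the Gamma product is uniform in τ, so the double integral is dominated
by a product of one-variable functions. -/
lemma integrable_gammaTransform_prod (hc : 0 < c) {N : ℝ → ℂ} (hN : Continuous N)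
    (hNi : Integrable fun t => N t * Real.exp (-2 * |t|))
    (hw : Integrable fun τ : ℝ => ((|τ| * Real.exp (2 * Real.pi * |τ|) : ℝ) : ℂ) * F τ) :
    Integrable (Function.uncurry fun (t τ : ℝ) => N t *
      (((τ * Real.sinh (2 * Real.pi * τ) : ℝ) : ℂ) * F τ *
        (Gamma (c + t * I + I * τ) * Gamma (c + t * I + -(I * τ)))))
      (volume.prod (volume.restrict (Ioi 0))) := by
  obtain ⟨C, hC, hb⟩ := exists_norm_Gamma_mul_Gamma_le hc
  have hk := (integrable_mul_sinh_of_weight hw).integrableOn (s := Ioi 0)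
  refine ((hNi.norm.mul_prod hk.norm).const_mul C).mono' ?_ (Eventually.of_forall ?_)
  · refine (hN.comp continuous_fst).aestronglyMeasurable.mul
      (AEStronglyMeasurable.mul ?_ (continuous_Gamma_mul_Gamma hc).aestronglyMeasurable)
    exact hk.aestronglyMeasurable.comp_snd
  · rintro ⟨t, τ⟩
    simp only [Function.uncurry]
    rw [norm_mul, norm_mul (_ * F τ), norm_mul (N t), norm_real, Real.norm_of_nonneg (Real.exp_pos _).le]
    calc _ ≤ ‖N t‖ * (‖((τ * Real.sinh (2 * Real.pi * τ) : ℝ) : ℂ) * F τ‖ *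
          (C * Real.exp (-2 * |t|))) := by gcongr; exact hb t τ
      _ = _ := by ring

lemma continuous_gammaTransform (hc : 0 < c)
    (hw : Integrable fun τ : ℝ => ((|τ| * Real.exp (2 * Real.pi * |τ|) : ℝ) : ℂ) * F τ) :
    Continuous fun t : ℝ => gammaTransform F (c + t * I) := by
  obtain ⟨C, hC, hb⟩ := exists_norm_Gamma_mul_Gamma_le hc
  have hk := (integrable_mul_sinh_of_weight hw).integrableOn (s := Ioi 0)
  refine continuous_of_dominated
    (bound := fun τ : ℝ => ‖((τ * Real.sinh (2 * Real.pi * τ) : ℝ) : ℂ) * F τ‖ * C) ?_ ?_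
    (hk.norm.mul_const C) ?_
  · intro t
    refine hk.aestronglyMeasurable.mul (Continuous.aestronglyMeasurable ?_)
    exact (continuous_Gamma_mul_Gamma hc).comp (by fun_prop : Continuous fun τ : ℝ => (t, τ))
  · refine fun t => Eventually.of_forall fun τ => ?_
    rw [norm_mul]
    gcongr
    exact (hb t τ).trans (mul_le_of_le_one_right hC (Real.exp_le_one_iff.2 (by
      linarith [abs_nonneg t])))
  · refine Eventually.of_forall fun τ => Continuous.mul continuous_const ?_
    exact (continuous_Gamma_mul_Gamma hc).comp (by fun_prop : Continuous fun t : ℝ => (t, τ))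

lemma exists_norm_gammaTransform_le (F : ℝ → ℂ) (hc : 0 < c)
    (hw : Integrable fun τ : ℝ => ((|τ| * Real.exp (2 * Real.pi * |τ|) : ℝ) : ℂ) * F τ) :
    ∃ C : ℝ, 0 ≤ C ∧ ∀ t : ℝ, ‖gammaTransform F (c + t * I)‖ ≤ C * Real.exp (-2 * |t|) := by
  obtain ⟨C, hC, hb⟩ := exists_norm_Gamma_mul_Gamma_le hc
  have hk := (integrable_mul_sinh_of_weight hw).integrableOn (s := Ioi 0)
  refine ⟨(∫ τ in Ioi (0 : ℝ), ‖((τ * Real.sinh (2 * Real.pi * τ) : ℝ) : ℂ) * F τ‖) * C,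
    mul_nonneg (integral_nonneg fun _ => norm_nonneg _) hC, fun t => ?_⟩
  rw [mul_assoc, ← integral_mul_const]
  refine norm_integral_le_of_norm_le (hk.norm.mul_const _) (Eventually.of_forall fun τ => ?_)
  rw [norm_mul]
  gcongr
  exact hb t τ

lemma vint_neg (c : ℝ) (Φ : ℂ → ℂ) : vint (-c) Φ = vint c fun s => Φ (-s) := by
  rw [vint, vint, ← integral_neg_eq_self]
  refine integral_congr_ae (Eventually.of_forall fun t => ?_)
  simp only
  congr 1
  push_cast
  ring

/-- After exchanging the integrals, the inner one is `barnesJ`; its closed form supplies sin(2τv)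
and cancels sinh(2πτ). -/
lemma tanh_mul_barnes_gammaTransform (hc0 : 0 < c) (hc1 : c < 1 / 2)
    (hw : Integrable fun τ : ℝ => ((|τ| * Real.exp (2 * Real.pi * |τ|) : ℝ) : ℂ) * F τ) (v : ℝ) :
    (Real.sinh v / Real.cosh v : ℝ) *
        barnes (-c) (fun s => 2 * Gamma (2 * s + 1) * gammaTransform F (-s)) (logCosh v) =
      8 * Real.pi ^ 2 * ∫ τ in Ioi (0 : ℝ), (Real.sin (2 * τ * v) : ℂ) * (τ * F τ) := by
  set N : ℂ → ℂ := fun s => 2 * Gamma (2 * s + 1) * cexp (-s * logCosh v) with hN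
  have hexp : StripExp N (-c) (-c) := by
    have := (stripExp_two_mul_Gamma_two_mul_add_one (σ := -c) hc1 (StripGrowth.const 1)
      (fun _ _ _ => differentiableAt_const _)).mul_exp (logCosh v)
    simpa [hN] using this
  have hNc : Continuous fun t : ℝ => N (-(c + t * I)) := by
    have := (continuous_vline (σ := -c) fun s hs => hexp.2 s hs.ge hs.le).comp continuous_neg
    refine this.congr fun t => ?_
    simp only [Function.comp]
    congr 1
    push_cast
    ring
  have hNi : Integrable fun t : ℝ => N (-(c + t * I)) := by
    have := (hexp.stripDecay.integrable le_rfl le_rfl).comp_neg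
    refine this.congr (Eventually.of_forall fun t => ?_)
    simp only
    congr 1
    push_cast
    ring
  have hNi' : Integrable fun t : ℝ => N (-(c + t * I)) * Real.exp (-2 * |t|) := by
    refine hNi.norm.mono' (hNc.mul (by fun_prop)).aestronglyMeasurable
      (Eventually.of_forall fun t => ?_)
    rw [norm_mul, norm_real, Real.norm_of_nonneg (Real.exp_pos _).le]
    exact mul_le_of_le_one_right (norm_nonneg _)
      (Real.exp_le_one_iff.2 (by linarith [abs_nonneg t]))
  have hprod := integrable_gammaTransform_prod hc0 hNc hNi' hw
  have e1 : barnes (-c) (fun s => 2 * Gamma (2 * s + 1) * gammaTransform F (-s)) (logCosh v) =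
      ∫ t : ℝ, ∫ τ in Ioi (0 : ℝ), N (-(c + t * I)) *
      (((τ * Real.sinh (2 * Real.pi * τ) : ℝ) : ℂ) * F τ *
        (Gamma (c + t * I + I * τ) * Gamma (c + t * I + -(I * τ)))) := by
    rw [barnes, vint_neg, vint]
    refine integral_congr_ae (Eventually.of_forall fun t => ?_)
    simp only
    rw [integral_const_mul, neg_neg, gammaTransform, hN]
    simp only [neg_neg]
    rw [mul_right_comm]
  rw [e1, integral_integral_swap hprod, ← integral_const_mul, ← integral_const_mul]
  refine setIntegral_congr_fun measurableSet_Ioi fun τ hτ => ?_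
  have hτ0 : τ ≠ 0 := ne_of_gt hτ
  have e2 : ∫ t : ℝ, N (-(c + t * I)) *
      (((τ * Real.sinh (2 * Real.pi * τ) : ℝ) : ℂ) * F τ *
        (Gamma (c + t * I + I * τ) * Gamma (c + t * I + -(I * τ)))) =
      2 * ((τ * Real.sinh (2 * Real.pi * τ) : ℝ) : ℂ) * F τ * barnes (-c) (barnesJ τ) (logCosh v) := by
    rw [barnes, vint_neg, vint, ← integral_const_mul]
    refine integral_congr_ae (Eventually.of_forall fun t => ?_)
    simp only [hN, barnesJ]
    rw [show I * (τ : ℂ) - -(c + t * I) = c + t * I + I * τ by ring,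
      show -(I * (τ : ℂ)) - -(c + t * I) = c + t * I + -(I * τ) by ring]
    ring
  have h3 := tanh_mul_barnesJ hτ0 (by linarith : -(1 / 2) < -c) (by linarith) v
  have hsinh : Real.sinh (2 * Real.pi * τ) ≠ 0 := by
    rw [Ne, Real.sinh_eq_zero]
    positivity
  rw [eq_div_iff (ofReal_ne_zero.2 hsinh)] at h3
  rw [e2, ofReal_mul]
  linear_combination 2 * τ * F τ * h3

/-- Inversion of the transform `h ↦ (2π)⁻¹ ∫ Γ(s+iτ) Γ(s-iτ) h(s)`. -/
theorem gammaTransform_eq (hσ : 0 < σ) (hc0 : 0 < c) (hc1 : c < 1 / 2)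
    (hg : StripGrowth 0 h (-c) σ)
    (hd : ∀ s : ℂ, -c ≤ s.re → s.re ≤ σ → DifferentiableAt ℂ h s)
    (hF : ∀ τ : ℝ, τ ≠ 0 → F τ = (2 * Real.pi : ℂ)⁻¹ *
      vint σ fun s => Gamma (s + I * τ) * Gamma (s + -(I * τ)) * h s)
    (hw : Integrable fun τ : ℝ => ((|τ| * Real.exp (2 * Real.pi * |τ|) : ℝ) : ℂ) * F τ) {s : ℂ}
    (hs : s.re = c) : gammaTransform F s = Real.pi ^ 2 * h (-s) := by
  have hexp1 := stripExp_two_mul_Gamma_two_mul_add_one hc1 hg hd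
  have hexp0 : StripExp (fun s => 2 * Gamma (2 * s + 1)) (-c) (-c) := by
    have := stripExp_two_mul_Gamma_two_mul_add_one (σ := -c) hc1 (StripGrowth.const 1)
      (fun _ _ _ => differentiableAt_const _)
    simpa using this
  have hH : Continuous fun t : ℝ => gammaTransform F (-((-c : ℝ) + t * I)) := by
    refine ((continuous_gammaTransform hc0 hw).comp continuous_neg).congr fun t => ?_
    simp only [Function.comp]
    congr 1
    push_cast
    ring
  obtain ⟨C₁, hC₁, hb₁⟩ := exists_norm_gammaTransform_le F hc0 hw
  obtain ⟨C₂, hC₂, hb₂⟩ := (((StripGrowth.const 2).mul_zero_left (stripGrowth_Gamma_two_mul_add_one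
    (α := -c) (β := σ) (by linarith))).mul_zero_right hg).exp_decay (δ := 2)
      (by linarith [Real.pi_gt_three])
  obtain ⟨C₃, hC₃, hb₃⟩ := ((StripGrowth.const 2).mul_zero_left (stripGrowth_Gamma_two_mul_add_one
    (α := -c) (β := σ) (by linarith))).exp_decay (δ := 2)
      (by linarith [Real.pi_gt_three])
  -- The goal is d = 0: d is the difference of the two symbols times 2Γ(2s+1) on Re s = -c. Since
  -- Γ(2s+1) decays like e^{-π|t|} up to powers and π > 2, d has the decay that the uniqueness
  -- theorem asks for.
  set d : ℝ → ℂ := fun t => 2 * Gamma (2 * ((-c : ℝ) + t * I) + 1) *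
    (gammaTransform F (-((-c : ℝ) + t * I)) - Real.pi ^ 2 * h ((-c : ℝ) + t * I)) with hdd
  have hk0 : Continuous fun t : ℝ => 2 * Gamma (2 * ((-c : ℝ) + t * I) + 1) :=
    continuous_vline (Φ := fun s => 2 * Gamma (2 * s + 1)) fun s hs => hexp0.2 s hs.ge hs.le
  have hk1 : Continuous fun t : ℝ => h ((-c : ℝ) + t * I) :=
    continuous_vline fun s hs => hd s hs.ge (by linarith)
  have hdc : Continuous d := hk0.mul (hH.sub (continuous_const.mul hk1))
  have hdb : ∀ t, ‖d t‖ ≤ (C₃ * C₁ + Real.pi ^ 2 * C₂) * Real.exp (-2 * |t|) := by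
    intro t
    have e1 : gammaTransform F (-((-c : ℝ) + t * I)) = gammaTransform F (c + (-t : ℝ) * I) := by
      congr 1; push_cast; ring
    have h1 := hb₁ (-t)
    rw [abs_neg] at h1
    have h2 := hb₂ ((-c : ℝ) + t * I) (by simp) (by simp; linarith)
    have h3 := hb₃ ((-c : ℝ) + t * I) (by simp) (by simp; linarith)
    rw [vline_im] at h2 h3
    have hle : Real.exp (-2 * |t|) ≤ 1 := Real.exp_le_one_iff.2 (by linarith [abs_nonneg t])
    have e2 : d t = 2 * Gamma (2 * ((-c : ℝ) + t * I) + 1) * gammaTransform F (c + (-t : ℝ) * I) -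
        Real.pi ^ 2 * (2 * Gamma (2 * ((-c : ℝ) + t * I) + 1) * h ((-c : ℝ) + t * I)) := by
      rw [hdd, ← e1]; ring
    rw [e2]
    refine (norm_sub_le _ _).trans ?_
    rw [norm_mul (2 * Gamma _), norm_mul ((Real.pi : ℂ) ^ 2), add_mul]
    refine add_le_add ?_ ?_
    · calc _ ≤ C₃ * Real.exp (-2 * |t|) * (C₁ * Real.exp (-2 * |t|)) := by gcongr
        _ ≤ C₃ * Real.exp (-2 * |t|) * (C₁ * 1) := by gcongr
        _ = _ := by ring
    · rw [norm_pow, norm_real, Real.norm_of_nonneg Real.pi_pos.le, mul_assoc (Real.pi ^ 2)]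
      gcongr
  have hI0 : Integrable fun t : ℝ => d t := by
    simpa using integrable_mul_exp_neg hdc hdb (z := 0) (by simp)
  -- Both symbols lead to the same sine transform, up to π², and tanh v ≠ 0 can be divided out.
  have hzero : ∀ v : ℝ, v ≠ 0 → ∫ t : ℝ, d t * cexp (-(I * t * logCosh v)) = 0 := by
    intro v hv
    have h1 := tanh_mul_barnes_eq hσ hc0 hc1 hg hd hF hw v
    have h2 := tanh_mul_barnes_gammaTransform hc0 hc1 hw v
    have hT : ((Real.sinh v / Real.cosh v : ℝ) : ℂ) ≠ 0 :=
      ofReal_ne_zero.2 (div_ne_zero (Real.sinh_ne_zero.2 hv) (Real.cosh_pos v).ne')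
    have h3 : barnes (-c) (fun s => 2 * Gamma (2 * s + 1) * gammaTransform F (-s)) (logCosh v) -
        Real.pi ^ 2 * barnes (-c) (fun s => 2 * Gamma (2 * s + 1) * h s) (logCosh v) = 0 := by
      refine (mul_eq_zero.1 ?_).resolve_left hT
      linear_combination h2 - (Real.pi : ℂ) ^ 2 * h1
    rw [barnes, barnes, vint, vint, ← integral_const_mul, ← integral_sub] at h3
    · have e : ∀ t : ℝ, d t * cexp (-(I * t * logCosh v)) = cexp (-c * logCosh v) *
          (2 * Gamma (2 * ((-c : ℝ) + t * I) + 1) * gammaTransform F (-((-c : ℝ) + t * I)) *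
            cexp (-((-c : ℝ) + t * I) * logCosh v) - Real.pi ^ 2 *
          (2 * Gamma (2 * ((-c : ℝ) + t * I) + 1) * h ((-c : ℝ) + t * I) *
            cexp (-((-c : ℝ) + t * I) * logCosh v))) := by
        intro t
        have e' : cexp (-(I * t * logCosh v)) = cexp (-c * logCosh v) *
            cexp (-((-c : ℝ) + t * I) * logCosh v) := by
          rw [← Complex.exp_add]; congr 1; push_cast; ring
        rw [e', hdd]
        ring
      simp_rw [e]
      rw [integral_const_mul, h3, mul_zero]
    · have : Integrable fun t : ℝ => d t * cexp (-((-c : ℝ) + t * I) * logCosh v) := by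
        refine hI0.mul_bdd (c := Real.exp (-(-c) * logCosh v)) ?_ (Eventually.of_forall fun t => ?_)
        · exact (by fun_prop : Continuous _).aestronglyMeasurable
        · exact (norm_cexp_vline _ _ _).le
      refine (this.add ((hexp1.mono le_rfl (by linarith)).integrable_barnes (logCosh v)
        |>.const_mul ((Real.pi : ℂ) ^ 2))).congr (Eventually.of_forall fun t => ?_)
      simp only [Pi.add_apply, hdd]
      ring
    · exact ((hexp1.mono le_rfl (by linarith)).integrable_barnes (logCosh v)).const_mul _
  -- The values `logCosh v` fill only a half-line. A single accumulation point is enough, and at v =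
  -- 1 the derivative of `logCosh` is nonzero.
  have hfreq : ∃ᶠ x : ℝ in 𝓝[≠] (logCosh 1), ∫ t : ℝ, d t * cexp (-(I * t * x)) = 0 := by
    have h1 : Tendsto logCosh (𝓝[≠] 1) (𝓝[≠] (logCosh 1)) :=
      (hasDerivAt_logCosh 1).tendsto_nhdsNE (mul_ne_zero two_ne_zero
        (div_ne_zero (Real.sinh_ne_zero.2 one_ne_zero) (Real.cosh_pos 1).ne'))
    refine h1.frequently (Eventually.frequently ?_)
    have : ∀ᶠ v : ℝ in 𝓝[≠] 1, v ≠ 0 :=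
      nhdsWithin_le_nhds (eventually_ne_nhds one_ne_zero)
    exact this.mono hzero
  -- The parameter t = -Im s corresponds to the point -s of the line Re = -c.
  have h1 := eq_zero_of_frequently_integral_mul_exp_eq_zero hdc hdb hfreq (-s.im)
  have e : ((-c : ℝ) : ℂ) + (-s.im : ℝ) * I = -s := by
    apply Complex.ext <;> simp [hs]
  simp only [hdd] at h1
  rw [e, neg_neg] at h1
  have hne : (2 : ℂ) * Gamma (2 * -s + 1) ≠ 0 :=
    mul_ne_zero two_ne_zero (Gamma_ne_zero_of_re_pos (by simp [hs]; linarith))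
  exact sub_eq_zero.1 ((mul_eq_zero.1 h1).resolve_left hne)

end Inversion

/-! ### Bounds for the squared kernel and the Mellin form of the index transform -/

section Kernel

variable {μ : ℂ} {σ : ℝ} {f : ℝ → ℂ}

/-- The square of a Mellin–Barnes integral on Re s = σ/2 is available for every real τ, including τ
= 0. It yields continuity and the bound y^{1/2-σ}, hence absolute convergence of the inner integral
for each τ. -/
lemma exists_kernelPP_eq (h0 : 0 < σ) (h1 : σ < 1 / 2 - μ.re) (τ : ℝ) : ∃ k : ℂ, ∀ ξ : ℝ,
    kernelPP μ τ (Real.exp ξ) =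
      k * cexp (ξ / 2) * barnes (σ / 2) (barnesP (1 / 2 - μ) τ) ξ ^ 2 := by
  set b : ℂ := 1 / 2 - μ with hb
  have hbre : b.re = 1 / 2 - μ.re := by simp [hb]
  set K : ℂ := 2 * Real.pi * (Gamma (b / 2 + I * τ / 2) * Gamma (b / 2 + -(I * τ / 2)) *
    (Gamma (b + 1 / 2))⁻¹) with hK
  have hK0 : K ≠ 0 := by
    have hpi : (Real.pi : ℂ) ≠ 0 := ofReal_ne_zero.2 Real.pi_ne_zero
    refine mul_ne_zero (mul_ne_zero two_ne_zero hpi) (mul_ne_zero (mul_ne_zero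
      (Gamma_ne_zero_of_re_pos ?_) (Gamma_ne_zero_of_re_pos ?_))
      (inv_ne_zero (Gamma_ne_zero_of_re_pos ?_)))
    · simp [hbre]; linarith
    · simp [hbre]; linarith
    · rw [add_re, hbre]; norm_num; linarith
  refine ⟨((2 : ℂ) ^ μ / Gamma (1 - μ) * K⁻¹) ^ 2, fun ξ => ?_⟩
  have h2 := barnesP_eq (b := b) (σ := σ / 2) (by linarith) (by rw [hbre]; linarith) τ ξ
  rw [barnesD_zero, ← hK] at h2
  rw [kernelPP, legendreP_arg_exp, h2, show (ξ / 2 : ℂ) = ξ / 4 + ξ / 4 by ring, Complex.exp_add, ← hb]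
  generalize solP b τ ξ = S
  field_simp

lemma exists_norm_kernelPP_le (h0 : 0 < σ) (h1 : σ < 1 / 2 - μ.re) (τ : ℝ) : ∃ C : ℝ, ∀ y : ℝ,
    0 < y → ‖kernelPP μ τ y‖ ≤ C * Real.exp ((1 / 2 - σ) * Real.log y) := by
  obtain ⟨k, hk⟩ := exists_kernelPP_eq h0 h1 τ
  obtain ⟨C, hC, hb⟩ := exists_norm_barnes_le (σ / 2) (barnesP (1 / 2 - μ) τ)
  refine ⟨‖k‖ * C ^ 2, fun y hy => ?_⟩
  have h2 := hk (Real.log y)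
  rw [Real.exp_log hy] at h2
  have e : ‖cexp ((Real.log y : ℝ) / 2)‖ = Real.exp (Real.log y / 2) := by
    rw [Complex.norm_exp]; norm_num
  rw [h2, norm_mul, norm_mul, norm_pow, e]
  calc _ ≤ ‖k‖ * Real.exp (Real.log y / 2) * (C * Real.exp (-(σ / 2) * Real.log y)) ^ 2 := by
        gcongr
        exact hb _
    _ = ‖k‖ * C ^ 2 * (Real.exp (Real.log y / 2) * (Real.exp (-(σ / 2) * Real.log y) *
          Real.exp (-(σ / 2) * Real.log y))) := by ring
    _ = _ := by
        rw [← Real.exp_add, ← Real.exp_add]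
        ring_nf

lemma continuousOn_kernelPP (hμ : μ.re < 1 / 2) (τ : ℝ) : ContinuousOn (kernelPP μ τ) (Ioi 0) := by
  obtain ⟨k, hk⟩ := exists_kernelPP_eq (μ := μ) (σ := (1 / 2 - μ.re) / 2) (by linarith)
    (by linarith) τ
  have hE : StripExp (barnesP (1 / 2 - μ) τ) ((1 / 2 - μ.re) / 2 / 2) ((1 / 2 - μ.re) / 2 / 2) :=
    stripExp_barnesP (by linarith) (by simp; linarith)
  have hc : Continuous (barnes ((1 / 2 - μ.re) / 2 / 2) (barnesP (1 / 2 - μ) τ)) :=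
    continuous_iff_continuousAt.2 fun ξ => (hE.hasDerivAt_barnes ξ).continuousAt
  have hlog : ContinuousOn Real.log (Ioi 0) := Real.continuousOn_log.mono fun y hy => ne_of_gt hy
  have h2 : ContinuousOn (fun y => k * cexp ((Real.log y : ℝ) / 2) *
      barnes ((1 / 2 - μ.re) / 2 / 2) (barnesP (1 / 2 - μ) τ) (Real.log y) ^ 2) (Ioi 0) :=
    (by fun_prop : Continuous fun ξ : ℝ => k * cexp (ξ / 2) *
      barnes ((1 / 2 - μ.re) / 2 / 2) (barnesP (1 / 2 - μ) τ) ξ ^ 2).comp_continuousOn hlog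
  refine h2.congr fun y hy => ?_
  simp only
  rw [← hk, Real.exp_log hy]

lemma integrableOn_kernelPP_mul (h0 : 0 < σ) (h1 : σ < 1 / 2 - μ.re)
    (hm : AEStronglyMeasurable f (volume.restrict (Ioi 0)))
    (hi : IntegrableOn (fun y => Real.exp ((1 / 2 - σ) * Real.log y) * ‖f y‖) (Ioi 0)) (τ : ℝ) :
    IntegrableOn (fun y => kernelPP μ τ y * f y) (Ioi 0) := by
  obtain ⟨C, hC⟩ := exists_norm_kernelPP_le h0 h1 τ
  refine (hi.const_mul C).mono' (((continuousOn_kernelPP (by linarith) τ).aestronglyMeasurable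
    measurableSet_Ioi).mul hm) ?_
  refine (ae_restrict_iff' measurableSet_Ioi).2 (Eventually.of_forall fun y hy => ?_)
  rw [norm_mul, ← mul_assoc]
  exact mul_le_mul_of_nonneg_right (hC y hy) (norm_nonneg _)

/-- Parseval's equality for a Mellin–Barnes integral. -/
lemma integral_barnes_mul {Φ : ℂ → ℂ} (hΦ : StripExp Φ σ σ)
    (hm : AEStronglyMeasurable f (volume.restrict (Ioi 0)))
    (hi : IntegrableOn (fun y => Real.exp ((1 / 2 - σ) * Real.log y) * ‖f y‖) (Ioi 0)) :
    ∫ y in Ioi (0 : ℝ), cexp ((Real.log y : ℝ) / 2) * barnes σ Φ (Real.log y) * f y =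
      vint σ fun s => Φ s * mellin f (3 / 2 - s) := by
  have hΦc : Continuous fun t : ℝ => Φ (σ + t * I) :=
    continuous_vline fun s hs => hΦ.2 s hs.ge hs.le
  have hΦi : Integrable fun t : ℝ => Φ (σ + t * I) := hΦ.stripDecay.integrable le_rfl le_rfl
  have hprod : Integrable (Function.uncurry fun (y t : ℝ) =>
      Φ (σ + t * I) * (cexp ((1 / 2 - (σ + t * I)) * (Real.log y : ℝ)) * f y))
      ((volume.restrict (Ioi 0)).prod volume) := by
    refine (hi.mul_prod hΦi.norm).mono' ?_ (Eventually.of_forall ?_)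
    · refine (hΦc.comp continuous_snd).aestronglyMeasurable.mul
        (AEStronglyMeasurable.mul ?_ hm.comp_fst)
      have : Measurable fun z : ℝ × ℝ => cexp ((1 / 2 - (σ + z.2 * I)) * (Real.log z.1 : ℝ)) := by
        have := Real.measurable_log
        fun_prop
      exact this.aestronglyMeasurable
    · rintro ⟨y, t⟩
      simp only [Function.uncurry]
      have e : ‖cexp ((1 / 2 - (σ + t * I)) * (Real.log y : ℝ))‖ =
          Real.exp ((1 / 2 - σ) * Real.log y) := by
        rw [Complex.norm_exp]
        congr 1
        rw [re_mul_ofReal]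
        simp
      rw [norm_mul, norm_mul, e, mul_comm]
  have e1 : ∀ y : ℝ, cexp ((Real.log y : ℝ) / 2) * barnes σ Φ (Real.log y) * f y =
      ∫ t : ℝ, Φ (σ + t * I) * (cexp ((1 / 2 - (σ + t * I)) * (Real.log y : ℝ)) * f y) := by
    intro y
    rw [barnes, vint, ← integral_const_mul, ← integral_mul_const]
    refine integral_congr_ae (Eventually.of_forall fun t => ?_)
    simp only
    rw [show (1 / 2 - (σ + t * I)) * ((Real.log y : ℝ) : ℂ) =
      (Real.log y : ℝ) / 2 + -(σ + t * I) * (Real.log y : ℝ) by ring, Complex.exp_add]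
    ring
  simp_rw [e1]
  rw [integral_integral_swap hprod, vint]
  refine integral_congr_ae (Eventually.of_forall fun t => ?_)
  simp only
  rw [integral_const_mul, mellin]
  congr 1
  refine setIntegral_congr_fun measurableSet_Ioi fun y hy => ?_
  simp only [smul_eq_mul]
  rw [ofReal_cpow_eq_exp hy]
  congr 3
  ring

/-- The kernel is replaced by its Mellin–Barnes integral and Parseval's equality is applied; the
value τ = 0, where poles collide, is left out. -/
lemma indexTransform_eq_vint (h0 : 0 < σ) (h1 : σ < 1 / 2 - μ.re)
    (hm : AEStronglyMeasurable f (volume.restrict (Ioi 0)))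
    (hi : IntegrableOn (fun y => Real.exp ((1 / 2 - σ) * Real.log y) * ‖f y‖) (Ioi 0)) {τ : ℝ}
    (hτ : τ ≠ 0) : indexTransform μ f τ = (2 * Real.pi : ℂ)⁻¹ *
      vint σ fun s => barnesPP (1 / 2 - μ) τ s * mellin f (3 / 2 - s) := by
  have hE : StripExp (barnesPP (1 / 2 - μ) τ) σ σ := stripExp_barnesPP h0 (by simpa using h1)
  rw [← integral_barnes_mul hE hm hi, indexTransform, ← integral_const_mul, ← integral_const_mul]
  refine setIntegral_congr_fun measurableSet_Ioi fun y hy => ?_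
  have h2 := sqrt_pi_mul_gammaProd_mul_kernelPP (μ := μ) hτ h0 h1 (Real.log y)
  rw [Real.exp_log hy] at h2
  have hpi : (2 * Real.pi : ℂ) ≠ 0 := mul_ne_zero two_ne_zero (ofReal_ne_zero.2 Real.pi_ne_zero)
  rw [← h2, mul_assoc (2 * Real.pi : ℂ), inv_mul_cancel_left₀ hpi]
  ring

lemma norm_mellin_le (s : ℂ) :
    ‖mellin f (3 / 2 - s)‖ ≤ ∫ y in Ioi (0 : ℝ), Real.exp ((1 / 2 - s.re) * Real.log y) * ‖f y‖ := by
  refine (norm_integral_le_integral_norm _).trans (le_of_eq ?_)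
  refine setIntegral_congr_fun measurableSet_Ioi fun y hy => ?_
  simp only [smul_eq_mul]
  rw [norm_mul, ofReal_cpow_eq_exp hy, Complex.norm_exp]
  congr 2
  rw [re_mul_ofReal]
  congr 1
  simp
  norm_num
  ring

end Kernel

/-! ### Mellin transforms between two weights -/

section Interp

variable {f : ℝ → ℂ} {α β σ : ℝ}

/-- An intermediate power of y is at most the left endpoint power for y ≥ 1 and the right one for y
≤ 1. -/
lemma exp_mul_log_le (h1 : α ≤ σ) (h2 : σ ≤ β) (y : ℝ) :
    Real.exp ((1 / 2 - σ) * Real.log y) ≤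
      Real.exp ((1 / 2 - α) * Real.log y) + Real.exp ((1 / 2 - β) * Real.log y) := by
  rcases le_total 0 (Real.log y) with h | h
  · refine le_add_of_le_of_nonneg (Real.exp_le_exp.2 ?_) (Real.exp_pos _).le
    nlinarith
  · refine le_add_of_nonneg_of_le (Real.exp_pos _).le (Real.exp_le_exp.2 ?_)
    nlinarith

lemma integrableOn_exp_mul_norm (hm : AEStronglyMeasurable f (volume.restrict (Ioi 0)))
    (hα : IntegrableOn (fun y => Real.exp ((1 / 2 - α) * Real.log y) * ‖f y‖) (Ioi 0))
    (hβ : IntegrableOn (fun y => Real.exp ((1 / 2 - β) * Real.log y) * ‖f y‖) (Ioi 0))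
    (h1 : α ≤ σ) (h2 : σ ≤ β) :
    IntegrableOn (fun y => Real.exp ((1 / 2 - σ) * Real.log y) * ‖f y‖) (Ioi 0) := by
  refine (hα.add hβ).mono' ((by have := Real.measurable_log; fun_prop : Measurable fun y =>
    Real.exp ((1 / 2 - σ) * Real.log y)).aestronglyMeasurable.mul hm.norm)
    (Eventually.of_forall fun y => ?_)
  rw [Real.norm_of_nonneg (by positivity), Pi.add_apply, ← add_mul]
  exact mul_le_mul_of_nonneg_right (exp_mul_log_le h1 h2 y) (norm_nonneg _)

lemma norm_mellin_le_add (hα : IntegrableOn (fun y => Real.exp ((1 / 2 - α) * Real.log y) * ‖f y‖) (Ioi 0))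
    (hβ : IntegrableOn (fun y => Real.exp ((1 / 2 - β) * Real.log y) * ‖f y‖) (Ioi 0)) {s : ℂ}
    (h1 : α ≤ s.re) (h2 : s.re ≤ β) : ‖mellin f (3 / 2 - s)‖ ≤
      (∫ y in Ioi (0 : ℝ), Real.exp ((1 / 2 - α) * Real.log y) * ‖f y‖) +
      ∫ y in Ioi (0 : ℝ), Real.exp ((1 / 2 - β) * Real.log y) * ‖f y‖ := by
  refine (norm_mellin_le s).trans ?_
  rw [← integral_add hα hβ]
  refine integral_mono_of_nonneg (Eventually.of_forall fun y => by positivity) (hα.add hβ)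
    (Eventually.of_forall fun y => ?_)
  simp only [← add_mul]
  exact mul_le_mul_of_nonneg_right (exp_mul_log_le h1 h2 y) (norm_nonneg _)

/-- A holomorphic continuation of `f*(3/2-s)/s` is bounded in closed substrips. -/
lemma stripGrowth_of_eq_mellin_div
    (hα : IntegrableOn (fun y => Real.exp ((1 / 2 - α) * Real.log y) * ‖f y‖) (Ioi 0))
    (hβ : IntegrableOn (fun y => Real.exp ((1 / 2 - β) * Real.log y) * ‖f y‖) (Ioi 0))
    {G : ℂ → ℂ} (hG : DifferentiableOn ℂ G {s : ℂ | α < s.re ∧ s.re < β})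
    (hGe : ∀ s : ℂ, α < s.re → s.re < β → s ≠ 0 → G s = mellin f (3 / 2 - s) / s) {a b : ℝ}
    (ha : α < a) (hb : b < β) : StripGrowth 0 G a b := by
  have hcomp : IsCompact (Icc a b ×ℂ Icc (-1) 1) := isCompact_Icc.reProdIm isCompact_Icc
  obtain ⟨D, hD⟩ := hcomp.exists_bound_of_continuousOn (f := G) fun s hs =>
    (hG.continuousOn.mono fun s (hs : s ∈ Icc a b ×ℂ Icc (-1) 1) =>
      ⟨ha.trans_le hs.1.1, hs.1.2.trans_lt hb⟩) s hs
  set B := (∫ y in Ioi (0 : ℝ), Real.exp ((1 / 2 - α) * Real.log y) * ‖f y‖) +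
    ∫ y in Ioi (0 : ℝ), Real.exp ((1 / 2 - β) * Real.log y) * ‖f y‖ with hB
  refine StripGrowth.of_bounded (max D B) fun s h1 h2 => ?_
  -- Near the removable point 0 compactness gives the bound; for |Im s| > 1, division by s only
  -- makes the bounded Mellin transform smaller.
  by_cases hs : |s.im| ≤ 1
  · exact (hD s ⟨⟨h1, h2⟩, abs_le.1 hs⟩).trans (le_max_left _ _)
  · rw [not_le] at hs
    have hn : 1 ≤ ‖s‖ := hs.le.trans (abs_im_le_norm s)
    rw [hGe s (by linarith) (by linarith) (norm_pos_iff.1 (by linarith)), norm_div]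
    exact (div_le_self (norm_nonneg _) hn).trans
      ((norm_mellin_le_add hα hβ (by linarith) (by linarith)).trans (le_max_right _ _))

end Interp

/-! ### The Mellin transform and the derivative of x ↦ ∫_x^∞ u -/

section Antiderivative

variable {u : ℝ → ℂ} {c : ℝ}

lemma integrableOn_Ioo_cpow {s : ℂ} (hs : 0 < s.re) (y : ℝ) :
    IntegrableOn (fun x : ℝ => (x : ℂ) ^ (s - 1)) (Ioo 0 y) := by
  rcases le_or_gt y 0 with hy | hy
  · simp [Ioo_eq_empty_of_le hy]
  · exact ((intervalIntegrable_iff_integrableOn_Ioc_of_le hy.le).1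
      (intervalIntegral.intervalIntegrable_cpow' (by simpa))).mono_set Ioo_subset_Ioc_self

lemma integral_Ioo_cpow {s : ℂ} (hs : 0 < s.re) {y : ℝ} (hy : 0 < y) :
    ∫ x in Ioo 0 y, (x : ℂ) ^ (s - 1) = (y : ℂ) ^ s / s := by
  have hs0 : s ≠ 0 := ne_zero_of_re_ne hs.ne'
  rw [← integral_Ioc_eq_integral_Ioo, ← intervalIntegral.integral_of_le hy.le,
    integral_cpow (Or.inl (by simpa)), sub_add_cancel, ofReal_zero, zero_cpow hs0, sub_zero]

lemma integral_Ioo_norm_cpow {s : ℂ} (hs : 0 < s.re) {y : ℝ} (hy : 0 < y) :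
    ∫ x in Ioo 0 y, ‖(x : ℂ) ^ (s - 1)‖ = y ^ s.re / s.re := by
  have e : ∫ x in Ioo 0 y, ‖(x : ℂ) ^ (s - 1)‖ = ∫ x in Ioo 0 y, x ^ (s.re - 1) := by
    refine setIntegral_congr_fun measurableSet_Ioo fun x hx => ?_
    rw [norm_cpow_eq_rpow_re_of_pos hx.1]
    simp
  rw [e, ← integral_Ioc_eq_integral_Ioo, ← intervalIntegral.integral_of_le hy.le,
    integral_rpow (Or.inl (by linarith)), sub_add_cancel, Real.zero_rpow hs.ne', sub_zero]

/-- Tonelli with the x-integral first: over (0,y) it equals y^{Re s}/Re s, which needs Re s > 0. -/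
lemma integrable_indicator_cpow_mul (hm : AEStronglyMeasurable u (volume.restrict (Ioi 0)))
    {s : ℂ} (hs : 0 < s.re) (hi : IntegrableOn (fun y => y ^ s.re * ‖u y‖) (Ioi 0)) :
    Integrable (Function.uncurry fun (x y : ℝ) =>
      (Iio y).indicator (fun x : ℝ => (x : ℂ) ^ (s - 1)) x * u y)
      ((volume.restrict (Ioi 0)).prod (volume.restrict (Ioi 0))) := by
  have hmeas : AEStronglyMeasurable (Function.uncurry fun (x y : ℝ) =>
      (Iio y).indicator (fun x : ℝ => (x : ℂ) ^ (s - 1)) x * u y)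
      ((volume.restrict (Ioi 0)).prod (volume.restrict (Ioi 0))) := by
    have h1 : Measurable ({z : ℝ × ℝ | z.1 < z.2}.indicator
        fun z : ℝ × ℝ => (z.1 : ℂ) ^ (s - 1)) :=
      Measurable.indicator (by fun_prop) (measurableSet_lt measurable_fst measurable_snd)
    refine (h1.aestronglyMeasurable.mul hm.comp_snd).congr (Eventually.of_forall ?_)
    rintro ⟨x, y⟩
    simp [indicator, Function.uncurry]
  have hpos : ∀ᵐ y ∂(volume.restrict (Ioi (0 : ℝ))), 0 < y :=
    (ae_restrict_iff' measurableSet_Ioi).2 (Eventually.of_forall fun y hy => hy)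
  rw [integrable_prod_iff' hmeas]
  constructor
  · refine hpos.mono fun y hy => ?_
    refine Integrable.mul_const (f := fun x : ℝ =>
      (Iio y).indicator (fun x : ℝ => (x : ℂ) ^ (s - 1)) x) ?_ (u y)
    refine (integrable_indicator_iff measurableSet_Iio).2 ?_
    rw [IntegrableOn, Measure.restrict_restrict measurableSet_Iio, Iio_inter_Ioi]
    exact integrableOn_Ioo_cpow hs y
  · refine (hi.const_mul s.re⁻¹).congr (hpos.mono fun y hy => ?_)
    simp only [Function.uncurry, norm_mul]
    rw [integral_mul_const]
    simp_rw [norm_indicator_eq_indicator_norm]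
    rw [setIntegral_indicator measurableSet_Iio, Ioi_inter_Iio, integral_Ioo_norm_cpow hs hy]
    ring

lemma integral_Ioi_indicator_cpow_mul {s : ℂ} {x : ℝ} (hx : 0 < x) :
    ∫ y in Ioi (0 : ℝ), (Iio y).indicator (fun x : ℝ => (x : ℂ) ^ (s - 1)) x * u y =
      (x : ℂ) ^ (s - 1) * ∫ y in Ioi x, u y := by
  have e : ∀ y, (Iio y).indicator (fun x : ℝ => (x : ℂ) ^ (s - 1)) x * u y =
      (x : ℂ) ^ (s - 1) * (Ioi x).indicator u y := by
    intro y
    by_cases h : x < y <;> simp [indicator, h]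
  simp_rw [e]
  rw [integral_const_mul, setIntegral_indicator measurableSet_Ioi, Ioi_inter_Ioi,
    max_eq_right hx.le]

/-- The Mellin transform of `x ↦ ∫_x^∞ u`. -/
lemma hasMellin_integral_Ioi (hm : AEStronglyMeasurable u (volume.restrict (Ioi 0)))
    {s : ℂ} (hs : 0 < s.re) (hi : IntegrableOn (fun y => y ^ s.re * ‖u y‖) (Ioi 0)) :
    HasMellin (fun x => ∫ y in Ioi x, u y) s (mellin u (s + 1) / s) := by
  have hprod := integrable_indicator_cpow_mul hm hs hi
  constructor
  · refine IntegrableOn.congr_fun (f := fun x : ℝ => ∫ y in Ioi (0 : ℝ),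
      (Iio y).indicator (fun x : ℝ => (x : ℂ) ^ (s - 1)) x * u y) hprod.integral_prod_left
      (fun x hx => ?_) measurableSet_Ioi
    simp only [smul_eq_mul]
    rw [integral_Ioi_indicator_cpow_mul hx]
  · have e : mellin (fun x => ∫ y in Ioi x, u y) s = ∫ x in Ioi (0 : ℝ), ∫ y in Ioi (0 : ℝ),
        (Iio y).indicator (fun x : ℝ => (x : ℂ) ^ (s - 1)) x * u y := by
      refine setIntegral_congr_fun measurableSet_Ioi fun x hx => ?_
      simp only
      rw [smul_eq_mul, integral_Ioi_indicator_cpow_mul hx]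
    rw [e, integral_integral_swap hprod, mellin, ← integral_div]
    refine setIntegral_congr_fun measurableSet_Ioi fun y hy => ?_
    rw [integral_mul_const, setIntegral_indicator measurableSet_Iio, Ioi_inter_Iio,
      integral_Ioo_cpow hs hy, smul_eq_mul, add_sub_cancel_right]
    ring

/-- Extending u by 0 makes the integral the primitive of a function integrable on all of ℝ, to which
continuity and Lebesgue differentiation apply. -/
lemma integral_Ioi_eq_sub (hu : IntegrableOn u (Ioi 0)) {x : ℝ} (hx : 0 < x) :
    ∫ y in Ioi x, u y = (∫ y in Ioi 0, u y) - ∫ y in (0 : ℝ)..x, (Ioi 0).indicator u y := by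
  have h1 := intervalIntegral.integral_interval_add_Ioi hu (hu.mono_set (Ioi_subset_Ioi hx.le))
  have h2 : ∫ y in (0 : ℝ)..x, (Ioi 0).indicator u y = ∫ y in (0 : ℝ)..x, u y := by
    rw [intervalIntegral.integral_of_le hx.le, intervalIntegral.integral_of_le hx.le]
    refine setIntegral_congr_fun measurableSet_Ioc fun y hy => ?_
    exact indicator_of_mem (mem_Ioi.2 hy.1) u
  rw [h2, ← h1]
  ring

lemma continuousAt_integral_Ioi (hu : IntegrableOn u (Ioi 0)) {x : ℝ} (hx : 0 < x) :
    ContinuousAt (fun x => ∫ y in Ioi x, u y) x := by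
  have h0 : Integrable ((Ioi 0).indicator u) := (integrable_indicator_iff measurableSet_Ioi).2 hu
  have h1 : Continuous fun x => (∫ y in Ioi 0, u y) - ∫ y in (0 : ℝ)..x, (Ioi 0).indicator u y :=
    continuous_const.sub (intervalIntegral.continuous_primitive
      (fun a b => h0.intervalIntegrable) 0)
  refine h1.continuousAt.congr ?_
  filter_upwards [Ioi_mem_nhds hx] with z hz
  rw [integral_Ioi_eq_sub hu hz]

lemma ae_hasDerivAt_integral_Ioi (hu : IntegrableOn u (Ioi 0)) :
    ∀ᵐ x ∂(volume.restrict (Ioi (0 : ℝ))), HasDerivAt (fun x => ∫ y in Ioi x, u y) (-u x) x := by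
  have h0 : Integrable ((Ioi 0).indicator u) := (integrable_indicator_iff measurableSet_Ioi).2 hu
  rw [ae_restrict_iff' measurableSet_Ioi]
  filter_upwards [LocallyIntegrable.ae_hasDerivAt_integral h0.locallyIntegrable] with x hx hx0
  have h1 := (hx 0).const_sub (∫ y in Ioi 0, u y)
  rw [indicator_of_mem hx0] at h1
  refine h1.congr_of_eventuallyEq ?_
  filter_upwards [Ioi_mem_nhds hx0] with z hz
  rw [integral_Ioi_eq_sub hu hz]

end Antiderivative

/-! ### The kernel S_μ as a Mellin–Barnes integral -/

section KernelS

variable {μ : ℂ} {c σ x : ℝ}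

/-- Replacing s by s + 3/2 turns the integrand into `barnesPQ`. The bounds on c become 0 < Re s <
min(1/2, 1/2 - Re μ), a strip free of poles, so the abscissa does not matter. -/
lemma mul_kernelS_eq_barnes (hx : 0 < x) (h1 : 3 / 2 < c) (h2 : c < min 2 (2 - μ.re))
    (h0 : 0 < σ) (h3 : σ < 1 / 2 - μ.re) (h4 : σ < 1 / 2) (τ : ℝ) :
    ((x ^ (3 / 2 : ℝ) : ℝ) : ℂ) * kernelS μ c x τ =
      (2 * Real.pi : ℂ)⁻¹ * barnes σ (barnesPQ (1 / 2 - μ) τ) (Real.log x) := by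
  have hc2 := h2.trans_le (min_le_left _ _)
  have hcμ := h2.trans_le (min_le_right _ _)
  have e1 : barnes σ (barnesPQ (1 / 2 - μ) τ) (Real.log x) =
      barnes (c - 3 / 2) (barnesPQ (1 / 2 - μ) τ) (Real.log x) := by
    rw [← barnesD_zero, ← barnesD_zero]
    rcases le_total σ (c - 3 / 2) with h | h
    · exact barnesD_shift h (stripExp_barnesPQ h0 (by simp; linarith) (by linarith)) 0 _
    · exact (barnesD_shift h (stripExp_barnesPQ (by linarith) (by simpa using h3) h4) 0 _).symm
  rw [e1, kernelS, mellinInv, barnes, vint, real_smul]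
  rw [← mul_assoc, mul_comm ((x ^ (3 / 2 : ℝ) : ℝ) : ℂ), mul_assoc, ← integral_const_mul]
  congr 1
  · push_cast
    simp
  refine integral_congr_ae (Eventually.of_forall fun t => ?_)
  simp only [smul_eq_mul, barnesPQ]
  set w : ℂ := (c - 3 / 2 : ℝ) + t * I with hw
  have hcw : (c : ℂ) + t * I = w + 3 / 2 := by rw [hw]; push_cast; ring
  rw [hcw, ofReal_cpow_eq_exp hx, Real.rpow_def_of_pos hx, ofReal_exp, ← mul_assoc,
    ← Complex.exp_add]
  rw [show ((Real.log x * (3 / 2) : ℝ) : ℂ) + -(w + 3 / 2) * (Real.log x : ℝ) = -w * (Real.log x : ℝ) by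
    push_cast; ring]
  rw [show 2 - (w + 3 / 2) = 1 / 2 - w by ring, show 1 / 2 - w - μ = 1 / 2 - μ - w by ring,
    show w + 3 / 2 - 1 - μ = w + (1 / 2 - μ) by ring, show 5 / 2 - (w + 3 / 2) = 1 - w by ring,
    show w + 3 / 2 - 3 / 2 + I * (τ : ℂ) = w + I * τ by ring,
    show w + 3 / 2 - 3 / 2 - I * (τ : ℂ) = w + -(I * τ) by ring, div_eq_mul_inv, mul_inv]
  ring

end KernelS

/-- The factor of the Mellin transform of the squared kernel that does not depend on `τ`, times a
function `G`. -/
def symbolPP (b : ℂ) (G : ℂ → ℂ) (s : ℂ) : ℂ :=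
  Gamma (s + 1) * Gamma (b - s) * (Gamma (s + b))⁻¹ * (Gamma (s + 1 / 2))⁻¹ * G s

/-- The factor of `barnesPQ` that does not depend on `τ`. -/
def symbolPQ (b s : ℂ) : ℂ :=
  Gamma (1 / 2 - s) * Gamma (b - s) * (Gamma (s + b))⁻¹ * (Gamma (1 - s))⁻¹

/-! ### The τ-free factors of the two kernels -/

section Symbols

variable {b : ℂ} {G : ℂ → ℂ} {α β : ℝ}

/-- Two Gamma factors above and two below: the exponential rates cancel and polynomial growth
remains. -/
lemma stripGrowth_symbolPP (hα : -1 < α) (hβ : β < b.re) (hG : StripGrowth 0 G α β) :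
    StripGrowth 0 (symbolPP b G) α β := by
  have h1 := (((stripGrowth_Gamma_add 1 (a := α) (b := β) (by simp; linarith)).mul
    (stripGrowth_Gamma_sub b hβ)).mul (stripGrowth_Gamma_inv_add b)).mul
    (stripGrowth_Gamma_inv_add (1 / 2))
  have e : -(Real.pi / 2) + -(Real.pi / 2) + Real.pi / 2 + Real.pi / 2 = 0 := by ring
  rw [e] at h1
  exact h1.mul_zero_right hG

lemma differentiableAt_symbolPP {s : ℂ} (h1 : -1 < s.re) (h2 : s.re < b.re)
    (hG : DifferentiableAt ℂ G s) : DifferentiableAt ℂ (symbolPP b G) s :=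
  ((((differentiableAt_Gamma_add (by simp; linarith)).mul (differentiableAt_Gamma_sub h2)).mul
    (differentiable_Gamma_inv_add b s)).mul (differentiable_Gamma_inv_add (1 / 2) s)).mul hG

lemma stripGrowth_symbolPQ (hβ : β < b.re) (hβ' : β < 1 / 2) :
    StripGrowth 0 (symbolPQ b) α β := by
  have h1 := (((stripGrowth_Gamma_sub (1 / 2) (a := α) (b := β) (by norm_num; linarith)).mul
    (stripGrowth_Gamma_sub b hβ)).mul (stripGrowth_Gamma_inv_add b)).mul
    (stripGrowth_Gamma_inv_sub 1)
  have e : -(Real.pi / 2) + -(Real.pi / 2) + Real.pi / 2 + Real.pi / 2 = 0 := by ring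
  rw [e] at h1
  exact h1

lemma differentiableAt_symbolPQ {s : ℂ} (h1 : s.re < 1 / 2) (h2 : s.re < b.re) :
    DifferentiableAt ℂ (symbolPQ b) s :=
  (((differentiableAt_Gamma_sub (by norm_num; linarith)).mul (differentiableAt_Gamma_sub h2)).mul
    (differentiable_Gamma_inv_add b s)).mul (differentiable_Gamma_inv_sub 1 s)

lemma barnesPQ_eq_symbolPQ (b : ℂ) (τ : ℝ) (s : ℂ) :
    barnesPQ b τ s = symbolPQ b s * (Gamma (s + I * τ) * Gamma (s + -(I * τ))) := by
  rw [barnesPQ, symbolPQ]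
  ring

/-- The reflection s ↦ -s turns each Gamma factor of one symbol into the reciprocal of a factor of
the other. This cancellation makes P(Q+Q) the kernel inverse to P². -/
lemma symbolPQ_mul_symbolPP_neg {s : ℂ} (h0 : 0 < s.re) (h1 : s.re < b.re) (h2 : s.re < 1 / 2) :
    symbolPQ b s * symbolPP b G (-s) = G (-s) := by
  have g1 : Gamma (1 / 2 - s) ≠ 0 := Gamma_ne_zero_of_re_pos (by simp; linarith)
  have g2 : Gamma (b - s) ≠ 0 := Gamma_ne_zero_of_re_pos (by simp; linarith)
  have g3 : Gamma (s + b) ≠ 0 := Gamma_ne_zero_of_re_pos (by simp; linarith)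
  have g4 : Gamma (1 - s) ≠ 0 := Gamma_ne_zero_of_re_pos (by simp; linarith)
  rw [symbolPQ, symbolPP, show -s + 1 = 1 - s by ring, show b - -s = s + b by ring,
    show -s + b = b - s by ring, show -s + 1 / 2 = 1 / 2 - s by ring]
  generalize Gamma (1 / 2 - s) = A at *
  generalize Gamma (b - s) = B at *
  generalize Gamma (s + b) = C at *
  generalize Gamma (1 - s) = D at *
  field_simp

end Symbols

/-! ### Expansion of the antiderivative -/

section Main

variable {μ : ℂ} {γ σ₀ c : ℝ} {f : ℝ → ℂ} {G : ℂ → ℂ}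

/-- On Re s = σ₀/2 the Mellin form of F has symbol Γ(s)f*(3/2-s) = Γ(s+1)G(s) times the remaining
factors, that is `symbolPP`. It is holomorphic and polynomially bounded down to Re s = -c, as the
inversion theorem requires. -/
lemma gammaTransform_indexTransform (h0 : 0 < σ₀) (h1 : σ₀ < 1 / 2 - μ.re)
    (hm : AEStronglyMeasurable f (volume.restrict (Ioi 0)))
    (hα : IntegrableOn (fun y => Real.exp ((1 / 2 - γ) * Real.log y) * ‖f y‖) (Ioi 0))
    (hβ : IntegrableOn (fun y => Real.exp ((1 / 2 - σ₀) * Real.log y) * ‖f y‖) (Ioi 0))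
    (hG : DifferentiableOn ℂ G {s : ℂ | γ < s.re ∧ s.re < σ₀})
    (hGe : ∀ s : ℂ, γ < s.re → s.re < σ₀ → s ≠ 0 → G s = mellin f (3 / 2 - s) / s)
    (hw : Integrable fun τ : ℝ =>
      ((|τ| * Real.exp (2 * Real.pi * |τ|) : ℝ) : ℂ) * indexTransform μ f τ)
    (hc0 : 0 < c) (hc1 : c < 1 / 2) (hcγ : γ < -c) {s : ℂ} (hs : s.re = c) :
    gammaTransform (indexTransform μ f) s = Real.pi ^ 2 * symbolPP (1 / 2 - μ) G (-s) := by
  have hbre : (1 / 2 - μ).re = 1 / 2 - μ.re := by simp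
  have hopen : IsOpen {s : ℂ | γ < s.re ∧ s.re < σ₀} :=
    (isOpen_lt continuous_const continuous_re).inter (isOpen_lt continuous_re continuous_const)
  have hGd : ∀ s : ℂ, γ < s.re → s.re < σ₀ → DifferentiableAt ℂ G s := fun s h h' =>
    hG.differentiableAt (hopen.mem_nhds ⟨h, h'⟩)
  refine gammaTransform_eq (σ := σ₀ / 2) (by linarith) hc0 hc1
    (stripGrowth_symbolPP (by linarith) (by rw [hbre]; linarith)
      (stripGrowth_of_eq_mellin_div hα hβ hG hGe hcγ (by linarith)))
    (fun s h h' => differentiableAt_symbolPP (by linarith) (by rw [hbre]; linarith)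
      (hGd s (by linarith) (by linarith))) (fun τ hτ => ?_) hw hs
  rw [indexTransform_eq_vint (σ := σ₀ / 2) (by linarith) (by linarith) hm
    (integrableOn_exp_mul_norm hm hα hβ (by linarith) (by linarith)) hτ]
  congr 1
  refine vint_congr fun s hs => ?_
  have hs0 : s ≠ 0 := ne_zero_of_re_ne (by rw [hs]; linarith)
  rw [barnesPP, symbolPP, hGe s (by linarith) (by linarith) hs0, Gamma_add_one s hs0, add_zero]
  field_simp

/-- The polynomial growth of `symbolPQ` is absorbed by half of the decay e^{-2|t|} of the Gamma
product. -/
lemma integrable_symbolPQ_prod (F : ℝ → ℂ) (h0 : 0 < c) (h1 : c < 1 / 2 - μ.re) (h2 : c < 1 / 2)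
    (hw : Integrable fun τ : ℝ => ((|τ| * Real.exp (2 * Real.pi * |τ|) : ℝ) : ℂ) * F τ) (ξ : ℝ) :
    Integrable (Function.uncurry fun (t τ : ℝ) =>
      symbolPQ (1 / 2 - μ) (c + t * I) * cexp (-(c + t * I) * ξ) *
      (((τ * Real.sinh (2 * Real.pi * τ) : ℝ) : ℂ) * F τ *
        (Gamma (c + t * I + I * τ) * Gamma (c + t * I + -(I * τ)))))
      (volume.prod (volume.restrict (Ioi 0))) := by
  have hbre : (1 / 2 - μ).re = 1 / 2 - μ.re := by simp
  have hN : Continuous fun t : ℝ => symbolPQ (1 / 2 - μ) (c + t * I) * cexp (-(c + t * I) * ξ) :=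
    (continuous_vline fun s hs => differentiableAt_symbolPQ (by linarith)
      (by rw [hbre]; linarith)).mul (by fun_prop)
  refine integrable_gammaTransform_prod (N := fun t : ℝ => symbolPQ (1 / 2 - μ) (c + t * I) *
    cexp (-(c + t * I) * ξ)) h0 hN ?_ hw
  obtain ⟨C, K, hC, hb⟩ := stripGrowth_symbolPQ (b := 1 / 2 - μ) (α := c) (β := c)
    (by rw [hbre]; linarith) h2
  obtain ⟨D, hD, hD'⟩ := pow_mul_exp_neg_bounded K (r := -1) (by norm_num)
  refine ((integrable_exp_mul_abs (r := -1) (by norm_num)).const_mul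
    (C * Real.exp (-c * ξ) * D)).mono' (hN.mul (by fun_prop)).aestronglyMeasurable
    (Eventually.of_forall fun t => ?_)
  have h3 := hb (c + t * I) (by simp) (by simp)
  rw [vline_im, zero_mul, Real.exp_zero, mul_one] at h3
  have h4 := hD' |t| (abs_nonneg t)
  rw [norm_mul, norm_mul, norm_cexp_vline, norm_real, Real.norm_of_nonneg (Real.exp_pos _).le]
  calc _ ≤ C * (1 + |t|) ^ K * Real.exp (-c * ξ) * Real.exp (-2 * |t|) := by gcongr
    _ = C * Real.exp (-c * ξ) * ((1 + |t|) ^ K * Real.exp (-1 * |t|)) * Real.exp (-1 * |t|) := by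
        rw [show -2 * |t| = -1 * |t| + -1 * |t| by ring, Real.exp_add]
        ring
    _ ≤ _ := by gcongr

lemma integral_symbolPQ (F : ℝ → ℂ) (τ ξ : ℝ) :
    ∫ t : ℝ, symbolPQ (1 / 2 - μ) (c + t * I) * cexp (-(c + t * I) * ξ) *
      (((τ * Real.sinh (2 * Real.pi * τ) : ℝ) : ℂ) * F τ *
        (Gamma (c + t * I + I * τ) * Gamma (c + t * I + -(I * τ)))) =
      ((τ * Real.sinh (2 * Real.pi * τ) : ℝ) : ℂ) * F τ * barnes c (barnesPQ (1 / 2 - μ) τ) ξ := by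
  rw [barnes, vint, ← integral_const_mul]
  refine integral_congr_ae (Eventually.of_forall fun t => ?_)
  simp only
  rw [barnesPQ_eq_symbolPQ]
  ring

lemma integrableOn_mul_barnesPQ (F : ℝ → ℂ) (h0 : 0 < c) (h1 : c < 1 / 2 - μ.re) (h2 : c < 1 / 2)
    (hw : Integrable fun τ : ℝ => ((|τ| * Real.exp (2 * Real.pi * |τ|) : ℝ) : ℂ) * F τ) (ξ : ℝ) :
    IntegrableOn (fun τ : ℝ => ((τ * Real.sinh (2 * Real.pi * τ) : ℝ) : ℂ) * F τ *
      barnes c (barnesPQ (1 / 2 - μ) τ) ξ) (Ioi 0) := by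
  refine (integrable_symbolPQ_prod F h0 h1 h2 hw ξ).integral_prod_right.congr
    (Eventually.of_forall fun τ => ?_)
  simp only [Function.uncurry]
  rw [integral_symbolPQ]

lemma integral_mul_barnesPQ (F : ℝ → ℂ) (h0 : 0 < c) (h1 : c < 1 / 2 - μ.re) (h2 : c < 1 / 2)
    (hw : Integrable fun τ : ℝ => ((|τ| * Real.exp (2 * Real.pi * |τ|) : ℝ) : ℂ) * F τ) (ξ : ℝ) :
    ∫ τ in Ioi (0 : ℝ), ((τ * Real.sinh (2 * Real.pi * τ) : ℝ) : ℂ) * F τ *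
      barnes c (barnesPQ (1 / 2 - μ) τ) ξ =
      barnes c (fun s => symbolPQ (1 / 2 - μ) s * gammaTransform F s) ξ := by
  simp_rw [← integral_symbolPQ]
  rw [← integral_integral_swap (integrable_symbolPQ_prod F h0 h1 h2 hw ξ), barnes, vint]
  refine integral_congr_ae (Eventually.of_forall fun t => ?_)
  simp only
  rw [integral_const_mul, gammaTransform, mul_right_comm]

lemma norm_sqrt_mul (f : ℝ → ℂ) {y : ℝ} (hy : 0 < y) :
    ‖(Real.sqrt y : ℂ) * f y‖ = Real.exp (1 / 2 * Real.log y) * ‖f y‖ := by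
  rw [norm_mul, norm_real, Real.norm_of_nonneg (Real.sqrt_nonneg _), Real.sqrt_eq_rpow,
    Real.rpow_def_of_pos hy, mul_comm (Real.log y)]

lemma mellin_sqrt_mul (f : ℝ → ℂ) (s : ℂ) :
    mellin (fun y => (Real.sqrt y : ℂ) * f y) (s + 1) = mellin f (3 / 2 - -s) := by
  refine setIntegral_congr_fun measurableSet_Ioi fun y hy => ?_
  simp only [smul_eq_mul]
  rw [Real.sqrt_eq_rpow, Real.rpow_def_of_pos hy, ofReal_exp, ofReal_cpow_eq_exp hy,
    ofReal_cpow_eq_exp hy, ← mul_assoc, ← Complex.exp_add]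
  congr 2
  push_cast
  ring

lemma integrableOn_sqrt_mul (hγ : γ ≤ 0) (h0 : 0 ≤ σ₀)
    (hm : AEStronglyMeasurable f (volume.restrict (Ioi 0)))
    (hα : IntegrableOn (fun y => Real.exp ((1 / 2 - γ) * Real.log y) * ‖f y‖) (Ioi 0))
    (hβ : IntegrableOn (fun y => Real.exp ((1 / 2 - σ₀) * Real.log y) * ‖f y‖) (Ioi 0)) :
    IntegrableOn (fun y => (Real.sqrt y : ℂ) * f y) (Ioi 0) := by
  refine (integrableOn_exp_mul_norm hm hα hβ hγ h0).mono'
    ((by fun_prop : Continuous fun y : ℝ => (Real.sqrt y : ℂ)).aestronglyMeasurable.mul hm) ?_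
  refine (ae_restrict_iff' measurableSet_Ioi).2 (Eventually.of_forall fun y hy => ?_)
  rw [norm_sqrt_mul f hy, sub_zero]

/-- Mellin inversion of the antiderivative of `√y f(y)`. -/
lemma barnes_eq_integral_Ioi (hγ : γ < 0) (h0 : 0 < σ₀)
    (hm : AEStronglyMeasurable f (volume.restrict (Ioi 0)))
    (hα : IntegrableOn (fun y => Real.exp ((1 / 2 - γ) * Real.log y) * ‖f y‖) (Ioi 0))
    (hβ : IntegrableOn (fun y => Real.exp ((1 / 2 - σ₀) * Real.log y) * ‖f y‖) (Ioi 0))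
    (hG : DifferentiableOn ℂ G {s : ℂ | γ < s.re ∧ s.re < σ₀})
    (hGe : ∀ s : ℂ, γ < s.re → s.re < σ₀ → s ≠ 0 → G s = mellin f (3 / 2 - s) / s)
    (hc0 : 0 < c) (hcγ : γ < -c)
    (hline : VerticalIntegrable (fun s : ℂ =>
        (((1 + ‖s‖) ^ (1 - 2 * s.re) : ℝ) : ℂ) * (mellin f (3 / 2 - s) / s)) (-c))
    {x : ℝ} (hx : 0 < x) :
    barnes c (fun s => G (-s)) (Real.log x) =
      -(2 * Real.pi) * ∫ y in Ioi x, (Real.sqrt y : ℂ) * f y := by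
  have hu := integrableOn_sqrt_mul hγ.le h0.le hm hα hβ
  -- For u = √y f the transform is u*(s+1)/s = f*(3/2+s)/s, and this is -G(-s).
  have hmel : ∀ s : ℂ, s.re = c →
      HasMellin (fun x => ∫ y in Ioi x, (Real.sqrt y : ℂ) * f y) s (-G (-s)) := by
    intro s hs
    have h1 := hasMellin_integral_Ioi hu.aestronglyMeasurable (s := s) (by rw [hs]; exact hc0) (by
      refine (integrableOn_exp_mul_norm hm hα hβ hcγ.le (by linarith)).congr_fun (fun y hy => ?_)
        measurableSet_Ioi
      simp only
      rw [norm_sqrt_mul f hy, hs, Real.rpow_def_of_pos hy, ← mul_assoc, ← Real.exp_add]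
      congr 2
      ring)
    have hs0 : s ≠ 0 := ne_zero_of_re_ne (by rw [hs]; exact hc0.ne')
    rw [mellin_sqrt_mul] at h1
    rw [hGe (-s) (by simpa [hs]) (by simp [hs]; linarith) (neg_ne_zero.2 hs0), div_neg, neg_neg]
    exact h1
  have hGc : Continuous fun t : ℝ => G ((-c : ℝ) + t * I) := by
    refine continuous_vline fun s hs => hG.differentiableAt (IsOpen.mem_nhds ?_ ?_)
    · exact (isOpen_lt continuous_const continuous_re).inter
        (isOpen_lt continuous_re continuous_const)
    · exact ⟨by rw [hs]; exact hcγ, by rw [hs]; linarith⟩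
  -- On Re s = -c the weight has the positive exponent 1 + 2c, so it is at least 1 and weighted
  -- integrability implies plain integrability.
  have hGi : Integrable fun t : ℝ => G ((-c : ℝ) + t * I) := by
    refine hline.norm.mono' hGc.aestronglyMeasurable (Eventually.of_forall fun t => ?_)
    have hs0 : ((-c : ℝ) + t * I : ℂ) ≠ 0 := ne_zero_of_re_ne (by simp; linarith)
    simp only
    rw [← hGe _ (by simpa) (by simp; linarith) hs0, norm_mul, norm_real]
    refine le_mul_of_one_le_left (norm_nonneg _) ?_
    refine le_trans ?_ (le_abs_self _)
    exact Real.one_le_rpow (by linarith [norm_nonneg ((-c : ℝ) + t * I : ℂ)]) (by simp; linarith)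
  have h1 := mellinInv_mellin_eq c (fun x => ∫ y in Ioi x, (Real.sqrt y : ℂ) * f y) hx
    (hmel c (by simp)).1 (by
      refine (hGi.comp_neg.neg).congr (Eventually.of_forall fun t => ?_)
      simp only [Pi.neg_apply]
      rw [(hmel (c + t * I) (by simp)).2]
      congr 2
      push_cast
      ring) (continuousAt_integral_Ioi hu hx)
  rw [← h1, mellinInv, real_smul, barnes, vint]
  have e : ∀ t : ℝ, ((x : ℂ) ^ (-((c : ℂ) + t * I)) •
      mellin (fun x => ∫ y in Ioi x, (Real.sqrt y : ℂ) * f y) (c + t * I) : ℂ) =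
      -(G (-(c + t * I)) * cexp (-(c + t * I) * (Real.log x : ℝ))) := by
    intro t
    rw [(hmel (c + t * I) (by simp)).2, ofReal_cpow_eq_exp hx, smul_eq_mul]
    ring
  simp_rw [e]
  rw [integral_neg]
  have hpi : (Real.pi : ℂ) ≠ 0 := ofReal_ne_zero.2 Real.pi_ne_zero
  generalize (∫ t : ℝ, G (-(c + t * I)) * cexp (-(c + t * I) * (Real.log x : ℝ))) = S
  push_cast
  field_simp

/-- The constant is π² from the inversion theorem times -2π from the Mellin inversion of -G(-s). -/
lemma integral_mul_barnesPQ_indexTransform (hγ : γ < 0) (h0 : 0 < σ₀) (h1 : σ₀ < 1 / 2 - μ.re)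
    (hm : AEStronglyMeasurable f (volume.restrict (Ioi 0)))
    (hα : IntegrableOn (fun y => Real.exp ((1 / 2 - γ) * Real.log y) * ‖f y‖) (Ioi 0))
    (hβ : IntegrableOn (fun y => Real.exp ((1 / 2 - σ₀) * Real.log y) * ‖f y‖) (Ioi 0))
    (hG : DifferentiableOn ℂ G {s : ℂ | γ < s.re ∧ s.re < σ₀})
    (hGe : ∀ s : ℂ, γ < s.re → s.re < σ₀ → s ≠ 0 → G s = mellin f (3 / 2 - s) / s)
    (hw : Integrable fun τ : ℝ =>
      ((|τ| * Real.exp (2 * Real.pi * |τ|) : ℝ) : ℂ) * indexTransform μ f τ)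
    (hc0 : 0 < c) (hc1 : c < 1 / 2) (hcμ : c < 1 / 2 - μ.re) (hcγ : γ < -c)
    (hline : VerticalIntegrable (fun s : ℂ =>
        (((1 + ‖s‖) ^ (1 - 2 * s.re) : ℝ) : ℂ) * (mellin f (3 / 2 - s) / s)) (-c))
    {x : ℝ} (hx : 0 < x) :
    ∫ τ in Ioi (0 : ℝ), ((τ * Real.sinh (2 * Real.pi * τ) : ℝ) : ℂ) * indexTransform μ f τ *
      barnes c (barnesPQ (1 / 2 - μ) τ) (Real.log x) =
      -(2 * Real.pi ^ 3) * ∫ y in Ioi x, (Real.sqrt y : ℂ) * f y := by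
  rw [integral_mul_barnesPQ _ hc0 hcμ hc1 hw]
  have e : barnes c (fun s => symbolPQ (1 / 2 - μ) s * gammaTransform (indexTransform μ f) s)
      (Real.log x) = Real.pi ^ 2 * barnes c (fun s => G (-s)) (Real.log x) := by
    rw [barnes, barnes, vint, vint, ← integral_const_mul]
    refine integral_congr_ae (Eventually.of_forall fun t => ?_)
    simp only
    rw [gammaTransform_indexTransform h0 h1 hm hα hβ hG hGe hw hc0 hc1 hcγ (vline_re c t)]
    have h3 := symbolPQ_mul_symbolPP_neg (b := 1 / 2 - μ) (G := G) (s := c + t * I) (by simpa)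
      (by simpa using hcμ) (by simpa using hc1)
    linear_combination (Real.pi : ℂ) ^ 2 * cexp (-(c + t * I) * (Real.log x : ℝ)) * h3
  rw [e, barnes_eq_integral_Ioi hγ h0 hm hα hβ hG hGe hc0 hcγ hline hx]
  ring

end Main

section

variable {μ : ℂ} {σ : ℝ}

/-- The factor cosh πτ in `cosh_mul_barnesPQ` combines with sinh πτ through sinh 2πτ = 2 sinh πτ
cosh πτ, and √π appears twice: once in the index transform, once in the kernel. -/
lemma expansion_integrand_eq (h0 : 0 < σ) (h1 : σ < 1 / 2 - μ.re) (h2 : σ < 1 / 2) (f : ℝ → ℂ)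
    {τ x : ℝ} (hτ : τ ≠ 0) (hx : 0 < x) :
    ((τ * Real.sinh (Real.pi * τ) : ℝ) : ℂ) * gammaProd μ τ * kernelPQ μ τ x *
        ∫ y in Ioi (0 : ℝ), kernelPP μ τ y * f y =
      Real.sqrt x / (4 * Real.pi ^ 2 * cexp (I * μ * Real.pi)) *
        (((τ * Real.sinh (2 * Real.pi * τ) : ℝ) : ℂ) * indexTransform μ f τ *
          barnes σ (barnesPQ (1 / 2 - μ) τ) (Real.log x)) := by
  have h3 := cosh_mul_barnesPQ hτ h0 h1 h2 (Real.log x)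
  rw [Real.exp_log hx] at h3
  have hpi : (Real.pi : ℂ) ≠ 0 := ofReal_ne_zero.2 Real.pi_ne_zero
  have hE := Complex.exp_ne_zero (I * μ * Real.pi)
  have hsx : (Real.sqrt x : ℂ) * cexp (-((Real.log x : ℝ) / 2)) = 1 := by
    rw [Real.sqrt_eq_rpow, Real.rpow_def_of_pos hx, ofReal_exp, ← Complex.exp_add]
    simp only [ofReal_mul]
    rw [← Complex.exp_zero]
    congr 1
    push_cast
    ring
  have hsp : (Real.sqrt Real.pi : ℂ) * (Real.sqrt Real.pi : ℂ) = Real.pi := by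
    rw [← ofReal_mul, Real.mul_self_sqrt Real.pi_pos.le]
  have hsinh : ((τ * Real.sinh (2 * Real.pi * τ) : ℝ) : ℂ) =
      2 * ((τ * Real.sinh (Real.pi * τ) : ℝ) : ℂ) * Real.cosh (Real.pi * τ) := by
    rw [mul_assoc 2 Real.pi τ, Real.sinh_two_mul]
    push_cast
    ring
  rw [hsinh, indexTransform]
  generalize (∫ y in Ioi (0 : ℝ), kernelPP μ τ y * f y) = J
  generalize barnes σ (barnesPQ (1 / 2 - μ) τ) (Real.log x) = B at *
  generalize cexp (I * μ * Real.pi) = E at *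
  generalize cexp (-((Real.log x : ℝ) / 2)) = X at *
  generalize (Real.sqrt x : ℂ) = S at *
  generalize (Real.sqrt Real.pi : ℂ) = R at *
  generalize ((Real.cosh (Real.pi * τ) : ℝ) : ℂ) = H at *
  generalize ((τ * Real.sinh (Real.pi * τ) : ℝ) : ℂ) = T
  generalize kernelPQ μ τ x = K at *
  generalize gammaProd μ τ = g
  rw [div_mul_eq_mul_div, eq_div_iff (mul_ne_zero (mul_ne_zero (by norm_num) (pow_ne_zero 2 hpi)) hE)]
  linear_combination (-(2 * S * T * R * g * J)) * h3 - 4 * T * g * J * K * Real.pi * E * R * R * hsx -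
    4 * T * g * J * K * Real.pi * E * hsp

lemma integrableOn_exp_of_memWeightedLp {f : ℝ → ℂ} {s : ℝ}
    (h : MemWeightedLp s 1 (Ioi 0) f) :
    IntegrableOn (fun y => Real.exp ((1 / 2 - (3 / 2 - s)) * Real.log y) * ‖f y‖) (Ioi 0) := by
  refine h.2.congr_fun (fun y hy => ?_) measurableSet_Ioi
  simp only
  rw [Real.rpow_one, Real.rpow_def_of_pos hy, mul_comm]
  congr 2
  ring

end

end LegendreIndex

end

/-! ### The expansion and the inversion formula -/

theorem theorem2 (μ : ℂ) (ν p q γ : ℝ) (f : ℝ → ℂ)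
    (hμ : μ.re < 1 / 2) (hp1 : 1 < p) (hp2 : p ≤ 2) (hq : q = p / (p - 1))
    (hν1 : -1 / (2 * q) < ν) (hν2 : ν < min 0 (-μ.re))
    (hf1 : LegendreIndex.MemWeightedLp (1 - ν) 1 (Set.Ioi 0) f)
    (hfp : LegendreIndex.MemWeightedLp (1 - ν) p (Set.Ioi 0) f)
    (hφ0 : LegendreIndex.MemWeightedLp (-1 / 4) 1 (Set.Ioo 0 1) (LegendreIndex.phi μ ν f))
    (hφ1 : LegendreIndex.MemWeightedLp (1 / 4) 1 (Set.Ioi 1) (LegendreIndex.phi μ ν f))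
    (hF : MeasureTheory.Integrable fun τ : ℝ =>
      ((|τ| * Real.exp (2 * Real.pi * |τ|) : ℝ) : ℂ) * LegendreIndex.indexTransform μ f τ)
    (hγ : γ < 0)
    (hfγ : LegendreIndex.MemWeightedLp (3 / 2 - γ) 1 (Set.Ioi 0) f)
    -- `f*(3/2-s)/s` is analytic in the open strip (the singularity at `s = 0` is removable)
    (hanalytic : ∃ G : ℂ → ℂ,
      DifferentiableOn ℂ G {s : ℂ | γ < s.re ∧ s.re < ν + 1 / 2} ∧
      ∀ s : ℂ, γ < s.re → s.re < ν + 1 / 2 → s ≠ 0 → G s = mellin f (3 / 2 - s) / s)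
    (hlines : ∀ σ ∈ Set.Icc γ (ν + 1 / 2),
      Complex.VerticalIntegrable (fun s : ℂ =>
        (((1 + ‖s‖) ^ (1 - 2 * s.re) : ℝ) : ℂ) * (mellin f (3 / 2 - s) / s)) σ) :
    -- the expansion of the antiderivative, with convergence of all the integrals in it
    (∀ τ : ℝ, MeasureTheory.IntegrableOn
      (fun y : ℝ => LegendreIndex.kernelPP μ τ y * f y) (Set.Ioi 0)) ∧
    (∀ x : ℝ, 0 < x →
      MeasureTheory.IntegrableOn (fun y : ℝ => (Real.sqrt y : ℂ) * f y) (Set.Ioi x) ∧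
      MeasureTheory.IntegrableOn (fun τ : ℝ =>
        ((τ * Real.sinh (Real.pi * τ) : ℝ) : ℂ) * LegendreIndex.gammaProd μ τ *
          LegendreIndex.kernelPQ μ τ x *
          ∫ y in Set.Ioi (0 : ℝ), LegendreIndex.kernelPP μ τ y * f y) (Set.Ioi 0) ∧
      ∫ y in Set.Ioi x, (Real.sqrt y : ℂ) * f y =
        -(2 * Complex.exp (Complex.I * μ * Real.pi) / (Real.pi * Real.sqrt x)) *
          ∫ τ in Set.Ioi (0 : ℝ),
            ((τ * Real.sinh (Real.pi * τ) : ℝ) : ℂ) * LegendreIndex.gammaProd μ τ *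
              LegendreIndex.kernelPQ μ τ x *
              ∫ y in Set.Ioi (0 : ℝ), LegendreIndex.kernelPP μ τ y * f y) ∧
    -- the inversion formula for the index transform
    (∀ c : ℝ, 3 / 2 < c → c < min 2 (2 - μ.re) →
      (∀ x : ℝ, 0 < x → MeasureTheory.IntegrableOn (fun τ : ℝ =>
        ((τ * Real.sinh (2 * Real.pi * τ) : ℝ) : ℂ) * LegendreIndex.kernelS μ c x τ *
          LegendreIndex.indexTransform μ f τ) (Set.Ioi 0)) ∧
      ∀ᵐ x : ℝ ∂(MeasureTheory.volume.restrict (Set.Ioi 0)),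
        DifferentiableAt ℝ
          (LegendreIndex.inverseIntegral μ c (LegendreIndex.indexTransform μ f)) x ∧
        f x = ((x ^ (-1 / 2 : ℝ) / Real.pi ^ 2 : ℝ) : ℂ) *
          deriv (LegendreIndex.inverseIntegral μ c (LegendreIndex.indexTransform μ f)) x) := by
  have hq0 : 2 ≤ q := by
    rw [hq, le_div_iff₀ (by linarith)]
    linarith
  -- p ≤ 2 gives q ≥ 2, hence ν > -1/4, and the line Re s = ν + 1/2 lies in the right half-plane.
  have hν0 : -(1 / 4) < ν := by
    refine lt_of_le_of_lt ?_ hν1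
    rw [neg_div, neg_le_neg_iff]
    exact one_div_le_one_div_of_le (by norm_num) (by linarith)
  have hνμ : ν < -μ.re := hν2.trans_le (min_le_right _ _)
  have hσ0 : 0 < ν + 1 / 2 := by linarith
  have hσμ : ν + 1 / 2 < 1 / 2 - μ.re := by linarith
  have hm := hf1.1
  have hα := LegendreIndex.integrableOn_exp_of_memWeightedLp hfγ
  have hβ := LegendreIndex.integrableOn_exp_of_memWeightedLp hf1
  rw [sub_sub_cancel] at hα
  rw [show 3 / 2 - (1 - ν) = ν + 1 / 2 by ring] at hβ
  obtain ⟨G, hG, hGe⟩ := hanalytic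
  -- Each bound on c has its use: -c stays in the strip of analyticity of G, c < 1/2 avoids the pole
  -- of Γ(2s+1) at -1/2 and that of Γ(1/2-s), and c < Re b avoids the first pole of Γ(b-s).
  obtain ⟨c, hc0, hc⟩ : ∃ c, 0 < c ∧ c < min (-γ) (min (1 / 2) (1 / 2 - μ.re)) :=
    exists_between (lt_min (by linarith) (lt_min (by norm_num) (by linarith)))
  have hcγ := hc.trans_le (min_le_left _ _)
  have hc1 : c < 1 / 2 := hc.trans_le ((min_le_right _ _).trans (min_le_left _ _))
  have hcμ : c < 1 / 2 - μ.re := hc.trans_le ((min_le_right _ _).trans (min_le_right _ _))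
  have hu := LegendreIndex.integrableOn_sqrt_mul hγ.le hσ0.le hm hα hβ
  have hmain : ∀ x : ℝ, 0 < x → _ := fun x hx =>
    LegendreIndex.integral_mul_barnesPQ_indexTransform (μ := μ) hγ hσ0 hσμ hm hα hβ hG hGe hF hc0 hc1
      hcμ (by linarith) (hlines (-c) ⟨by linarith, by linarith⟩) hx
  have hint : ∀ x : ℝ, _ := fun x => LegendreIndex.integrableOn_mul_barnesPQ
    (LegendreIndex.indexTransform μ f) hc0 hcμ hc1 hF (Real.log x)
  have hpi : (Real.pi : ℂ) ≠ 0 := ofReal_ne_zero.2 Real.pi_ne_zero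
  refine ⟨LegendreIndex.integrableOn_kernelPP_mul hσ0 hσμ hm hβ, fun x hx =>
    ⟨hu.mono_set (Ioi_subset_Ioi hx.le), ?_, ?_⟩, fun c' hc'1 hc'2 => ?_⟩
  · refine IntegrableOn.congr_fun ((hint x).const_mul
      (Real.sqrt x / (4 * Real.pi ^ 2 * cexp (I * μ * Real.pi)))) (fun τ hτ => ?_) measurableSet_Ioi
    rw [LegendreIndex.expansion_integrand_eq hc0 hcμ hc1 f (ne_of_gt hτ) hx]
  · rw [setIntegral_congr_fun measurableSet_Ioi fun τ hτ =>
      LegendreIndex.expansion_integrand_eq hc0 hcμ hc1 f (ne_of_gt hτ) hx,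
      integral_const_mul, hmain x hx]
    have hE := Complex.exp_ne_zero (I * μ * Real.pi)
    have hsx : (Real.sqrt x : ℂ) ≠ 0 := ofReal_ne_zero.2 (Real.sqrt_pos.2 hx).ne'
    generalize (∫ y in Ioi x, (Real.sqrt y : ℂ) * f y) = S
    generalize cexp (I * μ * Real.pi) = E at *
    field_simp
    norm_num
  -- The abscissa of S_μ is arbitrary in its range, yet the integral equals the one on Re s = c, so
  -- the estimates for that line apply.
  have hS : ∀ x : ℝ, 0 < x → ∀ τ : ℝ,
      ((τ * Real.sinh (2 * Real.pi * τ) : ℝ) : ℂ) * LegendreIndex.kernelS μ c' x τ *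
        LegendreIndex.indexTransform μ f τ =
      (((x ^ (3 / 2 : ℝ) : ℝ) : ℂ)⁻¹ * (2 * Real.pi : ℂ)⁻¹) *
        (((τ * Real.sinh (2 * Real.pi * τ) : ℝ) : ℂ) * LegendreIndex.indexTransform μ f τ *
          LegendreIndex.barnes c (LegendreIndex.barnesPQ (1 / 2 - μ) τ) (Real.log x)) := by
    intro x hx τ
    have h1 := LegendreIndex.mul_kernelS_eq_barnes hx hc'1 hc'2 hc0 hcμ hc1 τ
    have h2 : ((x ^ (3 / 2 : ℝ) : ℝ) : ℂ) ≠ 0 := ofReal_ne_zero.2 (Real.rpow_pos_of_pos hx _).ne'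
    rw [mul_comm] at h1
    rw [eq_div_of_mul_eq h2 h1, div_eq_inv_mul]
    ring
  -- The factor -2π³ from the expansion loses 2π to the normalisation of the inverse Mellin
  -- integral.
  have hI : ∀ x : ℝ, 0 < x → LegendreIndex.inverseIntegral μ c' (LegendreIndex.indexTransform μ f) x =
      -Real.pi ^ 2 * ∫ y in Ioi x, (Real.sqrt y : ℂ) * f y := by
    intro x hx
    have h2 : ((x ^ (3 / 2 : ℝ) : ℝ) : ℂ) ≠ 0 := ofReal_ne_zero.2 (Real.rpow_pos_of_pos hx _).ne'
    rw [LegendreIndex.inverseIntegral]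
    simp_rw [hS x hx]
    rw [integral_const_mul, hmain x hx]
    generalize ((x ^ (3 / 2 : ℝ) : ℝ) : ℂ) = X at *
    generalize (∫ y in Ioi x, (Real.sqrt y : ℂ) * f y) = S
    field_simp
  refine ⟨fun x hx => ?_, ?_⟩
  · simp_rw [hS x hx]
    exact (hint x).const_mul _
  -- The antiderivative has derivative -√x f(x) at almost every x, and the equality of functions on
  -- (0,∞) holds in a neighbourhood of each such x.
  · filter_upwards [LegendreIndex.ae_hasDerivAt_integral_Ioi hu,
      ae_restrict_mem measurableSet_Ioi] with x hx hx0
    have h1 : HasDerivAt (LegendreIndex.inverseIntegral μ c' (LegendreIndex.indexTransform μ f))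
        (-Real.pi ^ 2 * -((Real.sqrt x : ℂ) * f x)) x := by
      refine (hx.const_mul (-Real.pi ^ 2 : ℂ)).congr_of_eventuallyEq ?_
      filter_upwards [Ioi_mem_nhds hx0] with z hz
      exact hI z hz
    refine ⟨h1.differentiableAt, ?_⟩
    have h2 : ((x ^ (-1 / 2 : ℝ) / Real.pi ^ 2 : ℝ) : ℂ) * (Real.pi ^ 2 * Real.sqrt x) = 1 := by
      have : x ^ (-1 / 2 : ℝ) / Real.pi ^ 2 * (Real.pi ^ 2 * Real.sqrt x) = 1 := by
        rw [Real.sqrt_eq_rpow, ← mul_assoc, div_mul_cancel₀ _ (pow_ne_zero 2 Real.pi_ne_zero),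
          ← Real.rpow_add hx0]
        norm_num
      exact_mod_cast this
    rw [h1.deriv]
    linear_combination -f x * h2
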